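/- Let $A,B$ be separable complex Hilbert spaces, $\mathcal T(\cdot)$ the trace class operators, and let $\Delta:\mathcal T(A)\to\mathcal T(B)$ be a Hermitian-preserving superoperator, i.e. a difference of two completely positive linear maps. Let $H=\sum_k h_k|k\rangle\langle k|$ be a Hamiltonian on $A$ with an orthonormal eigenbasis $\{|k\rangle\}$, eigenvalues $h_k\ge 0$ and ground state energy $\inf_k h_k=0$; call $H$ discrete if $\{k:h_k\le e\}$ is finite for every $e$. Let $E>0$ and $$\|\Delta\|_{\diamond E}=\sup\{\|(\Delta\otimes\mathrm{id}_C)\rho\|_1:\ C\text{ a separable Hilbert space},\ \rho\text{ a state on }A\otimes C,\ \operatorname{tr}\rho^A H\le E\}.$$ Let $A'$ be a copy of $A$ and let $J=(\Delta\otimes\mathrm{id})|\Phi\rangle\langle\Phi|$, where $|\Phi\rangle=\sum_k|k\rangle|k\rangle$ is formal; that is, $J$ is the (in general singular) operator on $B\otimes A'$ with blocks $\langle k|J|l\rangle=\Delta(|k\rangle\langle l|)$. For bounded $V$ on $B\otimes A'$, $\operatorname{tr}JV$ denotes the limit, along the finite sets $F$ of basis indices, of $\operatorname{tr}J_FV$,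 where $J_F=(\Delta\otimes\mathrm{id})|\Phi_F\rangle\langle\Phi_F|$ and $|\Phi_F\rangle=\sum_{k\in F}|k\rangle|k\rangle$. Then $\|\Delta\|_{\diamond E}<\infty$, the limit $\operatorname{tr}JV$ exists and is real for all $(\rho,V)$ feasible below, and $$\|\Delta\|_{\diamond E}=\sup\ \operatorname{tr}JV\quad\text{s.t.}\quad -1\otimes\rho\le V\le 1\otimes\rho,\ \rho\ge0,\ \operatorname{tr}\rho=1,\ \operatorname{tr}\rho H\le E,$$ where the supremum is a maximum if $H$ is discrete. If moreover $\Delta$ is trace-annihilating, $\operatorname{tr}\Delta(\xi)=0$ for all $\xi$ (for instance, the difference of two completely positive trace preserving maps), then $$\tfrac12\|\Delta\|_{\diamond E}=\sup\ \operatorname{tr}JW\quad\text{s.t.}\quad 0\le W\le 1\otimes\rho,\ \rho\ge0,\ \operatorname{tr}\rho=1,\ \operatorname{tr}\rho H\le E,$$ where the supremum is again a maximum if $H$ is discrete, and $$\tfrac12\|\Delta\|_{\diamond E}=\min\ x+yE\quad\text{s.t.}\quad Z\ge J,\ Z\ge0,\ x,y\ge0,\ x1+yH\ge\operatorname{tr}_BZ,$$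 where the minimum is attained. Here $Z$ ranges over the possibly singular operators on $B\otimes A'$ given by trace class blocks $Z_{kl}=\langle k|Z|l\rangle\in\mathcal T(B)$, and the operator inequalities that involve $Z$ are inequalities of quadratic forms on the finite sums $\sum_k v_k\otimes|k\rangle$ with $v_k\in B$ (respectively, for the last one, on the finite sums $\sum_k c_k|k\rangle$ with $c_k\in\mathbb C$). -/

import Mathlib

open scoped TensorProduct InnerProductSpace ENNReal ComplexOrder
open Filter Topology

namespace ECDiamond

noncomputable section

section TraceClass

variable {K : Type*} [NormedAddCommGroup K] [InnerProductSpace ℂ K] [CompleteSpace K]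

variable (K) in
/-- The index set of a chosen orthonormal basis of `K`. -/
def StdIndex : Set K := Classical.choose (exists_hilbertBasis ℂ K)

variable (K) in
/-- A chosen orthonormal basis of `K`; traces are computed in it (they do not depend on it). -/
def stdBasis : HilbertBasis (StdIndex K) ℂ K :=
  Classical.choose (Classical.choose_spec (exists_hilbertBasis ℂ K))

/-- The trace norm `‖T‖₁ = tr √(T† T)`, with values in `[0, ∞]`. -/
def traceNorm (T : K →L[ℂ] K) : ℝ≥0∞ :=
  ∑' i, ENNReal.ofReal (⟪stdBasis K i, CFC.abs T (stdBasis K i)⟫_ℂ).re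

/-- The trace of a trace class operator. -/
def trace (T : K →L[ℂ] K) : ℂ :=
  ∑' i, ⟪stdBasis K i, T (stdBasis K i)⟫_ℂ

/-- The square of the Hilbert-Schmidt norm. -/
def hsSq (R : K →L[ℂ] K) : ℝ≥0∞ := ∑' i, ‖R (stdBasis K i)‖ₑ ^ 2

theorem tsum_enorm_inner_sq (x : K) : ∑' i, ‖⟪stdBasis K i, x⟫_ℂ‖ₑ ^ 2 = ‖x‖ₑ ^ 2 := by
  have h := Complex.hasSum_re ((stdBasis K).hasSum_inner_mul_inner x x)
  have e1 : (⟪x, x⟫_ℂ).re = ‖x‖ ^ 2 := inner_self_eq_norm_sq (𝕜 := ℂ) x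
  have e2 : ∀ i, (⟪x, stdBasis K i⟫_ℂ * ⟪stdBasis K i, x⟫_ℂ).re
      = ‖⟪stdBasis K i, x⟫_ℂ‖ ^ 2 := by
    intro i
    rw [← inner_conj_symm x (stdBasis K i), Complex.conj_mul', ← Complex.ofReal_pow,
      Complex.ofReal_re]
  rw [e1] at h
  simp only [e2] at h
  have h3 := ENNReal.ofReal_tsum_of_nonneg (fun i => sq_nonneg ‖⟪stdBasis K i, x⟫_ℂ‖) h.summable
  rw [h.tsum_eq] at h3
  simp only [ENNReal.ofReal_pow (norm_nonneg _), ofReal_norm] at h3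
  exact h3.symm

theorem hsSq_adjoint (R : K →L[ℂ] K) : hsSq (star R) = hsSq R := by
  unfold hsSq
  simp only [← tsum_enorm_inner_sq (K := K)]
  rw [ENNReal.tsum_comm]
  refine tsum_congr fun i => tsum_congr fun j => ?_
  rw [ContinuousLinearMap.star_eq_adjoint, ContinuousLinearMap.adjoint_inner_right,
    ← inner_conj_symm, ← ofReal_norm, ← ofReal_norm, RCLike.norm_conj]

theorem hsSq_mul_lt_top_left (C : K →L[ℂ] K) {R : K →L[ℂ] K} (hR : hsSq R < ∞) :
    hsSq (C * R) < ∞ := by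
  have h : hsSq (C * R) ≤ ‖C‖ₑ ^ 2 * hsSq R := by
    unfold hsSq
    rw [← ENNReal.tsum_mul_left]
    refine ENNReal.tsum_le_tsum fun i => ?_
    rw [← mul_pow]
    exact pow_le_pow_left₀ zero_le (C.le_opENorm _) 2
  refine h.trans_lt (ENNReal.mul_lt_top ?_ hR)
  exact ENNReal.pow_lt_top enorm_lt_top

theorem hsSq_mul_lt_top_right (C : K →L[ℂ] K) {R : K →L[ℂ] K} (hR : hsSq R < ∞) :
    hsSq (R * C) < ∞ := by
  rw [← hsSq_adjoint, star_mul]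
  exact hsSq_mul_lt_top_left _ (by rwa [hsSq_adjoint])

theorem exists_mul_eq_of_norm_eq (X Y : K →L[ℂ] K) (h : ∀ x, ‖Y x‖ = ‖X x‖) :
    ∃ W : K →L[ℂ] K, W * X = Y := by
  let M : Submodule ℂ K := X.range.topologicalClosure
  have hm : ∀ x, X x ∈ M := fun x => Submodule.le_topologicalClosure _ ⟨x, rfl⟩
  let e : K →ₗ[ℂ] M := X.toLinearMap.codRestrict M hm
  have hd : DenseRange e := by
    intro z
    rw [Metric.mem_closure_iff]
    intro ε hε
    have hz : (z : K) ∈ closure (X.range : Set K) := z.2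
    obtain ⟨_, ⟨x, rfl⟩, hx⟩ := Metric.mem_closure_iff.1 hz ε hε
    exact ⟨e x, ⟨x, rfl⟩, hx⟩
  have : CompleteSpace M := X.range.isClosed_topologicalClosure.completeSpace_coe
  refine ⟨(Y.toLinearMap.extendOfNorm e) ∘L M.orthogonalProjectionOnto, ?_⟩
  ext x
  have hp : M.orthogonalProjectionOnto (X x) = e x :=
    Submodule.orthogonalProjectionOnto_mem_subspace_eq_self (⟨X x, hm x⟩ : M)
  change Y.toLinearMap.extendOfNorm e (M.orthogonalProjectionOnto (X x)) = Y x
  rw [hp]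
  exact LinearMap.extendOfNorm_eq hd ⟨1, fun y => by rw [one_mul]; exact (h y).le⟩ x

theorem norm_abs_apply (T : K →L[ℂ] K) (x : K) : ‖CFC.abs T x‖ = ‖T x‖ := by
  have h : ∀ S : K →L[ℂ] K, ‖S x‖ ^ 2 = (⟪x, (star S * S) x⟫_ℂ).re := by
    intro S
    rw [ContinuousLinearMap.star_eq_adjoint]
    change _ = (⟪x, ContinuousLinearMap.adjoint S (S x)⟫_ℂ).re
    rw [ContinuousLinearMap.adjoint_inner_right]
    exact (inner_self_eq_norm_sq (𝕜 := ℂ) _).symm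
  have h1 := h (CFC.abs T)
  rw [(CFC.abs_nonneg T).isSelfAdjoint.star_eq, CFC.abs_mul_abs, ← h T] at h1
  exact (sq_eq_sq₀ (norm_nonneg _) (norm_nonneg _)).1 h1

theorem sum_mul_traceNorm {R₁ Q₁ R₂ Q₂ : K →L[ℂ] K} (h₁ : hsSq R₁ < ∞) (h₂ : hsSq Q₁ < ∞)
    (h₃ : hsSq R₂ < ∞) (h₄ : hsSq Q₂ < ∞) : traceNorm (R₁ * Q₁ + R₂ * Q₂) < ∞ := by
  set T := R₁ * Q₁ + R₂ * Q₂ with hT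
  obtain ⟨W, hW⟩ := exists_mul_eq_of_norm_eq T (CFC.abs T) (norm_abs_apply T)
  have key : ∀ (R Q : K →L[ℂ] K) (x : K),
      ‖⟪x, (W * (R * Q)) x⟫_ℂ‖ₑ ≤ ‖(star (W * R)) x‖ₑ ^ 2 + ‖Q x‖ₑ ^ 2 := by
    intro R Q x
    have e : ⟪x, (W * (R * Q)) x⟫_ℂ = ⟪(star (W * R)) x, Q x⟫_ℂ := by
      rw [ContinuousLinearMap.star_eq_adjoint, ContinuousLinearMap.adjoint_inner_left]; rfl
    rw [e]
    have h5 : ‖⟪(star (W * R)) x, Q x⟫_ℂ‖ₑ ≤ ‖(star (W * R)) x‖ₑ * ‖Q x‖ₑ := by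
      rw [← ofReal_norm, ← ofReal_norm, ← ofReal_norm,
        ← ENNReal.ofReal_mul (norm_nonneg _)]
      exact ENNReal.ofReal_le_ofReal (norm_inner_le_norm _ _)
    refine h5.trans ?_
    rcases le_total (‖(star (W * R)) x‖ₑ) (‖Q x‖ₑ) with h | h
    · rw [sq, sq]; exact (mul_le_mul_left h _).trans le_add_self
    · rw [sq, sq]; exact (mul_le_mul_right h _).trans le_self_add
  have bound : traceNorm T ≤ (hsSq (star (W * R₁)) + hsSq Q₁) +
      (hsSq (star (W * R₂)) + hsSq Q₂) := by
    unfold traceNorm hsSq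
    rw [← ENNReal.tsum_add, ← ENNReal.tsum_add, ← ENNReal.tsum_add]
    refine ENNReal.tsum_le_tsum fun i => ?_
    refine le_trans ?_ (add_le_add (key R₁ Q₁ _) (key R₂ Q₂ _))
    rw [← hW, hT, mul_add, add_apply, inner_add_right]
    refine le_trans ?_ (enorm_add_le _ _)
    rw [← ofReal_norm]
    exact ENNReal.ofReal_le_ofReal (Complex.re_le_norm _)
  refine bound.trans_lt ?_
  rw [hsSq_adjoint, hsSq_adjoint]
  exact ENNReal.add_lt_top.2 ⟨ENNReal.add_lt_top.2 ⟨hsSq_mul_lt_top_left _ h₁, h₂⟩,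
    ENNReal.add_lt_top.2 ⟨hsSq_mul_lt_top_left _ h₃, h₄⟩⟩

theorem hsSq_zero : hsSq (0 : K →L[ℂ] K) < ∞ := by simp [hsSq]

theorem exists_factor {T : K →L[ℂ] K} (hT : traceNorm T < ∞) :
    ∃ R Q : K →L[ℂ] K, hsSq R < ∞ ∧ hsSq Q < ∞ ∧ T = R * Q := by
  obtain ⟨V, hV⟩ := exists_mul_eq_of_norm_eq (CFC.abs T) T (fun x => (norm_abs_apply T x).symm)
  have hs : CFC.sqrt (CFC.abs T) * CFC.sqrt (CFC.abs T) = CFC.abs T :=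
    CFC.sqrt_mul_sqrt_self _ (CFC.abs_nonneg T)
  have hQ : hsSq (CFC.sqrt (CFC.abs T)) < ∞ := by
    refine lt_of_eq_of_lt ?_ hT
    unfold hsSq traceNorm
    refine tsum_congr fun i => ?_
    rw [← ofReal_norm, ← ENNReal.ofReal_pow (norm_nonneg _)]
    congr 1
    conv_rhs => rw [← hs]
    change _ = (⟪_, CFC.sqrt (CFC.abs T) (CFC.sqrt (CFC.abs T) (stdBasis K i))⟫_ℂ).re
    have hsa : ContinuousLinearMap.adjoint (CFC.sqrt (CFC.abs T)) = CFC.sqrt (CFC.abs T) :=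
      (CFC.sqrt_nonneg (CFC.abs T)).isSelfAdjoint.star_eq
    conv_rhs => rw [← ContinuousLinearMap.adjoint_inner_left, hsa]
    exact (inner_self_eq_norm_sq (𝕜 := ℂ) _).symm
  exact ⟨V * CFC.sqrt (CFC.abs T), CFC.sqrt (CFC.abs T), hsSq_mul_lt_top_left _ hQ, hQ,
    by rw [mul_assoc, hs, hV]⟩

theorem traceNorm_mul_lt_top {R Q : K →L[ℂ] K} (h₁ : hsSq R < ∞) (h₂ : hsSq Q < ∞) :
    traceNorm (R * Q) < ∞ := by
  simpa using sum_mul_traceNorm h₁ h₂ hsSq_zero hsSq_zero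

variable (K) in
/-- The space `𝒯(K)` of trace class operators, `‖T‖₁ < ∞`. -/
def TraceClass : Submodule ℂ (K →L[ℂ] K) where
  carrier := {T | traceNorm T < ∞}
  zero_mem' := by
    change traceNorm (0 : K →L[ℂ] K) < ∞
    simp [traceNorm]
  add_mem' := by
    rintro S T hS hT
    obtain ⟨R₁, Q₁, h₁, h₂, rfl⟩ := exists_factor hS
    obtain ⟨R₂, Q₂, h₃, h₄, rfl⟩ := exists_factor hT
    exact sum_mul_traceNorm h₁ h₂ h₃ h₄
  smul_mem' := by
    rintro c T hT
    obtain ⟨R, Q, h₁, h₂, rfl⟩ := exists_factor hT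
    change traceNorm (c • (R * Q)) < ∞
    have : c • (R * Q) = ((c • (1 : K →L[ℂ] K)) * R) * Q := by
      rw [smul_mul_assoc, one_mul, smul_mul_assoc]
    rw [this]
    exact traceNorm_mul_lt_top (hsSq_mul_lt_top_left _ h₁) h₂

theorem hsSq_rankOne (x y : K) : hsSq (InnerProductSpace.rankOne ℂ x y) < ∞ := by
  have : hsSq (InnerProductSpace.rankOne ℂ x y) = ‖x‖ₑ ^ 2 * ‖y‖ₑ ^ 2 := by
    unfold hsSq
    rw [← tsum_enorm_inner_sq y, ← ENNReal.tsum_mul_left]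
    refine tsum_congr fun i => ?_
    rw [InnerProductSpace.rankOne_apply, enorm_smul, mul_pow, mul_comm, ← inner_conj_symm,
      ← ofReal_norm (starRingEnd ℂ _), RCLike.norm_conj, ofReal_norm]
  rw [this]
  exact ENNReal.mul_lt_top (ENNReal.pow_lt_top enorm_lt_top) (ENNReal.pow_lt_top enorm_lt_top)

/-- The rank one operator `|x⟩⟨y|` as a trace class operator. -/
def ketBra (x y : K) : TraceClass K :=
  ⟨InnerProductSpace.rankOne ℂ x y, by
    by_cases hx : x = 0
    · subst hx; simp
    · have hn : (‖x‖ : ℂ) ≠ 0 := by simpa using hx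
      have : InnerProductSpace.rankOne ℂ x y = InnerProductSpace.rankOne ℂ x x *
          InnerProductSpace.rankOne ℂ (((‖x‖ : ℂ) ^ 2)⁻¹ • x) y := by
        ext z
        have hxx : ⟪x, x⟫_ℂ = (‖x‖ : ℂ) ^ 2 := inner_self_eq_norm_sq_to_K x
        change ⟪y, z⟫_ℂ • x = ⟪x, ⟪y, z⟫_ℂ • (((‖x‖ : ℂ) ^ 2)⁻¹ • x)⟫_ℂ • x
        rw [inner_smul_right, inner_smul_right, hxx, inv_mul_cancel₀ (pow_ne_zero 2 hn), mul_one]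
      change traceNorm _ < ∞
      rw [this]
      exact traceNorm_mul_lt_top (hsSq_rankOne _ _) (hsSq_rankOne _ _)⟩

end TraceClass

section Tensor

variable {K L : Type*} [NormedAddCommGroup K] [InnerProductSpace ℂ K]
  [NormedAddCommGroup L] [InnerProductSpace ℂ L] [CompleteSpace L]

/-- The Hilbert space tensor product: the completion of the algebraic tensor product. -/
abbrev HTensor (K L : Type*) [NormedAddCommGroup K] [InnerProductSpace ℂ K]
    [NormedAddCommGroup L] [InnerProductSpace ℂ L] : Type _ :=
  UniformSpace.Completion (K ⊗[ℂ] L)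

variable (K) in
/-- The map `K → K ⊗ L`, `a ↦ a ⊗ c`. -/
def tmulRight (c : L) : K →L[ℂ] HTensor K L :=
  UniformSpace.Completion.toComplL ∘L (TensorProduct.mkL ℂ K L).flip c

/-- The block `⟨c| T |d⟩ = (1 ⊗ ⟨c|) T (1 ⊗ |d⟩)`, an operator on `K`, of an operator `T` on
`K ⊗ L`. -/
def slice [CompleteSpace K] (T : HTensor K L →L[ℂ] HTensor K L) (c d : L) : K →L[ℂ] K :=
  ContinuousLinearMap.adjoint (tmulRight K c) ∘L T ∘L tmulRight K d

theorem inner_lTensor (S T : L →L[ℂ] L) (u v : K ⊗[ℂ] L) :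
    ⟪S.toLinearMap.lTensor K u, T.toLinearMap.lTensor K v⟫_ℂ =
      ⟪u, ((star S * T : L →L[ℂ] L).toLinearMap.lTensor K) v⟫_ℂ := by
  induction u with
  | zero => simp
  | add a b ha hb => rw [map_add, inner_add_left, inner_add_left, ha, hb]
  | tmul a b =>
    induction v with
    | zero => simp
    | add c d hc hd => rw [map_add, map_add, inner_add_right, inner_add_right, hc, hd]
    | tmul c d =>
      simp [TensorProduct.inner_tmul, ContinuousLinearMap.star_eq_adjoint,
        ContinuousLinearMap.adjoint_inner_right]

theorem norm_lTensor_le (T : L →L[ℂ] L) (u : K ⊗[ℂ] L) :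
    ‖T.toLinearMap.lTensor K u‖ ≤ ‖T‖ * ‖u‖ := by
  have h : 0 ≤ algebraMap ℝ (L →L[ℂ] L) (‖T‖ ^ 2) - star T * T := by
    rw [sub_nonneg]
    exact CStarAlgebra.star_mul_le_algebraMap_norm_sq
  obtain ⟨S, hS⟩ := CStarAlgebra.nonneg_iff_eq_star_mul_self.1 h
  have h1 := inner_lTensor T T u u
  have h2 := inner_lTensor S S u u
  rw [← hS] at h2
  have h3 : ⟪u, ((algebraMap ℝ (L →L[ℂ] L) (‖T‖ ^ 2) - star T * T :
      L →L[ℂ] L).toLinearMap.lTensor K) u⟫_ℂ = (‖T‖ ^ 2 : ℝ) * ⟪u, u⟫_ℂ -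
      ⟪u, ((star T * T : L →L[ℂ] L).toLinearMap.lTensor K) u⟫_ℂ := by
    have : (algebraMap ℝ (L →L[ℂ] L) (‖T‖ ^ 2) - star T * T : L →L[ℂ] L).toLinearMap
      = ((‖T‖ ^ 2 : ℝ) : ℂ) • LinearMap.id - (star T * T : L →L[ℂ] L).toLinearMap := by
      ext z
      simp only [Algebra.algebraMap_eq_smul_one, Complex.coe_smul]
      rfl
    rw [this, LinearMap.lTensor_sub, LinearMap.lTensor_smul, LinearMap.lTensor_id,
      LinearMap.sub_apply, inner_sub_right, LinearMap.smul_apply, inner_smul_right]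
    rfl
  rw [h3, ← h1] at h2
  have hn : ∀ w : K ⊗[ℂ] L, ⟪w, w⟫_ℂ = (‖w‖ : ℂ) ^ 2 := fun w => inner_self_eq_norm_sq_to_K w
  rw [hn, hn, hn] at h2
  have h4 : ‖S.toLinearMap.lTensor K u‖ ^ 2 = ‖T‖ ^ 2 * ‖u‖ ^ 2 -
      ‖T.toLinearMap.lTensor K u‖ ^ 2 := by exact_mod_cast h2
  refine le_of_sq_le_sq ?_ (by positivity)
  nlinarith [sq_nonneg ‖S.toLinearMap.lTensor K u‖]

variable (K) in
/-- The operator `1 ⊗ T` on the Hilbert space `K ⊗ L`. -/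
def oneTensor (T : L →L[ℂ] L) : HTensor K L →L[ℂ] HTensor K L :=
  ((T.toLinearMap.lTensor K).mkContinuous ‖T‖ (norm_lTensor_le T)).completion

theorem oneTensor_tmul (T : L →L[ℂ] L) (a : K) (c : L) :
    oneTensor K T (tmulRight K c a) = tmulRight K (T c) a := by
  change (ContinuousLinearMap.completion _) ((a ⊗ₜ[ℂ] c : K ⊗[ℂ] L) : HTensor K L) = 
    ((a ⊗ₜ[ℂ] (T c) : K ⊗[ℂ] L) : HTensor K L)
  simp

end Tensor

section States

variable {K L : Type*} [NormedAddCommGroup K] [InnerProductSpace ℂ K] [CompleteSpace K]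
  [NormedAddCommGroup L] [InnerProductSpace ℂ L] [CompleteSpace L]

/-- States (density operators): positive trace class operators of trace one. -/
structure IsState (ρ : K →L[ℂ] K) : Prop where
  nonneg : 0 ≤ ρ
  mem_traceClass : ρ ∈ TraceClass K
  trace_eq_one : trace ρ = 1

/-- `ρK` is the partial trace over `L` of the operator `ρ` on `K ⊗ L`. -/
def IsPartialTrace (ρ : HTensor K L →L[ℂ] HTensor K L) (ρK : K →L[ℂ] K) : Prop :=
  ∀ a b : K, HasSum (fun j => ⟪a, slice ρ (stdBasis L j) (stdBasis L j) b⟫_ℂ) ⟪a, ρK b⟫_ℂ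

/-- An operator (possibly unbounded, or merely formal) on `K ⊗ L` that is given by its blocks
`X i j = ⟨i| X |j⟩` with respect to an orthonormal basis of `L` is positive semidefinite: its
quadratic form is nonnegative on all finite sums `∑ i, v i ⊗ |i⟩`. -/
def BlockNonneg {κ : Type*} (X : κ → κ → K →L[ℂ] K) : Prop :=
  ∀ (s : Finset κ) (v : κ → K), 0 ≤ ∑ i ∈ s, ∑ j ∈ s, ⟪v i, X i j (v j)⟫_ℂ

end States

section Superoperators

variable {A B : Type*} [NormedAddCommGroup A] [InnerProductSpace ℂ A] [CompleteSpace A]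
  [NormedAddCommGroup B] [InnerProductSpace ℂ B] [CompleteSpace B]

/-- Complete positivity of `Φ : 𝒯(A) → 𝒯(B)`: for every `n`, the map `Φ ⊗ id` on `n × n` block
matrices preserves positivity. -/
def IsCompletelyPositive (Φ : TraceClass A →ₗ[ℂ] TraceClass B) : Prop :=
  ∀ (n : ℕ) (X : Fin n → Fin n → TraceClass A),
    BlockNonneg (fun i j => (X i j : A →L[ℂ] A)) →
      BlockNonneg (fun i j => (Φ (X i j) : B →L[ℂ] B))

/-- Hermitian-preserving superoperators, that is, differences of completely positive maps. -/
def IsHermitianPreserving (Δ : TraceClass A →ₗ[ℂ] TraceClass B) : Prop :=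
  ∃ Φ Ψ : TraceClass A →ₗ[ℂ] TraceClass B,
    IsCompletelyPositive Φ ∧ IsCompletelyPositive Ψ ∧ Δ = Φ - Ψ

/-- Trace-annihilating superoperators: `tr Δ(ξ) = 0` for all `ξ`. -/
def IsTraceAnnihilating (Δ : TraceClass A →ₗ[ℂ] TraceClass B) : Prop :=
  ∀ X : TraceClass A, trace (Δ X : B →L[ℂ] B) = 0

/-- `σ = (Δ ⊗ id_C) ρ`: the map `Δ` is applied to every block `⟨c| ρ |d⟩` of `ρ`. -/
def IsAmplification {C : Type*} [NormedAddCommGroup C] [InnerProductSpace ℂ C]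
    (Δ : TraceClass A →ₗ[ℂ] TraceClass B) (ρ : HTensor A C →L[ℂ] HTensor A C)
    (σ : HTensor B C →L[ℂ] HTensor B C) : Prop :=
  ∀ c d : C, ∃ X : TraceClass A, (X : A →L[ℂ] A) = slice ρ c d ∧
    slice σ c d = (Δ X : B →L[ℂ] B)

/-- A Hamiltonian `H = ∑ k, level k • |k⟩⟨k| ≥ 0` (in general unbounded) with an orthonormal
eigenbasis. -/
structure Hamiltonian (ι A : Type*) [NormedAddCommGroup A] [InnerProductSpace ℂ A] where
  basis : HilbertBasis ι ℂ A
  level : ι → ℝ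
  level_nonneg : ∀ k, 0 ≤ level k

variable {ι : Type*}

/-- The ground state energy is `0`. -/
def Hamiltonian.IsGrounded (H : Hamiltonian ι A) : Prop := IsGLB (Set.range H.level) 0

/-- Every spectral projection `{H ≤ E}` has finite rank. -/
def Hamiltonian.IsDiscrete (H : Hamiltonian ι A) : Prop := ∀ E : ℝ, {k | H.level k ≤ E}.Finite

/-- The mean energy `tr ρ H ∈ [0, ∞]` of a positive operator. -/
def Hamiltonian.meanEnergy (H : Hamiltonian ι A) (ρ : A →L[ℂ] A) : ℝ≥0∞ :=
  ∑' k, ENNReal.ofReal (H.level k * (⟪H.basis k, ρ (H.basis k)⟫_ℂ).re)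

/-- The energy-constrained diamond norm: the supremum of `‖(Δ ⊗ id_C) ρ‖₁` over all separable
reference systems `C` and all states `ρ` on `A ⊗ C` with `tr ρ^A H ≤ E`. -/
def ecDiamondNorm (Δ : TraceClass A →ₗ[ℂ] TraceClass B) (H : Hamiltonian ι A) (E : ℝ) : ℝ≥0∞ :=
  sSup {r | ∃ (C : Type) (_ : NormedAddCommGroup C) (_ : InnerProductSpace ℂ C)
    (_ : CompleteSpace C) (_ : TopologicalSpace.SeparableSpace C)
    (ρ : HTensor A C →L[ℂ] HTensor A C) (ρA : A →L[ℂ] A) (σ : HTensor B C →L[ℂ] HTensor B C),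
    IsState ρ ∧ IsPartialTrace ρ ρA ∧ H.meanEnergy ρA ≤ ENNReal.ofReal E ∧
      IsAmplification Δ ρ σ ∧ r = traceNorm σ}

/-- The blocks `⟨k| J |l⟩ = Δ(|k⟩⟨l|)` of the (singular) operator `J = (Δ ⊗ id) |Φ⟩⟨Φ|` on
`B ⊗ A'`, where `A'` is a copy of `A` and `|Φ⟩ = ∑ n, |n⟩|n⟩` in the eigenbasis of `H`. -/
def choi (Δ : TraceClass A →ₗ[ℂ] TraceClass B) (H : Hamiltonian ι A) (k l : ι) : TraceClass B :=
  Δ (ketBra (H.basis k) (H.basis l))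

/-- `tr J_F V` for `J_F = (Δ ⊗ id) |Φ_F⟩⟨Φ_F|`, `|Φ_F⟩ = ∑ k ∈ F, |k⟩|k⟩`, with `F` finite. -/
def truncTrace (Δ : TraceClass A →ₗ[ℂ] TraceClass B) (H : Hamiltonian ι A)
    (V : HTensor B A →L[ℂ] HTensor B A) (F : Finset ι) : ℂ :=
  ∑ k ∈ F, ∑ l ∈ F,
    trace ((choi Δ H k l : B →L[ℂ] B) ∘L slice V (H.basis l) (H.basis k))

/-- `tr J V = t`, understood as the limit of `tr J_F V` along the finite sets `F` of basis
vectors. -/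
def HasTraceAgainstChoi (Δ : TraceClass A →ₗ[ℂ] TraceClass B) (H : Hamiltonian ι A)
    (V : HTensor B A →L[ℂ] HTensor B A) (t : ℝ) : Prop :=
  Tendsto (truncTrace Δ H V) atTop (𝓝 (t : ℂ))

/-- Feasibility for the general programme:
`-1 ⊗ ρ ≤ V ≤ 1 ⊗ ρ`, `ρ ≥ 0`, `tr ρ = 1`, `tr ρ H ≤ E`. -/
def IsFeasible (H : Hamiltonian ι A) (E : ℝ) (ρ : A →L[ℂ] A)
    (V : HTensor B A →L[ℂ] HTensor B A) : Prop :=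
  IsState ρ ∧ H.meanEnergy ρ ≤ ENNReal.ofReal E ∧ -oneTensor B ρ ≤ V ∧ V ≤ oneTensor B ρ

/-- The objective values `tr J V` of the general programme. -/
def primalValues (Δ : TraceClass A →ₗ[ℂ] TraceClass B) (H : Hamiltonian ι A) (E : ℝ) : Set ℝ :=
  {t | ∃ (ρ : A →L[ℂ] A) (V : HTensor B A →L[ℂ] HTensor B A),
    IsFeasible H E ρ V ∧ HasTraceAgainstChoi Δ H V t}

/-- The objective values `tr J W` of the simplified primal programme, whose constraints are
`0 ≤ W ≤ 1 ⊗ ρ`, `ρ ≥ 0`, `tr ρ = 1`, `tr ρ H ≤ E`. -/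
def simplifiedPrimalValues (Δ : TraceClass A →ₗ[ℂ] TraceClass B) (H : Hamiltonian ι A) (E : ℝ) :
    Set ℝ :=
  {t | ∃ (ρ : A →L[ℂ] A) (W : HTensor B A →L[ℂ] HTensor B A),
    IsState ρ ∧ H.meanEnergy ρ ≤ ENNReal.ofReal E ∧ 0 ≤ W ∧ W ≤ oneTensor B ρ ∧
      HasTraceAgainstChoi Δ H W t}

/-- The inequality `tr_B Z ≤ x 1 + y H`, as an inequality of quadratic forms on the finite linear
combinations of eigenvectors of `H`; `Z` is given by its blocks in the eigenbasis. -/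
def PartialTraceLE (H : Hamiltonian ι A) (Z : ι → ι → TraceClass B) (x y : ℝ) : Prop :=
  ∀ (s : Finset ι) (c : ι → ℂ),
    ∑ k ∈ s, ∑ l ∈ s, starRingEnd ℂ (c k) * trace (Z k l : B →L[ℂ] B) * c l ≤
      ((∑ k ∈ s, (x + y * H.level k) * ‖c k‖ ^ 2 : ℝ) : ℂ)

/-- The objective values `x + y E` of the dual programme, whose constraints are `Z ≥ J`, `Z ≥ 0`,
`x, y ≥ 0` and `x 1 + y H ≥ tr_B Z`. Like `J`, the variable `Z` is a possibly singular operator on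
`B ⊗ A'` with trace class blocks `Z k l = ⟨k| Z |l⟩` in the eigenbasis of `H`. -/
def dualValues (Δ : TraceClass A →ₗ[ℂ] TraceClass B) (H : Hamiltonian ι A) (E : ℝ) : Set ℝ :=
  {t | ∃ (Z : ι → ι → TraceClass B) (x y : ℝ),
    BlockNonneg (fun k l => ((Z k l - choi Δ H k l : TraceClass B) : B →L[ℂ] B)) ∧
    BlockNonneg (fun k l => (Z k l : B →L[ℂ] B)) ∧
    0 ≤ x ∧ 0 ≤ y ∧ PartialTraceLE H Z x y ∧ t = x + y * E}

end Superoperators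

end

end ECDiamond

open ECDiamond

set_option linter.unusedSectionVars false

/-! Everything is compared with a family of finite programmes, `finValues`: for a finite set `F` of
eigenvectors of `H`, the blocks of `J` in `F` are paired with a block operator `V` lying between `-1
⊗ R` and `1 ⊗ R`, where `R ≥ 0` is a matrix of trace at most one and energy at most `E`. The trace
is only bounded by one because compressing a state to `F` may lose weight. The primal supremum and
the diamond norm both equal the supremum of these values.

For the primal programme, compression to `F` gives one inequality (`IsFeasible.finFeasible`). For
the other, a finite point is perturbed so that `R` is positive definite and the energy has slack
(`FinFeasible.exists_strict`); the missing trace is then put on an eigenvector of very low energy,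
which exists since the ground energy is zero (`StrictFeasible.mem_primalValues`).

For the diamond norm, `(Δ ⊗ id) ρ` is tested against a contraction `X`. Contracting the reference
system of `ρ` with that of `X` turns `X` into blocks `V` bounded by `1 ⊗ R`, with `R` the transposed
truncated marginal of `ρ` (`re_sum_blocks_le`). Conversely `R = m† m` with `m` invertible yields a
purification, and conjugating `V` by the inverse of `m` yields a self-adjoint contraction that tests
the output (`StrictFeasible.le_traceNorm`).

Completely positive maps on the trace class are automatically bounded (`exists_trace_bound`), and
the Cauchy-Schwarz inequality for positive matrices shows that truncation to `F` costs at most a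
constant times the square root of the weight of `ρ` outside `F` (`exists_tail_bound`). Hence `tr J
V` exists. If `H` is discrete, the energy bound makes this weight uniformly small, so no trace
escapes in a weak limit of a maximising sequence and the objective converges along it
(`mem_primalValues_of_isLUB`).

If `Δ` is trace-annihilating, `1 ⊗ ρ` pairs to zero with `J`, and `V = 2 W - 1 ⊗ ρ` identifies the
two primal programmes. Weak duality is the chain `tr J W ≤ tr Z W ≤ tr Z (1 ⊗ R) ≤ x + y E`. The
dual optimum comes from the M. Riesz extension theorem on the purely algebraic space of finite block
matrices (`exists_dual_functional`): no closedness or interior in any topology is required, and the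
bound is met exactly. The values of the functional on rank one operators define the blocks of `Z`.
Discarding its remaining, possibly singular, part can only lower `tr_B Z`, so the blocks are trace
class and feasible (`gram_blocks_mem`). -/

namespace ECDiamond

noncomputable section

/-! ### Trace norm estimates and the trace as a linear functional -/

section TraceClass

variable {K : Type*} [NormedAddCommGroup K] [InnerProductSpace ℂ K] [CompleteSpace K]

theorem nonneg_iff_inner {T : K →L[ℂ] K} : 0 ≤ T ↔ ∀ x, 0 ≤ ⟪x, T x⟫_ℂ := by
  rw [ContinuousLinearMap.nonneg_iff_isPositive]
  refine ⟨fun h x => h.inner_nonneg_right x, fun h => ?_⟩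
  rw [ContinuousLinearMap.isPositive_iff_complex]
  intro x
  have h1 := h x
  rw [← inner_conj_symm, Complex.nonneg_iff] at h1
  simp only [Complex.conj_re, Complex.conj_im] at h1
  refine ⟨?_, h1.1⟩
  apply Complex.ext
  · simp
  · rw [Complex.ofReal_im]; linarith [h1.2]

theorem adjoint_of_nonneg {T : K →L[ℂ] K} (h : 0 ≤ T) : ContinuousLinearMap.adjoint T = T :=
  h.isSelfAdjoint.star_eq

/-- The assignment `X x ↦ Y x` is isometric on the range of `X`; it extends to the closure and is
precomposed with the orthogonal projection. This is the polar decomposition with control of the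
norm, applied both as `T = U |T|` and as `|T| = W T`. -/
theorem exists_contraction_mul_eq (X Y : K →L[ℂ] K) (h : ∀ x, ‖Y x‖ = ‖X x‖) :
    ∃ W : K →L[ℂ] K, ‖W‖ ≤ 1 ∧ W * X = Y := by
  let M : Submodule ℂ K := X.range.topologicalClosure
  have hm : ∀ x, X x ∈ M := fun x => Submodule.le_topologicalClosure _ ⟨x, rfl⟩
  let e : K →ₗ[ℂ] M := X.toLinearMap.codRestrict M hm
  have hd : DenseRange e := by
    intro z
    rw [Metric.mem_closure_iff]
    intro ε hε
    have hz : (z : K) ∈ closure (X.range : Set K) := z.2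
    obtain ⟨_, ⟨x, rfl⟩, hx⟩ := Metric.mem_closure_iff.1 hz ε hε
    exact ⟨e x, ⟨x, rfl⟩, hx⟩
  have : CompleteSpace M := X.range.isClosed_topologicalClosure.completeSpace_coe
  refine ⟨(Y.toLinearMap.extendOfNorm e) ∘L M.orthogonalProjectionOnto, ?_, ?_⟩
  · refine (ContinuousLinearMap.opNorm_comp_le _ _).trans ?_
    exact mul_le_one₀ (LinearMap.opNorm_extendOfNorm_le hd zero_le_one
      fun y => by rw [one_mul]; exact (h y).le) (norm_nonneg _)
      (Submodule.orthogonalProjectionOnto_norm_le _)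
  ext x
  have hp : M.orthogonalProjectionOnto (X x) = e x :=
    Submodule.orthogonalProjectionOnto_mem_subspace_eq_self (⟨X x, hm x⟩ : M)
  change Y.toLinearMap.extendOfNorm e (M.orthogonalProjectionOnto (X x)) = Y x
  rw [hp]
  exact LinearMap.extendOfNorm_eq hd ⟨1, fun y => by rw [one_mul]; exact (h y).le⟩ x

theorem hsSq_mul_le_left (C R : K →L[ℂ] K) : hsSq (C * R) ≤ ‖C‖ₑ ^ 2 * hsSq R := by
  unfold hsSq
  rw [← ENNReal.tsum_mul_left]
  refine ENNReal.tsum_le_tsum fun i => ?_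
  rw [← mul_pow]
  exact pow_le_pow_left₀ zero_le (C.le_opENorm _) 2

theorem enorm_star (C : K →L[ℂ] K) : ‖star C‖ₑ = ‖C‖ₑ := by
  rw [← ofReal_norm, ← ofReal_norm, norm_star]

theorem hsSq_mul_le_right (R C : K →L[ℂ] K) : hsSq (R * C) ≤ ‖C‖ₑ ^ 2 * hsSq R := by
  rw [← hsSq_adjoint, star_mul, ← hsSq_adjoint R, ← enorm_star C]
  exact hsSq_mul_le_left _ _

theorem hsSq_add_lt_top {R Q : K →L[ℂ] K} (hR : hsSq R < ∞) (hQ : hsSq Q < ∞) :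
    hsSq (R + Q) < ∞ := by
  have h : hsSq (R + Q) ≤ 2 * (hsSq R + hsSq Q) := by
    unfold hsSq
    rw [← ENNReal.tsum_add, ← ENNReal.tsum_mul_left]
    refine ENNReal.tsum_le_tsum fun i => ?_
    rw [add_apply, ← ofReal_norm, ← ofReal_norm, ← ofReal_norm,
      ← ENNReal.ofReal_pow (norm_nonneg _), ← ENNReal.ofReal_pow (norm_nonneg _),
      ← ENNReal.ofReal_pow (norm_nonneg _), ← ENNReal.ofReal_add (by positivity) (by positivity),
      ← ENNReal.ofReal_ofNat, ← ENNReal.ofReal_mul (by norm_num)]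
    refine ENNReal.ofReal_le_ofReal ?_
    have := pow_le_pow_left₀ (norm_nonneg _) (norm_add_le (R (stdBasis K i)) (Q (stdBasis K i))) 2
    nlinarith [sq_nonneg (‖R (stdBasis K i)‖ - ‖Q (stdBasis K i)‖)]
  refine h.trans_lt (ENNReal.mul_lt_top (by simp) (ENNReal.add_lt_top.2 ⟨hR, hQ⟩))

theorem hsSq_smul_lt_top (c : ℂ) {R : K →L[ℂ] K} (hR : hsSq R < ∞) : hsSq (c • R) < ∞ := by
  have : c • R = (c • (1 : K →L[ℂ] K)) * R := by rw [smul_mul_assoc, one_mul]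
  rw [this]
  exact hsSq_mul_lt_top_left _ hR

/-- Cauchy-Schwarz in the arithmetic mean form, which loses nothing when both factors obey the same
bound. -/
theorem tsum_enorm_inner_mul_le (R Q : K →L[ℂ] K) :
    2 * ∑' i, ‖⟪stdBasis K i, (R * Q) (stdBasis K i)⟫_ℂ‖ₑ ≤ hsSq R + hsSq Q := by
  rw [← hsSq_adjoint R]
  unfold hsSq
  rw [← ENNReal.tsum_add, ← ENNReal.tsum_mul_left]
  refine ENNReal.tsum_le_tsum fun i => ?_
  have e : ⟪stdBasis K i, (R * Q) (stdBasis K i)⟫_ℂ =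
      ⟪(star R) (stdBasis K i), Q (stdBasis K i)⟫_ℂ := by
    rw [ContinuousLinearMap.star_eq_adjoint, ContinuousLinearMap.adjoint_inner_left]; rfl
  rw [e, ← ofReal_norm, ← ofReal_norm, ← ofReal_norm,
      ← ENNReal.ofReal_pow (norm_nonneg _),
      ← ENNReal.ofReal_pow (norm_nonneg _), ← ENNReal.ofReal_add (by positivity) (by positivity),
      ← ENNReal.ofReal_ofNat, ← ENNReal.ofReal_mul (by norm_num)]
  refine ENNReal.ofReal_le_ofReal ?_
  have := norm_inner_le_norm (𝕜 := ℂ) ((star R) (stdBasis K i)) (Q (stdBasis K i))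
  nlinarith [sq_nonneg (‖(star R) (stdBasis K i)‖ - ‖Q (stdBasis K i)‖)]

theorem hsSq_sqrt_abs (T : K →L[ℂ] K) : hsSq (CFC.sqrt (CFC.abs T)) = traceNorm T := by
  have hs : CFC.sqrt (CFC.abs T) * CFC.sqrt (CFC.abs T) = CFC.abs T :=
    CFC.sqrt_mul_sqrt_self _ (CFC.abs_nonneg T)
  unfold hsSq traceNorm
  refine tsum_congr fun i => ?_
  rw [← ofReal_norm, ← ENNReal.ofReal_pow (norm_nonneg _)]
  congr 1
  conv_rhs => rw [← hs]
  change _ = (⟪_, CFC.sqrt (CFC.abs T) (CFC.sqrt (CFC.abs T) (stdBasis K i))⟫_ℂ).re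
  have hsa : ContinuousLinearMap.adjoint (CFC.sqrt (CFC.abs T)) = CFC.sqrt (CFC.abs T) :=
    (CFC.sqrt_nonneg (CFC.abs T)).isSelfAdjoint.star_eq
  conv_rhs => rw [← ContinuousLinearMap.adjoint_inner_left, hsa]
  exact (inner_self_eq_norm_sq (𝕜 := ℂ) _).symm

theorem enorm_le_one {C : K →L[ℂ] K} (h : ‖C‖ ≤ 1) : ‖C‖ₑ ≤ 1 := by
  rw [← ofReal_norm]; exact ENNReal.ofReal_le_one.2 h

/-- With `T = U |T|` and `S = √|T|`, the product splits as `(U S) (S Y)`, and both factors have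
squared Hilbert-Schmidt norm at most `‖T‖₁`. This gives absolute convergence of the trace and the
duality bound. -/
theorem tsum_enorm_inner_le_traceNorm (T Y : K →L[ℂ] K) (hY : ‖Y‖ ≤ 1) :
    ∑' i, ‖⟪stdBasis K i, (T * Y) (stdBasis K i)⟫_ℂ‖ₑ ≤ traceNorm T := by
  obtain ⟨U, hU1, hU⟩ :=
    exists_contraction_mul_eq (CFC.abs T) T (fun x => (norm_abs_apply T x).symm)
  set S := CFC.sqrt (CFC.abs T) with hS
  have hs : S * S = CFC.abs T := CFC.sqrt_mul_sqrt_self _ (CFC.abs_nonneg T)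
  have h1 := tsum_enorm_inner_mul_le (U * S) (S * Y)
  have e : U * S * (S * Y) = T * Y := by
    rw [← hU, ← hs]; simp only [mul_assoc]
  rw [e] at h1
  have h2 : hsSq (U * S) ≤ traceNorm T := by
    refine (hsSq_mul_le_left _ _).trans ?_
    rw [hsSq_sqrt_abs]
    exact mul_le_of_le_one_left' (pow_le_one' (enorm_le_one hU1) 2)
  have h3 : hsSq (S * Y) ≤ traceNorm T := by
    refine (hsSq_mul_le_right _ _).trans ?_
    rw [hsSq_sqrt_abs]
    exact mul_le_of_le_one_left' (pow_le_one' (enorm_le_one hY) 2)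
  have h4 := h1.trans (add_le_add h2 h3)
  rw [← two_mul] at h4
  exact (ENNReal.mul_le_mul_iff_right (by simp) (by simp)).1 h4

theorem mul_mem_traceClass {T : K →L[ℂ] K} (hT : T ∈ TraceClass K) (Y : K →L[ℂ] K) :
    T * Y ∈ TraceClass K := by
  obtain ⟨R, Q, h₁, h₂, rfl⟩ := exists_factor hT
  rw [mul_assoc]
  exact traceNorm_mul_lt_top h₁ (hsSq_mul_lt_top_right _ h₂)

theorem star_mem_traceClass {T : K →L[ℂ] K} (hT : T ∈ TraceClass K) : star T ∈ TraceClass K := by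
  obtain ⟨R, Q, h₁, h₂, rfl⟩ := exists_factor hT
  rw [star_mul]
  exact traceNorm_mul_lt_top (by rwa [hsSq_adjoint]) (by rwa [hsSq_adjoint])

theorem summable_trace {T : K →L[ℂ] K} (hT : T ∈ TraceClass K) :
    Summable fun i => ⟪stdBasis K i, T (stdBasis K i)⟫_ℂ := by
  have h := (tsum_enorm_inner_le_traceNorm T 1 ContinuousLinearMap.norm_id_le).trans_lt hT
  rw [mul_one] at h
  exact Summable.of_enorm h.ne

theorem hasSum_trace {T : K →L[ℂ] K} (hT : T ∈ TraceClass K) :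
    HasSum (fun i => ⟪stdBasis K i, T (stdBasis K i)⟫_ℂ) (trace T) := (summable_trace hT).hasSum

theorem norm_trace_mul_le {T : K →L[ℂ] K} (hT : T ∈ TraceClass K) (Y : K →L[ℂ] K) :
    ‖trace (T * Y)‖ ≤ ‖Y‖ * (traceNorm T).toReal := by
  have key : ∀ Y : K →L[ℂ] K, ‖Y‖ ≤ 1 → ‖trace (T * Y)‖ ≤ (traceNorm T).toReal := by
    intro Y hY
    have h := (tsum_enorm_inner_le_traceNorm T Y hY)
    have h2 : ‖trace (T * Y)‖ₑ ≤ traceNorm T := enorm_tsum_le_tsum_enorm.trans h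
    rw [← ofReal_norm] at h2
    exact (ENNReal.ofReal_le_iff_le_toReal hT.ne).1 h2
  by_cases h0 : Y = 0
  · subst h0; simp [trace]
  have hn : 0 < ‖Y‖ := norm_pos_iff.2 h0
  have h1 := key (((‖Y‖⁻¹ : ℝ) : ℂ) • Y) (by
    rw [norm_smul, Complex.norm_real, norm_inv, norm_norm, inv_mul_cancel₀ hn.ne'])
  have h2 : trace (T * (((‖Y‖⁻¹ : ℝ) : ℂ) • Y)) = ((‖Y‖⁻¹ : ℝ) : ℂ) * trace (T * Y) := by
    unfold trace
    rw [← tsum_mul_left]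
    refine tsum_congr fun i => ?_
    rw [mul_smul_comm, smul_apply, inner_smul_right]
  rw [h2, norm_mul, Complex.norm_real, norm_inv, norm_norm, inv_mul_le_iff₀ hn] at h1
  exact h1

variable (K) in
/-- The trace as a linear functional on `𝒯(K)`. -/
def traceL : TraceClass K →ₗ[ℂ] ℂ where
  toFun T := trace (T : K →L[ℂ] K)
  map_add' S T := by
    refine HasSum.tsum_eq ?_
    refine ((hasSum_trace S.2).add (hasSum_trace T.2)).congr_fun fun i => ?_
    simp
  map_smul' c T := by
    refine HasSum.tsum_eq ?_
    refine ((hasSum_trace T.2).mul_left c).congr_fun fun i => ?_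
    simp

theorem traceL_apply (T : TraceClass K) : traceL K T = trace (T : K →L[ℂ] K) := rfl

/-- The functional `T ↦ tr (T Y)` on `𝒯(K)`. -/
def traceMulL (Y : K →L[ℂ] K) : TraceClass K →ₗ[ℂ] ℂ where
  toFun T := trace ((T : K →L[ℂ] K) * Y)
  map_add' S T := by
    have := (traceL K).map_add ⟨S * Y, mul_mem_traceClass S.2 Y⟩ ⟨T * Y, mul_mem_traceClass T.2 Y⟩
    simp only [traceL_apply] at this
    rw [← this]
    simp [add_mul]
  map_smul' c T := by
    have := (traceL K).map_smul c ⟨T * Y, mul_mem_traceClass T.2 Y⟩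
    simp only [traceL_apply] at this
    simp only [RingHom.id_apply, Submodule.coe_smul, smul_mul_assoc, smul_eq_mul]
    exact this

theorem traceMulL_apply (Y : K →L[ℂ] K) (T : TraceClass K) :
    traceMulL Y T = trace ((T : K →L[ℂ] K) * Y) := rfl

theorem trace_mul_add (T : TraceClass K) (X Y : K →L[ℂ] K) :
    trace ((T : K →L[ℂ] K) * (X + Y)) = trace ((T : K →L[ℂ] K) * X) + trace ((T : K →L[ℂ] K) * Y) := by
  have := (traceL K).map_add ⟨T * X, mul_mem_traceClass T.2 X⟩ ⟨T * Y, mul_mem_traceClass T.2 Y⟩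
  simp only [traceL_apply] at this
  rw [← this]
  simp [mul_add]

theorem trace_mul_smul (T : TraceClass K) (c : ℂ) (X : K →L[ℂ] K) :
    trace ((T : K →L[ℂ] K) * (c • X)) = c * trace ((T : K →L[ℂ] K) * X) := by
  have := (traceL K).map_smul c ⟨T * X, mul_mem_traceClass T.2 X⟩
  simp only [traceL_apply, smul_eq_mul] at this
  rw [← this]
  simp

/-- The functional `Y ↦ tr (T Y)` on bounded operators. -/
def mulTraceL (T : TraceClass K) : (K →L[ℂ] K) →ₗ[ℂ] ℂ where
  toFun Y := trace ((T : K →L[ℂ] K) * Y)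
  map_add' := trace_mul_add T
  map_smul' := trace_mul_smul T

theorem mulTraceL_apply (Y : K →L[ℂ] K) (T : TraceClass K) :
    mulTraceL T Y = trace ((T : K →L[ℂ] K) * Y) := rfl

theorem traceNorm_of_nonneg {T : K →L[ℂ] K} (hT : 0 ≤ T) :
    traceNorm T = ∑' i, ENNReal.ofReal (⟪stdBasis K i, T (stdBasis K i)⟫_ℂ).re := by
  unfold traceNorm
  rw [CFC.abs_of_nonneg T hT]

theorem inner_re_nonneg {T : K →L[ℂ] K} (hT : 0 ≤ T) (x : K) : 0 ≤ (⟪x, T x⟫_ℂ).re :=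
  (Complex.nonneg_iff.1 (nonneg_iff_inner.1 hT x)).1

theorem inner_eq_re {T : K →L[ℂ] K} (hT : 0 ≤ T) (x : K) :
    ⟪x, T x⟫_ℂ = ((⟪x, T x⟫_ℂ).re : ℂ) :=
  Complex.ext (by simp) (by simpa using (Complex.nonneg_iff.1 (nonneg_iff_inner.1 hT x)).2.symm)

theorem trace_of_nonneg {T : K →L[ℂ] K} (hT : 0 ≤ T) :
    trace T = ((traceNorm T).toReal : ℂ) := by
  rw [traceNorm_of_nonneg hT, ENNReal.tsum_toReal_eq (fun _ => ENNReal.ofReal_ne_top),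
    Complex.ofReal_tsum]
  refine tsum_congr fun i => ?_
  rw [ENNReal.toReal_ofReal (inner_re_nonneg hT _)]
  exact inner_eq_re hT _

theorem trace_nonneg {T : K →L[ℂ] K} (hT : 0 ≤ T) : 0 ≤ trace T := by
  rw [trace_of_nonneg hT]
  exact Complex.zero_le_real.2 ENNReal.toReal_nonneg

/-- Bessel's inequality for the trace of a positive operator. -/
theorem sum_inner_le_trace {T : K →L[ℂ] K} (hT : 0 ≤ T) (hT' : T ∈ TraceClass K) {α : Type*}
    {f : α → K} (hf : Orthonormal ℂ f) (s : Finset α) :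
    ∑ a ∈ s, (⟪f a, T (f a)⟫_ℂ).re ≤ (trace T).re := by
  set S := CFC.sqrt T with hS
  have hS0 : 0 ≤ S := CFC.sqrt_nonneg T
  have hs : S * S = T := CFC.sqrt_mul_sqrt_self _ hT
  have hsa := adjoint_of_nonneg hS0
  have h1 : ∀ x, (⟪x, T x⟫_ℂ).re = ‖S x‖ ^ 2 := by
    intro x
    rw [← hs]
    change (⟪x, S (S x)⟫_ℂ).re = _
    rw [← ContinuousLinearMap.adjoint_inner_left, hsa]
    exact inner_self_eq_norm_sq (𝕜 := ℂ) _
  have h2 : HasSum (fun i => ‖S (stdBasis K i)‖ ^ 2) (trace T).re := by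
    have := Complex.hasSum_re (hasSum_trace hT')
    simpa only [h1] using this
  -- Each `‖√T f a‖²` is expanded in the standard basis; after exchanging the sums, Bessel's
  -- inequality for the family `f` applies to every vector `√T e i`.
  have h3 : ∀ x, HasSum (fun i => ‖⟪x, S (stdBasis K i)⟫_ℂ‖ ^ 2) (‖S x‖ ^ 2) := by
    intro x
    have := (stdBasis K).hasSum_inner_mul_inner (S x) (S x)
    have h4 := Complex.hasSum_re this
    have e1 : (⟪S x, S x⟫_ℂ).re = ‖S x‖ ^ 2 := inner_self_eq_norm_sq (𝕜 := ℂ) _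
    rw [e1] at h4
    refine h4.congr_fun fun i => ?_
    have e2 : ⟪x, S (stdBasis K i)⟫_ℂ = ⟪S x, stdBasis K i⟫_ℂ := by
      rw [← ContinuousLinearMap.adjoint_inner_left, hsa]
    rw [e2, ← inner_conj_symm (stdBasis K i) (S x), Complex.mul_conj', ← Complex.ofReal_pow,
      Complex.ofReal_re]
  have h4 : HasSum (fun i => ∑ a ∈ s, ‖⟪f a, S (stdBasis K i)⟫_ℂ‖ ^ 2) (∑ a ∈ s, ‖S (f a)‖ ^ 2) :=
    hasSum_sum fun a _ => h3 (f a)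
  simp only [h1]
  exact hasSum_le (fun i => hf.sum_inner_products_le _) h4 h2

theorem norm_le_trace {T : K →L[ℂ] K} (hT : 0 ≤ T) (hT' : T ∈ TraceClass K) :
    ‖T‖ ≤ (trace T).re := by
  have h0 : 0 ≤ (trace T).re := (Complex.nonneg_iff.1 (trace_nonneg hT)).1
  rw [CStarAlgebra.norm_le_iff_le_algebraMap _ h0 hT, ← sub_nonneg, nonneg_iff_inner]
  intro x
  have key : (⟪x, T x⟫_ℂ).re ≤ (trace T).re * ‖x‖ ^ 2 := by
    by_cases hx : x = 0
    · subst hx; simp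
    have hn : 0 < ‖x‖ := norm_pos_iff.2 hx
    have := sum_inner_le_trace hT hT' (f := fun _ : Unit => ((‖x‖⁻¹ : ℝ) : ℂ) • x) (by
      rw [orthonormal_iff_ite]
      intro i j
      rw [inner_smul_left, inner_smul_right, inner_self_eq_norm_sq_to_K]
      simp
      field_simp) Finset.univ
    simp only [map_smul, inner_smul_left, inner_smul_right, Complex.conj_ofReal,
      Finset.univ_unique, Finset.sum_singleton, Complex.re_ofReal_mul] at this
    rw [inv_mul_le_iff₀ hn, inv_mul_le_iff₀ hn] at this
    linarith
  have e : ⟪x, (algebraMap ℝ (K →L[ℂ] K) (trace T).re - T) x⟫_ℂ =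
      (((trace T).re * ‖x‖ ^ 2 - (⟪x, T x⟫_ℂ).re : ℝ) : ℂ) := by
    rw [sub_apply, inner_sub_right, Complex.ofReal_sub, ← inner_eq_re hT]
    congr 1
    rw [Algebra.algebraMap_eq_smul_one]
    change ⟪x, ((trace T).re : ℝ) • x⟫_ℂ = _
    rw [← Complex.coe_smul, inner_smul_right, inner_self_eq_norm_sq_to_K]
    push_cast
    rfl
  rw [e]
  exact Complex.zero_le_real.2 (by linarith)

theorem mem_traceClass_of_nonneg {T : K →L[ℂ] K} (hT : 0 ≤ T) (C : ℝ)
    (h : ∀ s : Finset (StdIndex K), ∑ i ∈ s, (⟪stdBasis K i, T (stdBasis K i)⟫_ℂ).re ≤ C) :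
    T ∈ TraceClass K := by
  change traceNorm T < ∞
  rw [traceNorm_of_nonneg hT]
  refine lt_of_le_of_lt ?_ (ENNReal.ofReal_lt_top (r := C))
  rw [ENNReal.tsum_eq_iSup_sum]
  refine iSup_le fun s => ?_
  rw [← ENNReal.ofReal_sum_of_nonneg fun i _ => inner_re_nonneg hT _]
  exact ENNReal.ofReal_le_ofReal (h s)

end TraceClass

/-! ### Functionals on the trace class are determined by rank one operators -/

section Expansion

variable {K : Type*} [NormedAddCommGroup K] [InnerProductSpace ℂ K] [CompleteSpace K]

theorem ketBra_apply (x y z : K) : (ketBra x y : K →L[ℂ] K) z = ⟪y, z⟫_ℂ • x := rfl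

theorem ketBra_add_left (x x' y : K) : ketBra (x + x') y = ketBra x y + ketBra x' y :=
  Subtype.ext <| by ext z; simp [ketBra_apply]

theorem ketBra_add_right (x y y' : K) : ketBra x (y + y') = ketBra x y + ketBra x y' :=
  Subtype.ext <| by ext z; simp [ketBra_apply, add_smul]

theorem ketBra_smul_left (c : ℂ) (x y : K) : ketBra (c • x) y = c • ketBra x y :=
  Subtype.ext <| by ext z; simp [ketBra_apply, smul_smul, mul_comm]

theorem ketBra_smul_right (c : ℂ) (x y : K) :
    ketBra x (c • y) = starRingEnd ℂ c • ketBra x y :=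
  Subtype.ext <| by ext z; simp [ketBra_apply, smul_smul, mul_comm]

theorem ketBra_zero_left (y : K) : ketBra 0 y = 0 := by
  simpa using ketBra_smul_left 0 0 y

theorem ketBra_zero_right (x : K) : ketBra x 0 = 0 := by
  simpa using ketBra_smul_right 0 x 0

theorem ketBra_sum_left {α : Type*} (s : Finset α) (f : α → K) (y : K) :
    ketBra (∑ a ∈ s, f a) y = ∑ a ∈ s, ketBra (f a) y :=
  map_sum (⟨⟨fun x => ketBra x y, ketBra_zero_left y⟩, fun x x' => ketBra_add_left x x' y⟩ :
    K →+ TraceClass K) f s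

theorem ketBra_sum_right {α : Type*} (s : Finset α) (f : α → K) (x : K) :
    ketBra x (∑ a ∈ s, f a) = ∑ a ∈ s, ketBra x (f a) :=
  map_sum (⟨⟨fun y => ketBra x y, ketBra_zero_right x⟩, fun y y' => ketBra_add_right x y y'⟩ :
    K →+ TraceClass K) f s

theorem ketBra_self_nonneg (x : K) : 0 ≤ (ketBra x x : K →L[ℂ] K) := by
  rw [nonneg_iff_inner]
  intro z
  rw [ketBra_apply, inner_smul_right, ← inner_conj_symm z x, Complex.mul_conj']
  exact_mod_cast sq_nonneg ‖⟪x, z⟫_ℂ‖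

theorem trace_ketBra_mul (x y : K) (Y : K →L[ℂ] K) :
    trace ((ketBra x y : K →L[ℂ] K) * Y) = ⟪y, Y x⟫_ℂ := by
  refine HasSum.tsum_eq ?_
  have h := (stdBasis K).hasSum_inner_mul_inner (ContinuousLinearMap.adjoint Y y) x
  rw [ContinuousLinearMap.adjoint_inner_left] at h
  refine h.congr_fun fun i => ?_
  change ⟪stdBasis K i, ⟪y, Y (stdBasis K i)⟫_ℂ • x⟫_ℂ = _
  rw [inner_smul_right, ContinuousLinearMap.adjoint_inner_left]

theorem trace_mul_ketBra (x y : K) (Y : K →L[ℂ] K) :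
    trace (Y * (ketBra x y : K →L[ℂ] K)) = ⟪y, Y x⟫_ℂ := by
  refine HasSum.tsum_eq ?_
  have h := (stdBasis K).hasSum_inner_mul_inner y (Y x)
  refine h.congr_fun fun i => ?_
  change ⟪stdBasis K i, Y (⟪y, stdBasis K i⟫_ℂ • x)⟫_ℂ = _
  rw [map_smul, inner_smul_right]

theorem trace_ketBra (x y : K) : trace (ketBra x y : K →L[ℂ] K) = ⟪y, x⟫_ℂ := by
  simpa using trace_ketBra_mul x y 1

theorem re_trace_ketBra_self (x : K) : (trace (ketBra x x : K →L[ℂ] K)).re = ‖x‖ ^ 2 := by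
  rw [trace_ketBra]; exact inner_self_eq_norm_sq (𝕜 := ℂ) _

theorem four_smul_ketBra (x y : K) : (4 : ℂ) • ketBra x y =
    ketBra (x + y) (x + y) - ketBra (x - y) (x - y)
      + Complex.I • ketBra (x + Complex.I • y) (x + Complex.I • y)
      - Complex.I • ketBra (x - Complex.I • y) (x - Complex.I • y) := by
  simp only [sub_eq_add_neg, ← neg_one_smul ℂ y, ← neg_one_smul ℂ (Complex.I • y),
    ketBra_add_left, ketBra_add_right, ketBra_smul_left, ketBra_smul_right]
  simp only [Complex.conj_I, map_neg, map_one]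
  match_scalars <;> ring_nf <;> simp
  norm_num

/-- Only values on positive operators are controlled, so off-diagonal rank one operators are reached
by polarization. For unit vectors each of the four terms has trace at most `4`, and the sum is
divided by `4`; homogeneity does the rest. -/
theorem norm_map_ketBra_le (φ : TraceClass K →ₗ[ℂ] ℂ) (C : ℝ)
    (hφ : ∀ T : TraceClass K, 0 ≤ (T : K →L[ℂ] K) → ‖φ T‖ ≤ C * (trace (T : K →L[ℂ] K)).re)
    (x y : K) : ‖φ (ketBra x y)‖ ≤ 4 * C * (‖x‖ * ‖y‖) := by
  have h1 : ∀ x : K, ‖φ (ketBra x x)‖ ≤ C * ‖x‖ ^ 2 := fun x => by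
    rw [← re_trace_ketBra_self]; exact hφ _ (ketBra_self_nonneg x)
  have h2 : ∀ x y : K, ‖x‖ = 1 → ‖y‖ = 1 → ‖φ (ketBra x y)‖ ≤ 4 * C := by
    intro x y hx hy
    have hC : 0 ≤ C := by
      have := (norm_nonneg _).trans (h1 x); rw [hx] at this; linarith
    have h3 : ∀ c : ℂ, ‖c‖ = 1 → ‖φ (ketBra (x + c • y) (x + c • y))‖ ≤ 4 * C := by
      intro c hc
      refine (h1 _).trans ?_
      have h5 : ‖x + c • y‖ ≤ 2 := by
        refine (norm_add_le _ _).trans ?_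
        rw [norm_smul, hc, hx, hy]; norm_num
      have : ‖x + c • y‖ ^ 2 ≤ 4 := by nlinarith [norm_nonneg (x + c • y)]
      nlinarith
    have e := congrArg φ (four_smul_ketBra x y)
    rw [map_sub, map_add, map_sub, map_smul, map_smul, map_smul] at e
    have a1 := h3 1 (by simp)
    have a2 := h3 (-1) (by simp)
    have a3 := h3 Complex.I (by simp)
    have a4 := h3 (-Complex.I) (by simp)
    simp only [one_smul, neg_smul, ← sub_eq_add_neg] at a1 a2 a3 a4
    have e2 := congrArg norm e
    rw [norm_smul] at e2
    have h6 : ‖(4 : ℂ)‖ = 4 := by norm_num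
    rw [h6] at e2
    have h7 := norm_sub_le (φ (ketBra (x + y) (x + y)) - φ (ketBra (x - y) (x - y))
      + Complex.I • φ (ketBra (x + Complex.I • y) (x + Complex.I • y)))
      (Complex.I • φ (ketBra (x - Complex.I • y) (x - Complex.I • y)))
    have h8 := norm_add_le (φ (ketBra (x + y) (x + y)) - φ (ketBra (x - y) (x - y)))
      (Complex.I • φ (ketBra (x + Complex.I • y) (x + Complex.I • y)))
    have h9 := norm_sub_le (φ (ketBra (x + y) (x + y))) (φ (ketBra (x - y) (x - y)))
    rw [norm_smul, Complex.norm_I, one_mul] at h7 h8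
    linarith
  by_cases hx : x = 0
  · subst hx; simp [ketBra_zero_left]
  by_cases hy : y = 0
  · subst hy; simp [ketBra_zero_right]
  have hx' : (‖x‖ : ℂ) ≠ 0 := by simpa using hx
  have hy' : (‖y‖ : ℂ) ≠ 0 := by simpa using hy
  have e : ketBra x y = ((‖x‖ : ℂ) * ‖y‖) • ketBra ((‖x‖ : ℂ)⁻¹ • x) ((‖y‖ : ℂ)⁻¹ • y) := by
    rw [ketBra_smul_left, ketBra_smul_right, smul_smul, smul_smul, map_inv₀, Complex.conj_ofReal]
    have : (‖x‖ : ℂ) * ‖y‖ * (‖x‖ : ℂ)⁻¹ * (‖y‖ : ℂ)⁻¹ = 1 := by field_simp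
    rw [this, one_smul]
  rw [e, map_smul, norm_smul, norm_mul, Complex.norm_real, Complex.norm_real, norm_norm, norm_norm,
    mul_comm]
  refine mul_le_mul_of_nonneg_right (h2 _ _ ?_ ?_) (by positivity)
  · rw [norm_smul, norm_inv, Complex.norm_real, norm_norm, inv_mul_cancel₀ (norm_ne_zero_iff.2 hx)]
  · rw [norm_smul, norm_inv, Complex.norm_real, norm_norm, inv_mul_cancel₀ (norm_ne_zero_iff.2 hy)]

/-- The orthogonal projection of `x` onto the span of the basis vectors in `F`. -/
def cutoff {κ : Type*} (b : HilbertBasis κ ℂ K) (F : Finset κ) (x : K) : K :=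
  ∑ k ∈ F, ⟪b k, x⟫_ℂ • b k

theorem tendsto_cutoff {κ : Type*} (b : HilbertBasis κ ℂ K) (x : K) :
    Tendsto (fun F => cutoff b F x) atTop (𝓝 x) := by
  have := b.hasSum_repr x
  simp only [b.repr_apply_apply] at this
  exact this

theorem norm_cutoff_le {κ : Type*} (b : HilbertBasis κ ℂ K) (F : Finset κ) (x : K) :
    ‖cutoff b F x‖ ≤ ‖x‖ := by
  have h1 : ‖cutoff b F x‖ ^ 2 = ∑ k ∈ F, ‖⟪b k, x⟫_ℂ‖ ^ 2 := by
    have h := b.orthonormal.inner_sum (fun k => ⟪b k, x⟫_ℂ) (fun k => ⟪b k, x⟫_ℂ) F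
    have h2 : ((‖cutoff b F x‖ ^ 2 : ℝ) : ℂ) = ((∑ k ∈ F, ‖⟪b k, x⟫_ℂ‖ ^ 2 : ℝ) : ℂ) := by
      have := inner_self_eq_norm_sq_to_K (𝕜 := ℂ) (cutoff b F x)
      push_cast
      refine this.symm.trans (h.trans ?_)
      refine Finset.sum_congr rfl fun k _ => ?_
      rw [Complex.conj_mul']
    exact_mod_cast h2
  have := b.orthonormal.sum_inner_products_le x (s := F)
  rw [← h1] at this
  exact le_of_sq_le_sq this (norm_nonneg _)

theorem mul_self_star_mem {L : K →L[ℂ] K} (hL : hsSq L < ∞) : star L * L ∈ TraceClass K :=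
  traceNorm_mul_lt_top (by rwa [hsSq_adjoint]) hL

theorem inner_star_mul (L : K →L[ℂ] K) (x y : K) : ⟪x, (star L * L) y⟫_ℂ = ⟪L x, L y⟫_ℂ := by
  rw [ContinuousLinearMap.star_eq_adjoint]
  change ⟪x, ContinuousLinearMap.adjoint L (L y)⟫_ℂ = _
  rw [ContinuousLinearMap.adjoint_inner_right]

theorem hasSum_norm_sq_star {L : K →L[ℂ] K} (hL : hsSq L < ∞) :
    HasSum (fun j => ‖(star L) (stdBasis K j)‖ ^ 2) (trace (star L * L)).re := by
  have e : ∀ R : K →L[ℂ] K, hsSq R = ∑' i, ENNReal.ofReal (‖R (stdBasis K i)‖ ^ 2) := by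
    intro R
    unfold hsSq
    exact tsum_congr fun i => by rw [ENNReal.ofReal_pow (norm_nonneg _), ofReal_norm]
  have h1 := hasSum_trace (mul_self_star_mem hL)
  have h2 := Complex.hasSum_re h1
  have e2 : ∀ i, (⟪stdBasis K i, (star L * L) (stdBasis K i)⟫_ℂ).re = ‖L (stdBasis K i)‖ ^ 2 := by
    intro i
    rw [inner_star_mul]
    exact inner_self_eq_norm_sq (𝕜 := ℂ) _
  simp only [e2] at h2
  have h3 := hsSq_adjoint L
  have hs : Summable fun j => ‖(star L) (stdBasis K j)‖ ^ 2 := by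
    have : hsSq (star L) < ∞ := by rwa [h3]
    rw [e] at this
    have h5 := ENNReal.summable_toReal this.ne
    refine h5.congr fun j => ?_
    rw [ENNReal.toReal_ofReal (by positivity)]
  rw [e, e, ← ENNReal.ofReal_tsum_of_nonneg (fun _ => by positivity) hs,
    ← ENNReal.ofReal_tsum_of_nonneg (fun _ => by positivity) h2.summable,
    ENNReal.ofReal_eq_ofReal_iff (tsum_nonneg fun _ => by positivity)
      (tsum_nonneg fun _ => by positivity), h2.tsum_eq] at h3
  rw [← h3]
  exact hs.hasSum

/-- No continuity of `φ` is presupposed: the remainder after finitely many terms of `L† L = ∑ |L† e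
j⟩⟨L† e j|` is positive, so the bound on positive operators applies to it, and its trace tends to
zero. -/
theorem hasSum_map_ketBra (φ : TraceClass K →ₗ[ℂ] ℂ) (C : ℝ)
    (hφ : ∀ T : TraceClass K, 0 ≤ (T : K →L[ℂ] K) → ‖φ T‖ ≤ C * (trace (T : K →L[ℂ] K)).re)
    {L : K →L[ℂ] K} (hL : hsSq L < ∞) :
    HasSum (fun j => φ (ketBra ((star L) (stdBasis K j)) ((star L) (stdBasis K j))))
      (φ ⟨star L * L, mul_self_star_mem hL⟩) := by
  set T : TraceClass K := ⟨star L * L, mul_self_star_mem hL⟩ with hT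
  set a : StdIndex K → K := fun j => (star L) (stdBasis K j) with ha
  have hs := hasSum_norm_sq_star hL
  have hin : ∀ x j, ⟪a j, x⟫_ℂ = ⟪stdBasis K j, L x⟫_ℂ := by
    intro x j
    rw [ha]
    simp only [ContinuousLinearMap.star_eq_adjoint]
    exact ContinuousLinearMap.adjoint_inner_left _ _ _
  have hpos : ∀ G : Finset (StdIndex K),
      0 ≤ ((T - ∑ j ∈ G, ketBra (a j) (a j) : TraceClass K) : K →L[ℂ] K) := by
    intro G
    rw [nonneg_iff_inner]
    intro x
    have h1 : ⟪x, ((T - ∑ j ∈ G, ketBra (a j) (a j) : TraceClass K) : K →L[ℂ] K) x⟫_ℂ =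
        ((‖L x‖ ^ 2 - ∑ j ∈ G, ‖⟪stdBasis K j, L x⟫_ℂ‖ ^ 2 : ℝ) : ℂ) := by
      rw [Submodule.coe_sub, Submodule.coe_sum, sub_apply, sum_apply,
        inner_sub_right, inner_sum]
      push_cast
      congr 1
      · rw [hT]
        change ⟪x, (star L * L) x⟫_ℂ = _
        rw [inner_star_mul]
        exact inner_self_eq_norm_sq_to_K _
      · refine Finset.sum_congr rfl fun j _ => ?_
        rw [ketBra_apply, inner_smul_right, ← inner_conj_symm x, hin, Complex.mul_conj']
    rw [h1]
    exact Complex.zero_le_real.2 (by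
      linarith [(stdBasis K).orthonormal.sum_inner_products_le (L x) (s := G)])
  have htr : ∀ G : Finset (StdIndex K),
      (trace ((T - ∑ j ∈ G, ketBra (a j) (a j) : TraceClass K) : K →L[ℂ] K)).re =
      (trace (star L * L)).re - ∑ j ∈ G, ‖a j‖ ^ 2 := by
    intro G
    rw [← traceL_apply, map_sub, map_sum, Complex.sub_re, Complex.re_sum]
    congr 1
    exact Finset.sum_congr rfl fun j _ => re_trace_ketBra_self _
  rw [HasSum, tendsto_iff_norm_sub_tendsto_zero]
  have h0 : Tendsto (fun G : Finset (StdIndex K) =>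
      C * ((trace (star L * L)).re - ∑ j ∈ G, ‖a j‖ ^ 2)) atTop (𝓝 0) := by
    have : Tendsto (fun G : Finset (StdIndex K) =>
      C * ((trace (star L * L)).re - ∑ j ∈ G, ‖a j‖ ^ 2)) atTop
      (𝓝 (C * ((trace (star L * L)).re - (trace (star L * L)).re))) :=
      (hs.const_sub _).const_mul C
    simpa using this
  refine squeeze_zero (fun _ => norm_nonneg _) (fun G => ?_) h0
  rw [norm_sub_rev, ← htr, ← map_sum, ← map_sub]
  exact hφ _ (hpos G)

/-- For a factorisation `T = R Q` into Hilbert-Schmidt operators take `L m = R† + i ^ m Q`. The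
weights `(-i) ^ m / 4` keep the term `R Q` and cancel the other three. -/
theorem exists_polarization (T : TraceClass K) : ∃ L : Fin 4 → (K →L[ℂ] K), ∃ hL : ∀ m, hsSq (L m) < ∞,
    T = ∑ m : Fin 4, (4⁻¹ * (-Complex.I) ^ (m : ℕ)) •
      (⟨star (L m) * L m, mul_self_star_mem (hL m)⟩ : TraceClass K) := by
  obtain ⟨R, Q, hR, hQ, hT⟩ := exists_factor T.2
  refine ⟨fun m => star R + Complex.I ^ (m : ℕ) • Q,
    fun m => hsSq_add_lt_top (by rwa [hsSq_adjoint]) (hsSq_smul_lt_top _ hQ), Subtype.ext ?_⟩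
  rw [hT, Submodule.coe_sum]
  simp only [Submodule.coe_smul, Fin.sum_univ_four, star_add, star_star, star_smul, add_mul, mul_add,
    smul_mul_assoc, mul_smul_comm, RCLike.star_def, map_pow, Complex.conj_I]
  match_scalars <;> simp [pow_succ] <;> ring_nf <;> (simp; try ring)

/-- By polarization `T = L† L` suffices. With `a j = L† e j`, the truncated double sum equals `∑ j,
φ |P a j⟩⟨P a j|` for the projection `P` onto the span of `F`. Its terms are dominated by `4 C ‖a
j‖²`, which is summable, so dominated convergence applies. The consequences are basis independence
of the trace and the recovery of `Δ` from its Choi blocks. -/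
theorem tendsto_expansion {κ : Type*} (b : HilbertBasis κ ℂ K) (φ : TraceClass K →ₗ[ℂ] ℂ) (C : ℝ)
    (hφ : ∀ T : TraceClass K, 0 ≤ (T : K →L[ℂ] K) → ‖φ T‖ ≤ C * (trace (T : K →L[ℂ] K)).re)
    (T : TraceClass K) :
    Tendsto (fun F : Finset κ => ∑ k ∈ F, ∑ l ∈ F,
      ⟪b k, (T : K →L[ℂ] K) (b l)⟫_ℂ * φ (ketBra (b k) (b l))) atTop (𝓝 (φ T)) := by
  have hbd := norm_map_ketBra_le φ C hφ
  have key : ∀ {L : K →L[ℂ] K} (hL : hsSq L < ∞), Tendsto (fun F : Finset κ => ∑ k ∈ F, ∑ l ∈ F,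
      ⟪b k, (star L * L) (b l)⟫_ℂ * φ (ketBra (b k) (b l))) atTop
      (𝓝 (φ ⟨star L * L, mul_self_star_mem hL⟩)) := by
    intro L hL
    set a : StdIndex K → K := fun j => (star L) (stdBasis K j) with ha
    have hin : ∀ x j, ⟪a j, x⟫_ℂ = ⟪stdBasis K j, L x⟫_ℂ := by
      intro x j
      rw [ha]
      simp only [ContinuousLinearMap.star_eq_adjoint]
      exact ContinuousLinearMap.adjoint_inner_left _ _ _
    have h1 : ∀ F : Finset κ, ∑' j, φ (ketBra (cutoff b F (a j)) (cutoff b F (a j))) =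
        ∑ k ∈ F, ∑ l ∈ F, ⟪b k, (star L * L) (b l)⟫_ℂ * φ (ketBra (b k) (b l)) := by
      intro F
      refine HasSum.tsum_eq ?_
      have e : ∀ j, φ (ketBra (cutoff b F (a j)) (cutoff b F (a j))) =
          ∑ k ∈ F, ∑ l ∈ F, ⟪L (b k), stdBasis K j⟫_ℂ * ⟪stdBasis K j, L (b l)⟫_ℂ *
            φ (ketBra (b k) (b l)) := by
        intro j
        conv_lhs => unfold cutoff
        rw [ketBra_sum_left, map_sum]
        refine Finset.sum_congr rfl fun k _ => ?_
        rw [ketBra_sum_right, map_sum]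
        refine Finset.sum_congr rfl fun l _ => ?_
        rw [ketBra_smul_left, ketBra_smul_right, map_smul, map_smul, smul_eq_mul, smul_eq_mul,
          inner_conj_symm, hin, ← inner_conj_symm (b k), hin, inner_conj_symm, mul_assoc]
      simp only [e]
      refine hasSum_sum fun k _ => hasSum_sum fun l _ => ?_
      rw [inner_star_mul]
      exact ((stdBasis K).hasSum_inner_mul_inner _ _).mul_right _
    have h2 := hasSum_map_ketBra φ C hφ hL
    rw [← h2.tsum_eq]
    simp only [← h1]
    have hC : ∀ j, 0 ≤ 4 * C * (‖a j‖ * ‖a j‖) := fun j => (norm_nonneg _).trans (hbd _ _)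
    refine tendsto_tsum_of_dominated_convergence (bound := fun j => 4 * C * (‖a j‖ * ‖a j‖))
      ?_ ?_ ?_
    · have := (hasSum_norm_sq_star hL).summable.mul_left (4 * C)
      simpa only [sq] using this
    · intro j
      have ht := tendsto_cutoff b (a j)
      rw [tendsto_iff_norm_sub_tendsto_zero]
      have h0 : Tendsto (fun F => 4 * C * (‖cutoff b F (a j) - a j‖ * ‖cutoff b F (a j)‖) +
          4 * C * (‖a j‖ * ‖cutoff b F (a j) - a j‖)) atTop (𝓝 0) := by
        have hz := tendsto_iff_norm_sub_tendsto_zero.1 ht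
        have := ((hz.mul ht.norm).const_mul (4 * C)).add ((hz.const_mul (‖a j‖)).const_mul (4 * C))
        simpa using this
      refine squeeze_zero (fun _ => norm_nonneg _) (fun F => ?_) h0
      have e : ketBra (cutoff b F (a j)) (cutoff b F (a j)) - ketBra (a j) (a j) =
          ketBra (cutoff b F (a j) - a j) (cutoff b F (a j)) +
          ketBra (a j) (cutoff b F (a j) - a j) := by
        simp only [sub_eq_add_neg, ← neg_one_smul ℂ (a j), ketBra_add_left, ketBra_add_right,
          ketBra_smul_left, ketBra_smul_right, map_neg, map_one]
        module
      rw [← map_sub, e, map_add]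
      exact (norm_add_le _ _).trans (add_le_add (hbd _ _) (hbd _ _))
    · refine Eventually.of_forall fun F j => (hbd _ _).trans ?_
      -- The sign of `C` is not known beforehand; a nonzero `a j` forces `C ≥ 0`.
      by_cases h0 : a j = 0
      · have : cutoff b F (a j) = 0 := by
          have := norm_cutoff_le b F (a j)
          rw [h0, norm_zero] at this
          rw [h0]; exact norm_le_zero_iff.1 this
        rw [this, h0]
      · have hC' : 0 ≤ 4 * C := by
          have := hC j
          have hn : 0 < ‖a j‖ * ‖a j‖ := by positivity
          exact nonneg_of_mul_nonneg_left this hn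
        have := norm_cutoff_le b F (a j)
        gcongr
  obtain ⟨L, hL, hT⟩ := exists_polarization T
  have h3 := tendsto_finsetSum (Finset.univ : Finset (Fin 4))
    (fun m _ => (key (hL m)).const_mul (4⁻¹ * (-Complex.I) ^ (m : ℕ)))
  have e1 : φ T = ∑ m : Fin 4, (4⁻¹ * (-Complex.I) ^ (m : ℕ)) *
      φ ⟨star (L m) * L m, mul_self_star_mem (hL m)⟩ := by
    conv_lhs => rw [hT]
    rw [map_sum]
    simp only [map_smul, smul_eq_mul]
  rw [e1]
  refine h3.congr fun F => ?_
  simp only [Finset.mul_sum]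
  rw [Finset.sum_comm]
  refine Finset.sum_congr rfl fun k _ => ?_
  rw [Finset.sum_comm]
  refine Finset.sum_congr rfl fun l _ => ?_
  conv_rhs => rw [hT]
  rw [Submodule.coe_sum, sum_apply, inner_sum, Finset.sum_mul]
  refine Finset.sum_congr rfl fun m _ => ?_
  rw [Submodule.coe_smul, smul_apply, inner_smul_right]
  ring

theorem norm_traceMulL_le (Y : K →L[ℂ] K) (T : TraceClass K) (hT : 0 ≤ (T : K →L[ℂ] K)) :
    ‖traceMulL Y T‖ ≤ ‖Y‖ * (trace (T : K →L[ℂ] K)).re := by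
  rw [trace_of_nonneg hT]
  exact norm_trace_mul_le T.2 Y

theorem tendsto_trace_mul {κ : Type*} (b : HilbertBasis κ ℂ K) (T : TraceClass K)
    (Y : K →L[ℂ] K) :
    Tendsto (fun F : Finset κ => ∑ k ∈ F, ∑ l ∈ F,
      ⟪b k, (T : K →L[ℂ] K) (b l)⟫_ℂ * ⟪b l, Y (b k)⟫_ℂ) atTop
      (𝓝 (trace ((T : K →L[ℂ] K) * Y))) := by
  have := tendsto_expansion b (traceMulL Y) ‖Y‖ (norm_traceMulL_le Y) T
  simpa only [traceMulL_apply, trace_ketBra_mul] using this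

/-- Since `|σ| = W σ` with a contraction `W`, the partial sums of the trace norm are of the tested
form. Only finite sums enter, so `σ` need not be known to be trace class. -/
theorem traceNorm_le_of_forall (σ : K →L[ℂ] K) (c : ℝ)
    (h : ∀ (W : K →L[ℂ] K), ‖W‖ ≤ 1 → ∀ s : Finset (StdIndex K),
      ∑ i ∈ s, (⟪W (stdBasis K i), σ (stdBasis K i)⟫_ℂ).re ≤ c) :
    traceNorm σ ≤ ENNReal.ofReal c := by
  obtain ⟨W, hW1, hW⟩ := exists_contraction_mul_eq σ (CFC.abs σ) (norm_abs_apply σ)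
  unfold traceNorm
  rw [ENNReal.tsum_eq_iSup_sum]
  refine iSup_le fun s => ?_
  rw [← ENNReal.ofReal_sum_of_nonneg fun i _ => inner_re_nonneg (CFC.abs_nonneg σ) _]
  refine ENNReal.ofReal_le_ofReal ?_
  have := h (star W) (by rwa [norm_star]) s
  refine le_of_eq_of_le ?_ this
  refine Finset.sum_congr rfl fun i _ => ?_
  rw [← hW, ContinuousLinearMap.star_eq_adjoint, ContinuousLinearMap.adjoint_inner_left]
  rfl

end Expansion

/-! ### Automatic boundedness of positive maps; pairings of positive block operators -/

section Positivity

variable {K : Type*} [NormedAddCommGroup K] [InnerProductSpace ℂ K] [CompleteSpace K]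
  {L : Type*} [NormedAddCommGroup L] [InnerProductSpace ℂ L] [CompleteSpace L]

theorem re_traceL_nonneg {T : TraceClass K} (hT : 0 ≤ (T : K →L[ℂ] K)) :
    0 ≤ (trace (T : K →L[ℂ] K)).re := (Complex.nonneg_iff.1 (trace_nonneg hT)).1

theorem re_trace_mono {S T : TraceClass K} (h : (S : K →L[ℂ] K) ≤ T) :
    (trace (S : K →L[ℂ] K)).re ≤ (trace (T : K →L[ℂ] K)).re := by
  have h1 : 0 ≤ ((T - S : TraceClass K) : K →L[ℂ] K) := by
    rw [Submodule.coe_sub]; exact sub_nonneg.2 h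
  have h2 := re_traceL_nonneg h1
  rw [← traceL_apply, map_sub, Complex.sub_re] at h2
  exact sub_nonneg.1 h2

/-- Positive maps between trace class spaces are bounded. -/
theorem exists_trace_bound (Φ : TraceClass K →ₗ[ℂ] TraceClass L)
    (hΦ : ∀ T : TraceClass K, 0 ≤ (T : K →L[ℂ] K) → 0 ≤ (Φ T : L →L[ℂ] L)) :
    ∃ M : ℝ, 0 ≤ M ∧ ∀ T : TraceClass K, 0 ≤ (T : K →L[ℂ] K) →
      (trace (Φ T : L →L[ℂ] L)).re ≤ M * (trace (T : K →L[ℂ] K)).re := by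
  by_contra! hcon
  have h1 : ∀ n : ℕ, ∃ T : TraceClass K, 0 ≤ (T : K →L[ℂ] K) ∧
      (trace (T : K →L[ℂ] K)).re = (1 / 2) ^ n ∧ (2 : ℝ) ^ n < (trace (Φ T : L →L[ℂ] L)).re := by
    intro n
    -- After rescaling `T` to trace `2⁻ⁿ`, the factor `4 ^ n` leaves an image of trace above `2 ^
    -- n`. The sum `S` of these operators is trace class and dominates each of them, so the trace of
    -- `Φ S` would exceed every power of two.
    obtain ⟨T, hT, hlt⟩ := hcon (4 ^ n) (by positivity)
    have h0 := re_traceL_nonneg hT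
    have hpos : 0 < (trace (T : K →L[ℂ] K)).re := by
      rcases h0.lt_or_eq with h | h
      · exact h
      · have h2 := norm_le_trace hT T.2
        rw [← h] at h2
        have h3 : T = 0 := Subtype.ext (norm_le_zero_iff.1 h2)
        subst h3
        simp [trace] at hlt
    set t := (trace (T : K →L[ℂ] K)).re with ht
    refine ⟨((t⁻¹ * (1 / 2) ^ n : ℝ) : ℂ) • T, ?_, ?_, ?_⟩
    · rw [nonneg_iff_inner] at hT ⊢
      intro x
      rw [Submodule.coe_smul, smul_apply, inner_smul_right]
      exact mul_nonneg (Complex.zero_le_real.2 (by positivity)) (hT x)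
    · rw [← traceL_apply, map_smul, smul_eq_mul, Complex.re_ofReal_mul, traceL_apply, ← ht]
      field_simp
    · rw [map_smul, ← traceL_apply, map_smul, smul_eq_mul, Complex.re_ofReal_mul, traceL_apply]
      have h4 : (4 : ℝ) ^ n = 2 ^ n * 2 ^ n := by rw [← mul_pow]; norm_num
      rw [h4] at hlt
      have h5 : t⁻¹ * (1 / 2) ^ n * (2 ^ n * 2 ^ n * t) <
          t⁻¹ * (1 / 2) ^ n * (trace (Φ T : L →L[ℂ] L)).re :=
        mul_lt_mul_of_pos_left hlt (by positivity)
      refine lt_of_eq_of_lt ?_ h5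
      have : ((1 : ℝ) / 2) ^ n * 2 ^ n = 1 := by rw [← mul_pow]; norm_num
      field_simp
      linear_combination (-1:ℝ) * this
  choose ξ hξ0 hξ1 hξ2 using h1
  have hsum : Summable fun n => (ξ n : K →L[ℂ] K) := by
    refine Summable.of_norm_bounded summable_geometric_two fun n => ?_
    rw [← hξ1 n]
    exact norm_le_trace (hξ0 n) (ξ n).2
  have hS := hsum.hasSum
  set S : K →L[ℂ] K := ∑' n, (ξ n : K →L[ℂ] K) with hSdef
  have hin : ∀ x : K, HasSum (fun n => (⟪x, (ξ n : K →L[ℂ] K) x⟫_ℂ).re) (⟪x, S x⟫_ℂ).re := by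
    intro x
    have h2 : HasSum (fun n => (ξ n : K →L[ℂ] K) x) (S x) :=
      (ContinuousLinearMap.apply ℂ K x).hasSum hS
    exact Complex.hasSum_re ((innerSL ℂ x).hasSum h2)
  have hinC : ∀ x : K, HasSum (fun n => (⟪x, (ξ n : K →L[ℂ] K) x⟫_ℂ)) (⟪x, S x⟫_ℂ) := by
    intro x
    have h2 : HasSum (fun n => (ξ n : K →L[ℂ] K) x) (S x) :=
      (ContinuousLinearMap.apply ℂ K x).hasSum hS
    exact (innerSL ℂ x).hasSum h2
  have him : ∀ x : K, ⟪x, S x⟫_ℂ = ((⟪x, S x⟫_ℂ).re : ℂ) := by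
    intro x
    have h2 := Complex.hasSum_im (hinC x)
    have h3 : ∀ n, (⟪x, (ξ n : K →L[ℂ] K) x⟫_ℂ).im = 0 := fun n =>
      (Complex.nonneg_iff.1 (nonneg_iff_inner.1 (hξ0 n) x)).2.symm
    simp only [h3] at h2
    exact Complex.ext (by simp) (by simpa using h2.unique hasSum_zero)
  have hle : ∀ n, (ξ n : K →L[ℂ] K) ≤ S := by
    intro n
    rw [← sub_nonneg, nonneg_iff_inner]
    intro x
    rw [sub_apply, inner_sub_right, him, inner_eq_re (hξ0 n), ← Complex.ofReal_sub]
    exact Complex.zero_le_real.2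
      (sub_nonneg.2 (le_hasSum (hin x) n fun m _ => inner_re_nonneg (hξ0 m) x))
  have hS0 : 0 ≤ S := (hξ0 0).trans (hle 0)
  have hmem : S ∈ TraceClass K := by
    refine mem_traceClass_of_nonneg hS0 2 fun s => ?_
    have h2 : HasSum (fun n => ∑ i ∈ s, (⟪stdBasis K i, (ξ n : K →L[ℂ] K) (stdBasis K i)⟫_ℂ).re)
        (∑ i ∈ s, (⟪stdBasis K i, S (stdBasis K i)⟫_ℂ).re) := hasSum_sum fun i _ => hin _
    refine hasSum_le (fun n => ?_) h2 hasSum_geometric_two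
    rw [← hξ1 n]
    exact sum_inner_le_trace (hξ0 n) (ξ n).2 (stdBasis K).orthonormal s
  obtain ⟨n, hn⟩ := pow_unbounded_of_one_lt (trace (Φ ⟨S, hmem⟩ : L →L[ℂ] L)).re
    (one_lt_two : (1 : ℝ) < 2)
  have h6 : (Φ (ξ n) : L →L[ℂ] L) ≤ Φ ⟨S, hmem⟩ := by
    have h7 := hΦ (⟨S, hmem⟩ - ξ n) (by rw [Submodule.coe_sub]; exact sub_nonneg.2 (hle n))
    rw [map_sub, Submodule.coe_sub] at h7
    exact sub_nonneg.1 h7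
  have := re_trace_mono h6
  linarith [hξ2 n]

/-- Positivity of the compression of a block operator to finitely many block indices. -/
def PosOn {κ : Type*} (F : Finset κ) (X : κ → κ → K →L[ℂ] K) : Prop :=
  ∀ v : κ → K, 0 ≤ ∑ i ∈ F, ∑ j ∈ F, ⟪v i, X i j (v j)⟫_ℂ

theorem BlockNonneg.posOn {κ : Type*} {X : κ → κ → K →L[ℂ] K} (h : BlockNonneg X)
    (F : Finset κ) : PosOn F X := fun v => h F v

open scoped MatrixOrder Matrix.Norms.L2Operator in
-- Nonnegativity of the complex form includes being Hermitian, so the matrix is positive in a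
-- C*-algebra and has the form `N† N`. This reduces claims about positive matrices to sums of
-- squares.
theorem exists_gram {α : Type*} (s : Finset α) (M : α → α → ℂ)
    (h : ∀ c : α → ℂ, 0 ≤ ∑ a ∈ s, ∑ b ∈ s, starRingEnd ℂ (c a) * M a b * c b) :
    ∃ m : s → α → ℂ, ∀ a ∈ s, ∀ b ∈ s, M a b = ∑ r, starRingEnd ℂ (m r a) * m r b := by
  classical
  have hps : (Matrix.of fun a b : s => M a b).PosSemidef := by
    rw [← Matrix.isPositive_toEuclideanLin_iff, LinearMap.isPositive_iff_complex]
    intro x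
    have := h fun a => if ha : a ∈ s then x ⟨a, ha⟩ else 0
    have e : ⟪x, Matrix.toEuclideanLin (Matrix.of fun a b : s => M a b) x⟫_ℂ =
        ∑ a ∈ s, ∑ b ∈ s, starRingEnd ℂ (if ha : a ∈ s then x ⟨a, ha⟩ else 0) * M a b *
          (if hb : b ∈ s then x ⟨b, hb⟩ else 0) := by
      rw [← Finset.sum_coe_sort, PiLp.inner_apply]
      refine Finset.sum_congr rfl fun a _ => ?_
      rw [← Finset.sum_coe_sort]
      simp [Matrix.toLpLin_apply, Matrix.mulVec, dotProduct, Finset.mul_sum, mul_comm]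
      exact Finset.sum_congr rfl fun b _ => by ring
    rw [← e, ← inner_conj_symm, Complex.nonneg_iff] at this
    simp only [Complex.conj_re, Complex.conj_im] at this
    refine ⟨Complex.ext (by simp) ?_, this.1⟩
    have h2 := this.2
    simp only [RCLike.re_eq_complex_re, Complex.ofReal_im]
    linarith
  obtain ⟨N, hN⟩ := CStarAlgebra.nonneg_iff_eq_star_mul_self.1 (Matrix.nonneg_iff_posSemidef.2 hps)
  refine ⟨fun r a => if ha : a ∈ s then N r ⟨a, ha⟩ else 0, fun a ha b hb => ?_⟩
  have := congrFun (congrFun hN ⟨a, ha⟩) ⟨b, hb⟩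
  rw [Matrix.of_apply] at this
  rw [this, Matrix.mul_apply]
  simp [ha, hb, Matrix.star_apply]

/-- Inserting `M = m† m` turns `tr (M N)` into a sum of values of the quadratic form of `N`, one for
each row of `m`. -/
theorem scalar_pairing_nonneg {α : Type*} (s : Finset α) (M N : α → α → ℂ)
    (hM : ∀ c : α → ℂ, 0 ≤ ∑ a ∈ s, ∑ b ∈ s, starRingEnd ℂ (c a) * M a b * c b)
    (hN : ∀ c : α → ℂ, 0 ≤ ∑ a ∈ s, ∑ b ∈ s, starRingEnd ℂ (c a) * N a b * c b) :
    0 ≤ ∑ a ∈ s, ∑ b ∈ s, M a b * N b a := by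
  obtain ⟨m, hm⟩ := exists_gram s M hM
  have e : ∑ a ∈ s, ∑ b ∈ s, M a b * N b a =
      ∑ r, ∑ b ∈ s, ∑ a ∈ s, starRingEnd ℂ (starRingEnd ℂ (m r b)) * N b a * starRingEnd ℂ (m r a) := by
    rw [Finset.sum_comm, Finset.sum_comm (s := Finset.univ)]
    refine Finset.sum_congr rfl fun b hb => ?_
    rw [Finset.sum_comm (s := Finset.univ)]
    refine Finset.sum_congr rfl fun a ha => ?_
    rw [hm a ha b hb, Finset.sum_mul]
    refine Finset.sum_congr rfl fun r _ => ?_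
    rw [Complex.conj_conj]; ring
  rw [e]
  exact Finset.sum_nonneg fun r _ => hN _

theorem sum_product_sum_product {α β : Type*} (F : Finset α) (G : Finset β)
    (f : α × β → α × β → ℂ) : ∑ a ∈ F ×ˢ G, ∑ b ∈ F ×ˢ G, f a b =
      ∑ k ∈ F, ∑ l ∈ F, ∑ i ∈ G, ∑ j ∈ G, f (k, i) (l, j) := by
  simp only [Finset.sum_product]
  exact Finset.sum_congr rfl fun k _ => Finset.sum_comm

theorem PosOn.expand {κ σ : Type*} {F : Finset κ} {X : κ → κ → K →L[ℂ] K} (hX : PosOn F X)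
    (e : σ → K) (G : Finset σ) (c : κ × σ → ℂ) :
    0 ≤ ∑ a ∈ F ×ˢ G, ∑ b ∈ F ×ˢ G,
      starRingEnd ℂ (c a) * ⟪e a.2, X a.1 b.1 (e b.2)⟫_ℂ * c b := by
  refine (hX fun k => ∑ i ∈ G, c (k, i) • e i).trans_eq ?_
  rw [sum_product_sum_product]
  refine Finset.sum_congr rfl fun k _ => Finset.sum_congr rfl fun l _ => ?_
  rw [map_sum, sum_inner]
  refine Finset.sum_congr rfl fun i _ => ?_
  rw [inner_sum]
  refine Finset.sum_congr rfl fun j _ => ?_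
  rw [map_smul, inner_smul_left, inner_smul_right]
  ring

/-- `tr (J X) ≥ 0` for positive block operators `J` and `X`. -/
theorem pairing_nonneg {κ : Type*} (F : Finset κ) (J : κ → κ → TraceClass K)
    (X : κ → κ → K →L[ℂ] K) (hJ : PosOn F fun k l => (J k l : K →L[ℂ] K)) (hX : PosOn F X) :
    0 ≤ ∑ k ∈ F, ∑ l ∈ F, trace ((J k l : K →L[ℂ] K) * X l k) := by
  have hlim : Tendsto (fun G : Finset (StdIndex K) => ∑ k ∈ F, ∑ l ∈ F, ∑ i ∈ G, ∑ j ∈ G,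
      ⟪stdBasis K i, (J k l : K →L[ℂ] K) (stdBasis K j)⟫_ℂ *
      ⟪stdBasis K j, X l k (stdBasis K i)⟫_ℂ) atTop
      (𝓝 (∑ k ∈ F, ∑ l ∈ F, trace ((J k l : K →L[ℂ] K) * X l k))) :=
    tendsto_finsetSum _ fun k _ => tendsto_finsetSum _ fun l _ =>
      tendsto_trace_mul (stdBasis K) (J k l) (X l k)
  -- Compression of `K` to the span of finitely many basis vectors makes both block operators scalar
  -- matrices over `F × G`.
  refine ge_of_tendsto' hlim fun G => ?_
  refine (scalar_pairing_nonneg (F ×ˢ G)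
    (fun a b => ⟪stdBasis K a.2, (J a.1 b.1 : K →L[ℂ] K) (stdBasis K b.2)⟫_ℂ)
    (fun a b => ⟪stdBasis K a.2, X a.1 b.1 (stdBasis K b.2)⟫_ℂ)
    (hJ.expand _ G) (hX.expand _ G)).trans_eq ?_
  rw [sum_product_sum_product]

/-- Block operators that are positive are Hermitian. -/
theorem PosOn.adjoint_eq {κ : Type*} {F : Finset κ} {X : κ → κ → K →L[ℂ] K} (hX : PosOn F X)
    {k l : κ} (hk : k ∈ F) (hl : l ∈ F) : star (X k l) = X l k := by
  classical
  ext y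
  refine ext_inner_left ℂ fun x => ?_
  -- A Gram matrix is Hermitian; two vectors per block index suffice to read off one matrix element
  -- and its mirror image.
  obtain ⟨m, hm⟩ := exists_gram (F ×ˢ (Finset.univ : Finset (Fin 2)))
    (fun a b => ⟪(![x, y] : Fin 2 → K) a.2, X a.1 b.1 ((![x, y] : Fin 2 → K) b.2)⟫_ℂ)
    (hX.expand _ _)
  have h1 := hm (k, 1) (by simp [hk]) (l, 0) (by simp [hl])
  have h2 := hm (l, 0) (by simp [hl]) (k, 1) (by simp [hk])
  simp only [Matrix.cons_val_zero, Matrix.cons_val_one] at h1 h2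
  rw [ContinuousLinearMap.star_eq_adjoint, ContinuousLinearMap.adjoint_inner_right,
    ← inner_conj_symm, h1, h2, map_sum]
  refine Finset.sum_congr rfl fun r _ => ?_
  rw [map_mul, Complex.conj_conj, mul_comm]

theorem conj_trace_mul (T : TraceClass K) (Y : K →L[ℂ] K) :
    starRingEnd ℂ (trace ((T : K →L[ℂ] K) * Y)) =
      trace (star (T : K →L[ℂ] K) * star Y) := by
  have h1 := tendsto_trace_mul (stdBasis K) ⟨_, star_mem_traceClass T.2⟩ (star Y)
  have h2 := (Complex.continuous_conj.tendsto _).comp (tendsto_trace_mul (stdBasis K) T Y)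
  refine tendsto_nhds_unique h2 (h1.congr fun F => ?_)
  simp only [Function.comp, map_sum]
  rw [Finset.sum_comm]
  refine Finset.sum_congr rfl fun k _ => Finset.sum_congr rfl fun l _ => ?_
  rw [map_mul, ContinuousLinearMap.star_eq_adjoint, ContinuousLinearMap.star_eq_adjoint,
    ContinuousLinearMap.adjoint_inner_right, ContinuousLinearMap.adjoint_inner_right,
    inner_conj_symm, inner_conj_symm]

end Positivity

/-! ### Block operators on a Hilbert space tensor product -/

section TensorBlocks

variable {K L : Type*} [NormedAddCommGroup K] [InnerProductSpace ℂ K] [CompleteSpace K]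
  [NormedAddCommGroup L] [InnerProductSpace ℂ L] [CompleteSpace L]

theorem inner_tmulRight (a b : K) (c d : L) :
    ⟪tmulRight K c a, tmulRight K d b⟫_ℂ = ⟪a, b⟫_ℂ * ⟪c, d⟫_ℂ := by
  change ⟪((a ⊗ₜ[ℂ] c : K ⊗[ℂ] L) : HTensor K L), ((b ⊗ₜ[ℂ] d : K ⊗[ℂ] L) : HTensor K L)⟫_ℂ = _
  rw [UniformSpace.Completion.inner_coe, TensorProduct.inner_tmul]

theorem norm_tmulRight (a : K) (c : L) : ‖tmulRight K c a‖ = ‖a‖ * ‖c‖ := by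
  have h : ‖tmulRight K c a‖ ^ 2 = (‖a‖ * ‖c‖) ^ 2 := by
    have := inner_tmulRight a a c c
    rw [inner_self_eq_norm_sq_to_K, inner_self_eq_norm_sq_to_K, inner_self_eq_norm_sq_to_K] at this
    rw [mul_pow]
    exact_mod_cast this
  exact (sq_eq_sq₀ (norm_nonneg _) (by positivity)).1 h

variable (K L) in
/-- `c ↦ (a ↦ a ⊗ c)` as a linear map. -/
def tmulRightL : L →ₗ[ℂ] K →L[ℂ] HTensor K L where
  toFun c := tmulRight K c
  map_add' c d := by simp [tmulRight, ContinuousLinearMap.comp_add]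
  map_smul' z c := by simp [tmulRight]

theorem tmulRightL_apply (c : L) : tmulRightL K L c = tmulRight K c := rfl

theorem tmulRight_sum_smul {α : Type*} (s : Finset α) (z : α → ℂ) (f : α → L) (a : K) :
    tmulRight K (∑ i ∈ s, z i • f i) a = ∑ i ∈ s, z i • tmulRight K (f i) a := by
  rw [← tmulRightL_apply, map_sum, sum_apply]
  exact Finset.sum_congr rfl fun i _ => by rw [map_smul]; rfl

theorem adjoint_tmulRight_tmulRight (c d : L) (b : K) :
    ContinuousLinearMap.adjoint (tmulRight K c) (tmulRight K d b) = ⟪c, d⟫_ℂ • b := by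
  refine ext_inner_left ℂ fun a => ?_
  rw [ContinuousLinearMap.adjoint_inner_right, inner_tmulRight, inner_smul_right, mul_comm]

/-- The operator `∑ k l ∈ F, (1 ⊗ |e k⟩) X k l (1 ⊗ ⟨e l|)` with blocks `X`. -/
def ofBlocks {κ : Type*} (e : κ → L) (F : Finset κ) (X : κ → κ → K →L[ℂ] K) :
    HTensor K L →L[ℂ] HTensor K L :=
  ∑ k ∈ F, ∑ l ∈ F, tmulRight K (e k) ∘L X k l ∘L ContinuousLinearMap.adjoint (tmulRight K (e l))

theorem inner_ofBlocks {κ : Type*} (e : κ → L) (F : Finset κ) (X : κ → κ → K →L[ℂ] K)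
    (u v : HTensor K L) : ⟪u, ofBlocks e F X v⟫_ℂ = ∑ k ∈ F, ∑ l ∈ F,
      ⟪ContinuousLinearMap.adjoint (tmulRight K (e k)) u,
        X k l (ContinuousLinearMap.adjoint (tmulRight K (e l)) v)⟫_ℂ := by
  simp only [ofBlocks, sum_apply, inner_sum, ContinuousLinearMap.comp_apply,
    ContinuousLinearMap.adjoint_inner_left]

theorem inner_slice (T : HTensor K L →L[ℂ] HTensor K L) (c d : L) (a b : K) :
    ⟪a, slice T c d b⟫_ℂ = ⟪tmulRight K c a, T (tmulRight K d b)⟫_ℂ := by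
  simp only [slice, ContinuousLinearMap.comp_apply, ContinuousLinearMap.adjoint_inner_right]

theorem slice_ofBlocks {κ : Type*} (e : κ → L) (F : Finset κ) (X : κ → κ → K →L[ℂ] K) (c d : L) :
    slice (ofBlocks e F X) c d = ∑ k ∈ F, ∑ l ∈ F, (⟪c, e k⟫_ℂ * ⟪e l, d⟫_ℂ) • X k l := by
  ext b
  refine ext_inner_left ℂ fun a => ?_
  rw [inner_slice, inner_ofBlocks]
  simp only [sum_apply, inner_sum]
  refine Finset.sum_congr rfl fun k _ => Finset.sum_congr rfl fun l _ => ?_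
  rw [adjoint_tmulRight_tmulRight, adjoint_tmulRight_tmulRight, map_smul, smul_apply,
    inner_smul_left, inner_smul_right, inner_smul_right, inner_conj_symm]
  ring

theorem slice_oneTensor (T : L →L[ℂ] L) (c d : L) :
    slice (oneTensor K T) c d = ⟪c, T d⟫_ℂ • (1 : K →L[ℂ] K) := by
  ext b
  refine ext_inner_left ℂ fun a => ?_
  rw [inner_slice, oneTensor_tmul, inner_tmulRight, smul_apply, inner_smul_right, mul_comm]
  rfl

theorem slice_add (S T : HTensor K L →L[ℂ] HTensor K L) (c d : L) :
    slice (S + T) c d = slice S c d + slice T c d := by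
  simp [slice, ContinuousLinearMap.add_comp, ContinuousLinearMap.comp_add]

theorem slice_sub (S T : HTensor K L →L[ℂ] HTensor K L) (c d : L) :
    slice (S - T) c d = slice S c d - slice T c d := by
  simp [slice, ContinuousLinearMap.sub_comp, ContinuousLinearMap.comp_sub]

theorem slice_smul (z : ℂ) (T : HTensor K L →L[ℂ] HTensor K L) (c d : L) :
    slice (z • T) c d = z • slice T c d := by
  simp [slice, ContinuousLinearMap.smul_comp]

theorem sum_inner_slice {κ : Type*} (e : κ → L) (F : Finset κ)
    (T : HTensor K L →L[ℂ] HTensor K L) (v w : κ → K) :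
    ∑ k ∈ F, ∑ l ∈ F, ⟪v k, slice T (e k) (e l) (w l)⟫_ℂ =
      ⟪∑ k ∈ F, tmulRight K (e k) (v k), T (∑ k ∈ F, tmulRight K (e k) (w k))⟫_ℂ := by
  rw [sum_inner, map_sum]
  refine Finset.sum_congr rfl fun k _ => ?_
  rw [inner_sum]
  exact Finset.sum_congr rfl fun l _ => inner_slice _ _ _ _ _

theorem posOn_slice {T : HTensor K L →L[ℂ] HTensor K L} (hT : 0 ≤ T) {κ : Type*} (e : κ → L)
    (F : Finset κ) : PosOn F fun k l => slice T (e k) (e l) := fun v => by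
  rw [sum_inner_slice]
  exact nonneg_iff_inner.1 hT _

/-- The projection `1 ⊗ P` with `P` the projection onto the span of `e k`, `k ∈ F`. -/
def blockProj {κ : Type*} (e : κ → L) (F : Finset κ) (u : HTensor K L) : HTensor K L :=
  ∑ k ∈ F, tmulRight K (e k) (ContinuousLinearMap.adjoint (tmulRight K (e k)) u)

theorem norm_sq_sum_tmulRight {κ : Type*} {e : κ → L} (he : Orthonormal ℂ e) (F : Finset κ)
    (v : κ → K) : ‖∑ k ∈ F, tmulRight K (e k) (v k)‖ ^ 2 = ∑ k ∈ F, ‖v k‖ ^ 2 := by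
  classical
  have h : ((‖∑ k ∈ F, tmulRight K (e k) (v k)‖ ^ 2 : ℝ) : ℂ) = ((∑ k ∈ F, ‖v k‖ ^ 2 : ℝ) : ℂ) := by
    have := inner_self_eq_norm_sq_to_K (𝕜 := ℂ) (∑ k ∈ F, tmulRight K (e k) (v k))
    push_cast
    refine this.symm.trans ?_
    rw [sum_inner]
    refine Finset.sum_congr rfl fun k hk => ?_
    rw [inner_sum, Finset.sum_eq_single k]
    · rw [inner_tmulRight, (orthonormal_iff_ite.1 he) k k, if_pos rfl, mul_one]
      exact inner_self_eq_norm_sq_to_K _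
    · intro l _ hl
      rw [inner_tmulRight, (orthonormal_iff_ite.1 he) k l, if_neg hl.symm, mul_zero]
    · exact fun h => (h hk).elim
  exact_mod_cast h

/-- Bessel's inequality for blocks: the left side is `‖P u‖² = ⟪u, P u⟫ ≤ ‖u‖ ‖P u‖` for `P =
blockProj e F`. -/
theorem sum_norm_sq_adjoint_le {κ : Type*} {e : κ → L} (he : Orthonormal ℂ e) (F : Finset κ)
    (u : HTensor K L) :
    ∑ k ∈ F, ‖ContinuousLinearMap.adjoint (tmulRight K (e k)) u‖ ^ 2 ≤ ‖u‖ ^ 2 := by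
  have h1 := norm_sq_sum_tmulRight he F fun k => ContinuousLinearMap.adjoint (tmulRight K (e k)) u
  have h2 : (⟪u, blockProj e F u⟫_ℂ).re =
      ∑ k ∈ F, ‖ContinuousLinearMap.adjoint (tmulRight K (e k)) u‖ ^ 2 := by
    rw [blockProj, inner_sum, Complex.re_sum]
    refine Finset.sum_congr rfl fun k _ => ?_
    rw [← ContinuousLinearMap.adjoint_inner_left]
    exact inner_self_eq_norm_sq (𝕜 := ℂ) _
  have h3 : (⟪u, blockProj e F u⟫_ℂ).re ≤ ‖u‖ * ‖blockProj e F u‖ :=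
    (Complex.re_le_norm _).trans (norm_inner_le_norm _ _)
  rw [h2, ← h1] at h3
  change ‖blockProj e F u‖ ^ 2 ≤ ‖u‖ * ‖blockProj e F u‖ at h3
  rw [← h1]
  change ‖blockProj e F u‖ ^ 2 ≤ ‖u‖ ^ 2
  by_contra! hcon
  have := lt_of_pow_lt_pow_left₀ 2 (norm_nonneg _) hcon
  nlinarith [norm_nonneg u]

theorem norm_blockProj_le {κ : Type*} {e : κ → L} (he : Orthonormal ℂ e) (F : Finset κ)
    (u : HTensor K L) : ‖blockProj e F u‖ ≤ ‖u‖ := by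
  refine le_of_sq_le_sq ?_ (norm_nonneg _)
  refine le_trans ?_ (sum_norm_sq_adjoint_le he F u)
  exact (norm_sq_sum_tmulRight he F _).le

theorem blockProj_add {κ : Type*} (e : κ → L) (F : Finset κ) (u v : HTensor K L) :
    blockProj e F (u + v) = blockProj e F u + blockProj e F v := by
  simp [blockProj, Finset.sum_add_distrib]

theorem blockProj_sub {κ : Type*} (e : κ → L) (F : Finset κ) (u v : HTensor K L) :
    blockProj e F (u - v) = blockProj e F u - blockProj e F v := by
  simp [blockProj, Finset.sum_sub_distrib]

/-- On elementary tensors this is the expansion of the second factor in the basis; the uniform bound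
`‖blockProj‖ ≤ 1` carries it to the completion. -/
theorem tendsto_blockProj {κ : Type*} (b : HilbertBasis κ ℂ L) (u : HTensor K L) :
    Tendsto (fun F => blockProj b F u) atTop (𝓝 u) := by
  have h1 : ∀ v : K ⊗[ℂ] L, Tendsto (fun F => blockProj b F (v : HTensor K L)) atTop
      (𝓝 (v : HTensor K L)) := by
    intro v
    induction v with
    | zero => simp [blockProj, UniformSpace.Completion.coe_zero]
    | add x y hx hy =>
      simp only [UniformSpace.Completion.coe_add, blockProj_add]
      exact hx.add hy
    | tmul a c =>
      change Tendsto (fun F => blockProj b F (tmulRight K c a)) atTop (𝓝 (tmulRight K c a))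
      have e : ∀ F, blockProj b F (tmulRight K c a) = tmulRight K (cutoff b F c) a := by
        intro F
        rw [cutoff, tmulRight_sum_smul, blockProj]
        refine Finset.sum_congr rfl fun k _ => ?_
        rw [adjoint_tmulRight_tmulRight, map_smul]
      simp only [e]
      rw [tendsto_iff_norm_sub_tendsto_zero]
      have e2 : ∀ F, ‖tmulRight K (cutoff b F c) a - tmulRight K c a‖ =
          ‖a‖ * ‖cutoff b F c - c‖ := by
        intro F
        rw [← norm_tmulRight, ← tmulRightL_apply, ← tmulRightL_apply, ← tmulRightL_apply, map_sub]
        rfl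
      simp only [e2]
      simpa using (tendsto_iff_norm_sub_tendsto_zero.1 (tendsto_cutoff b c)).const_mul ‖a‖
  rw [Metric.tendsto_nhds]
  intro ε hε
  obtain ⟨v, hv⟩ := Metric.denseRange_iff.1
    (UniformSpace.Completion.denseRange_coe (α := K ⊗[ℂ] L)) u (ε / 3) (by positivity)
  filter_upwards [Metric.tendsto_nhds.1 (h1 v) (ε / 3) (by positivity)] with F hF
  have h2 : dist (blockProj b F u) (blockProj b F (v : HTensor K L)) < ε / 3 := by
    rw [dist_eq_norm, ← blockProj_sub]
    refine (norm_blockProj_le b.orthonormal F _).trans_lt ?_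
    rwa [← dist_eq_norm]
  have h3 := dist_triangle4 (blockProj b F u) (blockProj b F (v : HTensor K L)) v u
  rw [dist_comm (v : HTensor K L) u] at h3
  linarith

theorem tendsto_inner_blockProj {κ : Type*} (b : HilbertBasis κ ℂ L)
    (T : HTensor K L →L[ℂ] HTensor K L) (u v : HTensor K L) :
    Tendsto (fun F : Finset κ => ∑ k ∈ F, ∑ l ∈ F,
      ⟪ContinuousLinearMap.adjoint (tmulRight K (b k)) u, slice T (b k) (b l)
        (ContinuousLinearMap.adjoint (tmulRight K (b l)) v)⟫_ℂ) atTop (𝓝 ⟪u, T v⟫_ℂ) := by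
  simp only [sum_inner_slice]
  exact (tendsto_blockProj b u).inner ((T.continuous.tendsto _).comp (tendsto_blockProj b v))

/-- The quadratic form of a bounded operator is the limit of the forms of its finite compressions.
-/
theorem nonneg_of_posOn {κ : Type*} (b : HilbertBasis κ ℂ L) {T : HTensor K L →L[ℂ] HTensor K L}
    (h : ∀ F : Finset κ, PosOn F fun k l => slice T (b k) (b l)) : 0 ≤ T := by
  rw [nonneg_iff_inner]
  intro u
  exact ge_of_tendsto' (tendsto_inner_blockProj b T u u) fun F => h F _

theorem ofBlocks_nonneg {κ : Type*} (e : κ → L) (F : Finset κ) {X : κ → κ → K →L[ℂ] K}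
    (h : PosOn F X) : 0 ≤ ofBlocks e F X := by
  rw [nonneg_iff_inner]
  intro u
  rw [inner_ofBlocks]
  exact h _

end TensorBlocks

/-! ### The pairing of block operators and its tail estimate -/

section BlockPairing

variable {K : Type*} [NormedAddCommGroup K] [InnerProductSpace ℂ K] [CompleteSpace K]

/-- `tr (J X)` for block operators, restricted to the blocks in `F`. -/
def blockPairing {κ : Type*} (J : κ → κ → TraceClass K) (F : Finset κ)
    (X : κ → κ → K →L[ℂ] K) : ℂ :=
  ∑ k ∈ F, ∑ l ∈ F, trace ((J k l : K →L[ℂ] K) * X l k)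

variable {κ : Type*} (J : κ → κ → TraceClass K) (F : Finset κ)

theorem blockPairing_add (X Y : κ → κ → K →L[ℂ] K) :
    blockPairing J F (fun k l => X k l + Y k l) = blockPairing J F X + blockPairing J F Y := by
  simp only [blockPairing, trace_mul_add, Finset.sum_add_distrib]

theorem blockPairing_smul (z : ℂ) (X : κ → κ → K →L[ℂ] K) :
    blockPairing J F (fun k l => z • X k l) = z * blockPairing J F X := by
  simp only [blockPairing, trace_mul_smul, Finset.mul_sum]

theorem blockPairing_sub (X Y : κ → κ → K →L[ℂ] K) :
    blockPairing J F (fun k l => X k l - Y k l) = blockPairing J F X - blockPairing J F Y := by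
  have h : (fun k l => X k l - Y k l) = fun k l => X k l + (-1 : ℂ) • Y k l := by
    funext k l; rw [neg_one_smul, sub_eq_add_neg]
  rw [h, blockPairing_add, blockPairing_smul]
  ring

theorem blockPairing_sub_left (J' : κ → κ → TraceClass K) (X : κ → κ → K →L[ℂ] K) :
    blockPairing (fun k l => J k l - J' k l) F X = blockPairing J F X - blockPairing J' F X := by
  simp only [blockPairing, ← traceMulL_apply, map_sub, Finset.sum_sub_distrib]

variable {J F}

theorem blockPairing_nonneg (hJ : PosOn F fun k l => (J k l : K →L[ℂ] K))
    {X : κ → κ → K →L[ℂ] K} (hX : PosOn F X) : 0 ≤ blockPairing J F X :=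
  pairing_nonneg F J X hJ hX

theorem PosOn.add {X Y : κ → κ → K →L[ℂ] K} (hX : PosOn F X) (hY : PosOn F Y) :
    PosOn F fun k l => X k l + Y k l := fun v => by
  simp only [add_apply, inner_add_right, Finset.sum_add_distrib]
  exact add_nonneg (hX v) (hY v)

theorem PosOn.smul {X : κ → κ → K →L[ℂ] K} (hX : PosOn F X) {r : ℝ} (hr : 0 ≤ r) :
    PosOn F fun k l => (r : ℂ) • X k l := fun v => by
  simp only [smul_apply, inner_smul_right, ← Finset.mul_sum]
  exact mul_nonneg (Complex.zero_le_real.2 hr) (hX v)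

theorem PosOn.congr {X Y : κ → κ → K →L[ℂ] K} (hX : PosOn F X)
    (h : ∀ k ∈ F, ∀ l ∈ F, Y k l = X k l) : PosOn F Y := fun v => by
  refine (hX v).trans_eq ?_
  exact Finset.sum_congr rfl fun k hk => Finset.sum_congr rfl fun l hl => by rw [h k hk l hl]

theorem PosOn.conj_smul {X : κ → κ → K →L[ℂ] K} (hX : PosOn F X) (c : κ → ℂ) :
    PosOn F fun k l => (starRingEnd ℂ (c k) * c l) • X k l := fun v => by
  refine (hX fun k => c k • v k).trans_eq ?_
  refine Finset.sum_congr rfl fun k _ => Finset.sum_congr rfl fun l _ => ?_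
  rw [map_smul, inner_smul_left, inner_smul_right, smul_apply, inner_smul_right]
  ring

theorem re_blockPairing_mono (hJ : PosOn F fun k l => (J k l : K →L[ℂ] K))
    {X Y : κ → κ → K →L[ℂ] K} (h : PosOn F fun k l => Y k l - X k l) :
    (blockPairing J F X).re ≤ (blockPairing J F Y).re := by
  have := blockPairing_nonneg hJ h
  rw [blockPairing_sub, Complex.nonneg_iff, Complex.sub_re] at this
  linarith [this.1]

/-- Positive semidefiniteness of a scalar matrix on finite index sets. -/
def ScalarPosOn (F : Finset κ) (R : κ → κ → ℂ) : Prop :=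
  ∀ c : κ → ℂ, 0 ≤ ∑ k ∈ F, ∑ l ∈ F, starRingEnd ℂ (c k) * R k l * c l

theorem inner_self_nonneg_complex (x : K) : 0 ≤ ⟪x, x⟫_ℂ :=
  nonneg_iff_inner.1 ((ContinuousLinearMap.nonneg_iff_isPositive _).2
    ContinuousLinearMap.isPositive_one) x

/-- A Gram factorisation of `R` makes the form of `1 ⊗ R` a sum of squared norms in `K`. -/
theorem ScalarPosOn.posOn {R : κ → κ → ℂ} (h : ScalarPosOn F R) :
    PosOn F fun k l => R k l • (1 : K →L[ℂ] K) := fun v => by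
  obtain ⟨m, hm⟩ := exists_gram F R h
  have e : ∑ k ∈ F, ∑ l ∈ F, ⟪v k, (R k l • (1 : K →L[ℂ] K)) (v l)⟫_ℂ =
      ∑ r, ⟪∑ k ∈ F, m r k • v k, ∑ k ∈ F, m r k • v k⟫_ℂ := by
    simp only [sum_inner, inner_sum]
    rw [Finset.sum_comm, Finset.sum_comm (s := Finset.univ)]
    refine Finset.sum_congr rfl fun l hl => ?_
    rw [Finset.sum_comm (s := Finset.univ)]
    refine Finset.sum_congr rfl fun k hk => ?_
    rw [smul_apply, inner_smul_right, hm k hk l hl, Finset.sum_mul]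
    refine Finset.sum_congr rfl fun r _ => ?_
    rw [inner_smul_left, inner_smul_right, one_apply_eq_self]
    ring
  rw [e]
  refine Finset.sum_nonneg fun r _ => ?_
  exact inner_self_nonneg_complex _

theorem ScalarPosOn.diag {R : κ → κ → ℂ} (h : ScalarPosOn F R) {k : κ} (hk : k ∈ F) :
    0 ≤ R k k := by
  obtain ⟨m, hm⟩ := exists_gram F R h
  rw [hm k hk k hk]
  refine Finset.sum_nonneg fun r _ => ?_
  rw [Complex.conj_mul']
  exact_mod_cast sq_nonneg ‖_‖

theorem ScalarPosOn.add {R S : κ → κ → ℂ} (hR : ScalarPosOn F R) (hS : ScalarPosOn F S) :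
    ScalarPosOn F fun k l => R k l + S k l := fun c => by
  simp only [mul_add, add_mul, Finset.sum_add_distrib]
  exact add_nonneg (hR c) (hS c)

theorem ScalarPosOn.smul {R : κ → κ → ℂ} (hR : ScalarPosOn F R) {r : ℝ} (hr : 0 ≤ r) :
    ScalarPosOn F fun k l => (r : ℂ) * R k l := fun c => by
  have e : ∑ k ∈ F, ∑ l ∈ F, starRingEnd ℂ (c k) * (r * R k l) * c l =
      r * ∑ k ∈ F, ∑ l ∈ F, starRingEnd ℂ (c k) * R k l * c l := by
    simp only [Finset.mul_sum]
    exact Finset.sum_congr rfl fun k _ => Finset.sum_congr rfl fun l _ => by ring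
  rw [e]
  exact mul_nonneg (Complex.zero_le_real.2 hr) (hR c)

/-- A test vector can be absorbed into the blocks of `X` without losing positivity. The objective is
thereby the sum of all entries of a positive matrix, to which `abs_sum_sub_sum_le` applies. -/
theorem scalarPosOn_pairing (hJ : PosOn F fun k l => (J k l : K →L[ℂ] K))
    {X : κ → κ → K →L[ℂ] K} (hX : PosOn F X) :
    ScalarPosOn F fun k l => trace ((J k l : K →L[ℂ] K) * X l k) := fun c => by
  refine (blockPairing_nonneg hJ (hX.conj_smul fun k => starRingEnd ℂ (c k))).trans_eq ?_
  refine Finset.sum_congr rfl fun k _ => Finset.sum_congr rfl fun l _ => ?_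
  rw [trace_mul_smul, Complex.conj_conj]
  ring

open scoped Classical in
/-- Comparison of the entry sums of a positive semidefinite matrix over nested index sets. -/
theorem abs_sum_sub_sum_le {N : κ → κ → ℂ} (hN : ScalarPosOn F N) {M : ℝ} (hM : 0 ≤ M)
    {μ : κ → ℝ} (hle : ∀ G ⊆ F, (∑ k ∈ G, ∑ l ∈ G, N k l).re ≤ M * ∑ k ∈ G, μ k)
    (hμ0 : ∀ k ∈ F, 0 ≤ μ k) (hμ : ∑ k ∈ F, μ k ≤ 1) {G : Finset κ} (hG : G ⊆ F) :
    |(∑ k ∈ F, ∑ l ∈ F, N k l).re - (∑ k ∈ G, ∑ l ∈ G, N k l).re| ≤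
      3 * M * √(∑ k ∈ F \ G, μ k) := by
  set Q := F \ G with hQ
  set n : Finset κ → Finset κ → ℝ := fun S T => (∑ k ∈ S, ∑ l ∈ T, N k l).re with hn
  have hsplit : ∀ f : κ → ℂ, ∑ k ∈ F, f k = ∑ k ∈ G, f k + ∑ k ∈ Q, f k := fun f => by
    rw [hQ, add_comm, Finset.sum_sdiff hG]
  -- The form is tested at the vector equal to `1` on `G` and to a real `t` on `F \ G`. The
  -- discriminant of this nonnegative polynomial bounds the cross terms.
  have hquad : ∀ t : ℝ, 0 ≤ n Q Q * (t * t) + (n G Q + n Q G) * t + n G G := by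
    intro t
    have h := hN fun k => if k ∈ G then 1 else (t : ℂ)
    have e1 : ∀ f : κ → ℂ, ∑ k ∈ G, (if k ∈ G then (1 : ℂ) else t) * f k = ∑ k ∈ G, f k :=
      fun f => Finset.sum_congr rfl fun k hk => by simp [hk]
    have e2 : ∀ f : κ → ℂ, ∑ k ∈ Q, (if k ∈ G then (1 : ℂ) else t) * f k = t * ∑ k ∈ Q, f k :=
      fun f => by
        rw [Finset.mul_sum]
        exact Finset.sum_congr rfl fun k hk => by simp [(Finset.mem_sdiff.1 hk).2]
    have e3 : ∑ k ∈ F, ∑ l ∈ F, starRingEnd ℂ (if k ∈ G then 1 else (t : ℂ)) * N k l *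
        (if l ∈ G then 1 else (t : ℂ)) = ∑ k ∈ F, (if k ∈ G then (1 : ℂ) else t) *
        ∑ l ∈ F, (if l ∈ G then (1 : ℂ) else t) * N k l := by
      refine Finset.sum_congr rfl fun k _ => ?_
      rw [Finset.mul_sum]
      refine Finset.sum_congr rfl fun l _ => ?_
      have : starRingEnd ℂ (if k ∈ G then 1 else (t : ℂ)) = if k ∈ G then 1 else (t : ℂ) := by
        split_ifs <;> simp
      rw [this]; ring
    rw [e3] at h
    simp only [hsplit, e1, e2, Finset.sum_add_distrib, ← Finset.mul_sum] at h
    have h2 := (Complex.nonneg_iff.1 h).1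
    simp only [Complex.add_re, Complex.re_ofReal_mul] at h2
    simp only [hn]
    linarith
  have hd := discrim_le_zero hquad
  rw [discrim] at hd
  have hF : n F F = n G G + (n G Q + n Q G) + n Q Q := by
    simp only [hn, hsplit, Finset.sum_add_distrib, Complex.add_re]
    ring
  have hQF : Q ⊆ F := Finset.sdiff_subset
  have hμG : ∑ k ∈ G, μ k ≤ 1 :=
    (Finset.sum_le_sum_of_subset_of_nonneg hG fun k hk _ => hμ0 k hk).trans hμ
  have hμQ : ∑ k ∈ Q, μ k ≤ 1 :=
    (Finset.sum_le_sum_of_subset_of_nonneg hQF fun k hk _ => hμ0 k hk).trans hμ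
  have hμQ0 : 0 ≤ ∑ k ∈ Q, μ k := Finset.sum_nonneg fun k hk => hμ0 k (hQF hk)
  set s := √(∑ k ∈ Q, μ k) with hs
  have hs0 : 0 ≤ s := Real.sqrt_nonneg _
  have hss : s * s = ∑ k ∈ Q, μ k := Real.mul_self_sqrt hμQ0
  have hs1 : s ≤ 1 := by
    by_contra! hcon
    nlinarith
  have hQQ : n Q Q ≤ M * (s * s) := by rw [hss]; exact hle Q hQF
  have hGG : n G G ≤ M := (hle G hG).trans (by nlinarith)
  have hQQ0 : 0 ≤ n Q Q := by
    have hpos : (0 : ℂ) ≤ ∑ k ∈ Q, ∑ l ∈ Q, N k l := by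
      have h := hN fun k => if k ∈ Q then 1 else 0
      have e1 : ∀ f : κ → ℂ, ∑ k ∈ F, (if k ∈ Q then f k else 0) = ∑ k ∈ Q, f k := fun f => by
        rw [← Finset.sum_filter, Finset.filter_mem_eq_inter, Finset.inter_eq_right.2 hQF]
      refine h.trans_eq ?_
      rw [← e1]
      refine Finset.sum_congr rfl fun k _ => ?_
      rw [← e1]
      split_ifs
      · refine Finset.sum_congr rfl fun l _ => ?_
        split_ifs <;> simp
      · simp
    exact (Complex.nonneg_iff.1 hpos).1
  have hGG0 : 0 ≤ n G G := by have := hquad 0; simpa using this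
  -- The cross terms cost `2 M s` and the corner outside `G` costs `M s² ≤ M s`; together they give
  -- the factor `3`.
  have hz : |n G Q + n Q G| ≤ 2 * M * s := by
    refine abs_le_of_sq_le_sq ?_ (by positivity)
    have h5 : n Q Q * n G G ≤ M * (s * s) * M := mul_le_mul hQQ hGG hGG0 (by positivity)
    nlinarith
  change |n F F - n G G| ≤ _
  have h6 : n F F - n G G = (n G Q + n Q G) + n Q Q := by rw [hF]; ring
  rw [h6]
  refine (abs_add_le _ _).trans ?_
  rw [abs_of_nonneg hQQ0]
  have h7 : M * (s * s) ≤ M * s := by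
    apply mul_le_mul_of_nonneg_left _ hM
    nlinarith
  linarith

end BlockPairing

/-! ### Finite programmes and the existence of the limit `tr J V` -/

section FinitePrimal

variable {A B : Type*} [NormedAddCommGroup A] [InnerProductSpace ℂ A] [CompleteSpace A]
  [NormedAddCommGroup B] [InnerProductSpace ℂ B] [CompleteSpace B] {ι : Type*}

theorem IsCompletelyPositive.map_nonneg {Φ : TraceClass A →ₗ[ℂ] TraceClass B}
    (hΦ : IsCompletelyPositive Φ) (T : TraceClass A) (hT : 0 ≤ (T : A →L[ℂ] A)) :
    0 ≤ (Φ T : B →L[ℂ] B) := by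
  rw [nonneg_iff_inner]
  intro x
  have h := hΦ 1 (fun _ _ => T) (fun s v => by
    simpa only [map_sum, sum_inner, inner_sum] using
      (nonneg_iff_inner.1 hT (∑ i ∈ s, v i)).trans_eq (by
        rw [map_sum, sum_inner]; exact Finset.sum_congr rfl fun i _ => inner_sum _ _ _)) {0} (fun _ => x)
  simpa using h

/-- The blocks `|k⟩⟨l|` are those of `|Φ_F⟩⟨Φ_F|`, whose form is a squared modulus. Numbering `F`
makes the definition of complete positivity applicable. -/
theorem IsCompletelyPositive.posOn_choi {Φ : TraceClass A →ₗ[ℂ] TraceClass B}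
    (hΦ : IsCompletelyPositive Φ) (H : Hamiltonian ι A) (F : Finset ι) :
    PosOn F fun k l => (choi Φ H k l : B →L[ℂ] B) := fun v => by
  have h := hΦ F.card (fun i j => ketBra (H.basis (F.equivFin.symm i)) (H.basis (F.equivFin.symm j)))
    (fun s v => by
      have e : ∑ i ∈ s, ∑ j ∈ s, ⟪v i, (ketBra (H.basis (F.equivFin.symm i))
          (H.basis (F.equivFin.symm j)) : A →L[ℂ] A) (v j)⟫_ℂ =
          starRingEnd ℂ (∑ i ∈ s, ⟪H.basis (F.equivFin.symm i), v i⟫_ℂ) *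
          ∑ i ∈ s, ⟪H.basis (F.equivFin.symm i), v i⟫_ℂ := by
        rw [map_sum, Finset.sum_mul_sum]
        refine Finset.sum_congr rfl fun i _ => Finset.sum_congr rfl fun j _ => ?_
        rw [ketBra_apply, inner_smul_right, inner_conj_symm, mul_comm]
      rw [e]
      exact star_mul_self_nonneg _) Finset.univ (fun i => v (F.equivFin.symm i))
  refine h.trans_eq ?_
  rw [← Finset.sum_coe_sort F, ← F.equivFin.symm.sum_comp]
  refine Finset.sum_congr rfl fun i _ => ?_
  rw [← Finset.sum_coe_sort F, ← F.equivFin.symm.sum_comp]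
  rfl

theorem IsHermitianPreserving.exists_bound {Δ : TraceClass A →ₗ[ℂ] TraceClass B}
    (hΔ : IsHermitianPreserving Δ) : ∃ (Φ Ψ : TraceClass A →ₗ[ℂ] TraceClass B) (M : ℝ), 0 ≤ M ∧
      IsCompletelyPositive Φ ∧ IsCompletelyPositive Ψ ∧ Δ = Φ - Ψ ∧
      (∀ T : TraceClass A, 0 ≤ (T : A →L[ℂ] A) →
        (trace (Φ T : B →L[ℂ] B)).re ≤ M * (trace (T : A →L[ℂ] A)).re) ∧
      (∀ T : TraceClass A, 0 ≤ (T : A →L[ℂ] A) →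
        (trace (Ψ T : B →L[ℂ] B)).re ≤ M * (trace (T : A →L[ℂ] A)).re) := by
  obtain ⟨Φ, Ψ, hΦ, hΨ, rfl⟩ := hΔ
  obtain ⟨M, hM0, hM⟩ := exists_trace_bound Φ hΦ.map_nonneg
  obtain ⟨M', hM0', hM'⟩ := exists_trace_bound Ψ hΨ.map_nonneg
  refine ⟨Φ, Ψ, max M M', hM0.trans (le_max_left _ _), hΦ, hΨ, rfl, fun T hT => ?_, fun T hT => ?_⟩
  · exact (hM T hT).trans (mul_le_mul_of_nonneg_right (le_max_left _ _) (re_traceL_nonneg hT))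
  · exact (hM' T hT).trans (mul_le_mul_of_nonneg_right (le_max_right _ _) (re_traceL_nonneg hT))

theorem choi_sub (Φ Ψ : TraceClass A →ₗ[ℂ] TraceClass B) (H : Hamiltonian ι A) :
    choi (Φ - Ψ) H = fun k l => choi Φ H k l - choi Ψ H k l := rfl

/-- The operator on `A` with matrix `R` transposed. -/
def transposeOp (H : Hamiltonian ι A) (F : Finset ι) (R : ι → ι → ℂ) : TraceClass A :=
  ∑ k ∈ F, ∑ l ∈ F, R l k • ketBra (H.basis k) (H.basis l)

theorem transposeOp_nonneg (H : Hamiltonian ι A) {F : Finset ι} {R : ι → ι → ℂ}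
    (hR : ScalarPosOn F R) : 0 ≤ (transposeOp H F R : A →L[ℂ] A) := by
  rw [nonneg_iff_inner]
  intro x
  refine (hR fun k => ⟪x, H.basis k⟫_ℂ).trans_eq ?_
  rw [Finset.sum_comm]
  simp only [transposeOp, Submodule.coe_sum, Submodule.coe_smul, sum_apply, inner_sum, smul_apply,
    inner_smul_right, ketBra_apply]
  refine Finset.sum_congr rfl fun k _ => Finset.sum_congr rfl fun l _ => ?_
  rw [inner_conj_symm]
  ring

theorem trace_transposeOp (H : Hamiltonian ι A) (F : Finset ι) (R : ι → ι → ℂ) :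
    trace (transposeOp H F R : A →L[ℂ] A) = ∑ k ∈ F, R k k := by
  classical
  rw [← traceL_apply, transposeOp, map_sum]
  refine Finset.sum_congr rfl fun k hk => ?_
  rw [map_sum, Finset.sum_eq_single k]
  · rw [map_smul, traceL_apply, trace_ketBra, (orthonormal_iff_ite.1 H.basis.orthonormal) k k]
    simp
  · intro l _ hl
    rw [map_smul, traceL_apply, trace_ketBra, (orthonormal_iff_ite.1 H.basis.orthonormal) l k,
      if_neg hl, smul_zero]
  · exact fun h => (h hk).elim

/-- The transpose arises because `J` carries `|k⟩⟨l|` in block `(k, l)`. For a trace-annihilating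
map this makes `1 ⊗ R` invisible; for a positive map it brings in the trace bound. -/
theorem blockPairing_choi_scalar (Φ : TraceClass A →ₗ[ℂ] TraceClass B) (H : Hamiltonian ι A)
    (F : Finset ι) (R : ι → ι → ℂ) :
    blockPairing (choi Φ H) F (fun k l => R k l • (1 : B →L[ℂ] B)) =
      trace (Φ (transposeOp H F R) : B →L[ℂ] B) := by
  rw [← traceL_apply, transposeOp, blockPairing, map_sum, map_sum]
  refine Finset.sum_congr rfl fun k _ => ?_
  rw [map_sum, map_sum]
  refine Finset.sum_congr rfl fun l _ => ?_
  rw [map_smul, map_smul, trace_mul_smul, mul_one]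
  rfl

/-- Feasibility for the programme restricted to the blocks in the finite set `F`. -/
structure FinFeasible (H : Hamiltonian ι A) (E : ℝ) (F : Finset ι) (R : ι → ι → ℂ)
    (V : ι → ι → B →L[ℂ] B) : Prop where
  scalar : ScalarPosOn F R
  upper : PosOn F fun k l => R k l • (1 : B →L[ℂ] B) - V k l
  lower : PosOn F fun k l => R k l • (1 : B →L[ℂ] B) + V k l
  trace_le : ∑ k ∈ F, (R k k).re ≤ 1
  energy_le : ∑ k ∈ F, H.level k * (R k k).re ≤ E

/-- The objective values of the finite programmes. -/
def finValues (Δ : TraceClass A →ₗ[ℂ] TraceClass B) (H : Hamiltonian ι A) (E : ℝ) : Set ℝ :=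
  {t | ∃ (F : Finset ι) (R : ι → ι → ℂ) (V : ι → ι → B →L[ℂ] B),
    FinFeasible H E F R V ∧ t = (blockPairing (choi Δ H) F V).re}

section CP

variable {Φ : TraceClass A →ₗ[ℂ] TraceClass B} (hΦ : IsCompletelyPositive Φ) {M : ℝ}
  (hM : ∀ T : TraceClass A, 0 ≤ (T : A →L[ℂ] A) →
        (trace (Φ T : B →L[ℂ] B)).re ≤ M * (trace (T : A →L[ℂ] A)).re)
  {H : Hamiltonian ι A} {E : ℝ} {F : Finset ι} {R : ι → ι → ℂ} {V : ι → ι → B →L[ℂ] B}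

include hM in
theorem re_blockPairing_scalar_le (hR : ScalarPosOn F R) :
    (blockPairing (choi Φ H) F (fun k l => R k l • (1 : B →L[ℂ] B))).re ≤
      M * ∑ k ∈ F, (R k k).re := by
  rw [blockPairing_choi_scalar]
  have := hM _ (transposeOp_nonneg H hR)
  rwa [trace_transposeOp, Complex.re_sum] at this

include hΦ hM in
-- Pairing with a positive `J` preserves the two inequalities between `V` and `1 ⊗ R`.
theorem abs_re_blockPairing_le (h : FinFeasible H E F R V) :
    |(blockPairing (choi Φ H) F V).re| ≤ M * ∑ k ∈ F, (R k k).re := by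
  have hb := re_blockPairing_scalar_le (H := H) hM h.scalar
  rw [abs_le]
  constructor
  · have := blockPairing_nonneg (hΦ.posOn_choi H F) h.lower
    rw [blockPairing_add, Complex.nonneg_iff, Complex.add_re] at this
    linarith [this.1]
  · have := blockPairing_nonneg (hΦ.posOn_choi H F) h.upper
    rw [blockPairing_sub, Complex.nonneg_iff, Complex.sub_re] at this
    linarith [this.1]

include hΦ in
theorem im_blockPairing_eq_zero (h : FinFeasible H E F R V) :
    (blockPairing (choi Φ H) F V).im = 0 := by
  have h1 := (Complex.nonneg_iff.1 (blockPairing_nonneg (hΦ.posOn_choi H F) h.lower)).2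
  have h2 := (Complex.nonneg_iff.1 (blockPairing_nonneg (hΦ.posOn_choi H F) h.upper)).2
  rw [blockPairing_add, Complex.add_im] at h1
  rw [blockPairing_sub, Complex.sub_im] at h2
  linarith

open scoped Classical in
include hΦ hM in
theorem abs_tail_pos_le (hM0 : 0 ≤ M) {W : ι → ι → B →L[ℂ] B} (hR : ∀ F, ScalarPosOn F R)
    (hW : ∀ F, PosOn F W) (hW' : ∀ F, PosOn F fun k l => R k l • (1 : B →L[ℂ] B) - W k l)
    (htr : ∑ k ∈ F, (R k k).re ≤ 1) {G : Finset ι} (hG : G ⊆ F) :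
    |(blockPairing (choi Φ H) F W).re - (blockPairing (choi Φ H) G W).re| ≤
      3 * M * √(∑ k ∈ F \ G, (R k k).re) := by
  refine abs_sum_sub_sum_le (scalarPosOn_pairing (hΦ.posOn_choi H F) (hW F)) hM0 (fun G _ => ?_)
    (fun k hk => (Complex.nonneg_iff.1 ((hR F).diag hk)).1) htr hG
  exact (re_blockPairing_mono (hΦ.posOn_choi H G) (hW' G)).trans
    (re_blockPairing_scalar_le hM (hR G))

open scoped Classical in
include hΦ hM in
-- Writing `V` as twice the positive block operator `(1 ⊗ R + V) / 2` minus `1 ⊗ R` gives two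
-- instances of the positive case, whence `9 = 2 · 3 + 3`.
theorem abs_tail_le (hM0 : 0 ≤ M) (h : ∀ F, FinFeasible H E F R V) {G : Finset ι} (hG : G ⊆ F) :
    |(blockPairing (choi Φ H) F V).re - (blockPairing (choi Φ H) G V).re| ≤
      9 * M * √(∑ k ∈ F \ G, (R k k).re) := by
  have e : ∀ F, (blockPairing (choi Φ H) F V).re =
      2 * (blockPairing (choi Φ H) F
        (fun k l => ((1 / 2 : ℝ) : ℂ) • (R k l • (1 : B →L[ℂ] B) + V k l))).re -
      (blockPairing (choi Φ H) F (fun k l => R k l • (1 : B →L[ℂ] B))).re := by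
    intro F
    rw [blockPairing_smul, blockPairing_add, Complex.re_ofReal_mul, Complex.add_re]
    ring
  have h1 := abs_tail_pos_le hΦ hM (H := H) hM0 (fun F => (h F).scalar)
    (fun F => (h F).lower.smul (r := 1 / 2) (by norm_num)) (fun F => by
      refine ((h F).upper.smul (r := 1 / 2) (by norm_num)).congr fun k _ l _ => ?_
      push_cast
      module) (h F).trace_le hG
  have h2 := abs_tail_pos_le hΦ hM (H := H) hM0 (fun F => (h F).scalar)
    (fun F => ((h F).scalar.posOn (K := B))) (fun F v => by simp) (h F).trace_le hG
  rw [e, e]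
  rw [abs_le] at h1 h2 ⊢
  constructor <;> linarith

end CP

variable {Δ : TraceClass A →ₗ[ℂ] TraceClass B} {H : Hamiltonian ι A} {E : ℝ}

theorem bddAbove_finValues (hΔ : IsHermitianPreserving Δ) : BddAbove (finValues Δ H E) := by
  obtain ⟨Φ, Ψ, M, hM0, hΦ, hΨ, rfl, hMΦ, hMΨ⟩ := hΔ.exists_bound
  refine ⟨2 * M, ?_⟩
  rintro t ⟨F, R, V, h, rfl⟩
  rw [choi_sub, blockPairing_sub_left, Complex.sub_re]
  have h1 := abs_le.1 (abs_re_blockPairing_le hΦ hMΦ h)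
  have h2 := abs_le.1 (abs_re_blockPairing_le hΨ hMΨ h)
  have h3 := mul_le_mul_of_nonneg_left h.trace_le hM0
  linarith [h1.2, h2.1]

theorem zero_mem_finValues (hE : 0 ≤ E) : (0 : ℝ) ∈ finValues Δ H E :=
  ⟨∅, 0, 0, ⟨fun c => by simp, fun v => by simp, fun v => by simp, by simp, by simpa using hE⟩,
    by simp [blockPairing]⟩

theorem im_blockPairing_choi_eq_zero (hΔ : IsHermitianPreserving Δ) {F : Finset ι}
    {R : ι → ι → ℂ} {V : ι → ι → B →L[ℂ] B} (h : FinFeasible H E F R V) :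
    (blockPairing (choi Δ H) F V).im = 0 := by
  obtain ⟨Φ, Ψ, hΦ, hΨ, rfl⟩ := hΔ
  rw [choi_sub, blockPairing_sub_left, Complex.sub_im, im_blockPairing_eq_zero hΦ h,
    im_blockPairing_eq_zero hΨ h, sub_zero]

open scoped Classical in
-- The two completely positive parts contribute `9 M` each. The constant is independent of the
-- feasible point, as the attainment argument requires.
theorem exists_tail_bound (hΔ : IsHermitianPreserving Δ) (H : Hamiltonian ι A) (E : ℝ) :
    ∃ M : ℝ, 0 ≤ M ∧ ∀ (R : ι → ι → ℂ) (V : ι → ι → B →L[ℂ] B),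
      (∀ F, FinFeasible H E F R V) → ∀ F G : Finset ι, G ⊆ F →
      |(blockPairing (choi Δ H) F V).re - (blockPairing (choi Δ H) G V).re| ≤
        M * √(∑ k ∈ F \ G, (R k k).re) := by
  obtain ⟨Φ, Ψ, M, hM0, hΦ, hΨ, rfl, hMΦ, hMΨ⟩ := hΔ.exists_bound
  refine ⟨18 * M, by positivity, fun R V h F G hG => ?_⟩
  rw [choi_sub, blockPairing_sub_left, blockPairing_sub_left, Complex.sub_re, Complex.sub_re]
  have h1 := abs_le.1 (abs_tail_le hΦ hMΦ hM0 h hG)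
  have h2 := abs_le.1 (abs_tail_le hΨ hMΨ hM0 h hG)
  rw [abs_le]
  constructor <;> linarith [h1.1, h1.2, h2.1, h2.2]

theorem sum_level_le_of_meanEnergy_le (hE : 0 ≤ E) {ρ : A →L[ℂ] A} (hρ : 0 ≤ ρ)
    (h : H.meanEnergy ρ ≤ ENNReal.ofReal E) (F : Finset ι) :
    ∑ k ∈ F, H.level k * (⟪H.basis k, ρ (H.basis k)⟫_ℂ).re ≤ E := by
  have h1 := (ENNReal.sum_le_tsum F).trans h
  rw [← ENNReal.ofReal_sum_of_nonneg fun k _ =>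
    mul_nonneg (H.level_nonneg k) (inner_re_nonneg hρ _)] at h1
  exact (ENNReal.ofReal_le_ofReal_iff hE).1 h1

theorem scalarPosOn_of_nonneg {ρ : A →L[ℂ] A} (hρ : 0 ≤ ρ) (b : ι → A) (F : Finset ι) :
    ScalarPosOn F fun k l => ⟪b k, ρ (b l)⟫_ℂ := fun c => by
  refine (nonneg_iff_inner.1 hρ (∑ k ∈ F, c k • b k)).trans_eq ?_
  rw [map_sum, sum_inner]
  refine Finset.sum_congr rfl fun k _ => ?_
  rw [inner_sum]
  refine Finset.sum_congr rfl fun l _ => ?_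
  rw [map_smul, inner_smul_left, inner_smul_right]
  ring

theorem IsFeasible.finFeasible (hE : 0 ≤ E) {ρ : A →L[ℂ] A} {V : HTensor B A →L[ℂ] HTensor B A}
    (h : IsFeasible H E ρ V) (F : Finset ι) :
    FinFeasible H E F (fun k l => ⟪H.basis k, ρ (H.basis l)⟫_ℂ)
      (fun k l => slice V (H.basis k) (H.basis l)) where
  scalar := scalarPosOn_of_nonneg h.1.nonneg _ F
  upper := by
    have := posOn_slice (sub_nonneg.2 h.2.2.2) H.basis F
    simpa only [slice_sub, slice_oneTensor] using this
  lower := by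
    have := posOn_slice (neg_le_iff_add_nonneg'.1 h.2.2.1) H.basis F
    simpa only [slice_add, slice_oneTensor] using this
  trace_le := by
    have := sum_inner_le_trace h.1.nonneg h.1.mem_traceClass H.basis.orthonormal F
    rwa [h.1.trace_eq_one] at this
  energy_le := sum_level_le_of_meanEnergy_le hE h.1.nonneg h.2.1 F

theorem truncTrace_eq_blockPairing (Δ : TraceClass A →ₗ[ℂ] TraceClass B) (H : Hamiltonian ι A)
    (V : HTensor B A →L[ℂ] HTensor B A) (F : Finset ι) : truncTrace Δ H V F =
      blockPairing (choi Δ H) F (fun k l => slice V (H.basis k) (H.basis l)) := rfl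

/-- The limit `tr J V` exists and is real for feasible `V`. -/
theorem exists_hasTraceAgainstChoi (hΔ : IsHermitianPreserving Δ) (hE : 0 ≤ E) {ρ : A →L[ℂ] A}
    {V : HTensor B A →L[ℂ] HTensor B A} (h : IsFeasible H E ρ V) :
    ∃ t : ℝ, HasTraceAgainstChoi Δ H V t := by
  classical
  obtain ⟨M, hM0, hM⟩ := exists_tail_bound hΔ H E
  have hf := h.finFeasible hE
  set μ : ι → ℝ := fun k => (⟪H.basis k, ρ (H.basis k)⟫_ℂ).re with hμ
  have hμ0 : ∀ k, 0 ≤ μ k := fun k => inner_re_nonneg h.1.nonneg _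
  have hs : Summable μ := summable_of_sum_le hμ0 fun F => (hf F).trace_le
  have hre : ∀ F, truncTrace Δ H V F = ((truncTrace Δ H V F).re : ℂ) := fun F =>
    Complex.ext (by simp) (by
      rw [Complex.ofReal_im]
      exact im_blockPairing_choi_eq_zero hΔ (hf F))
  -- The diagonal of `ρ` is summable, so the tail estimate makes the truncated values a Cauchy net.
  have hc : CauchySeq fun F => (truncTrace Δ H V F).re := by
    rw [Metric.cauchySeq_iff']
    intro ε hε
    have hδ : 0 < (ε / (M + 1)) ^ 2 := by positivity
    obtain ⟨G, hG⟩ := summable_iff_vanishing_norm.1 hs _ hδ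
    refine ⟨G, fun F hF => ?_⟩
    rw [Real.dist_eq]
    refine (hM _ _ hf F G hF).trans_lt ?_
    have h1 := hG (F \ G) Finset.sdiff_disjoint
    rw [Real.norm_of_nonneg (Finset.sum_nonneg fun k _ => hμ0 k)] at h1
    have h2 : √(∑ k ∈ F \ G, μ k) < ε / (M + 1) := by
      rw [← Real.sqrt_sq (by positivity : 0 ≤ ε / (M + 1))]
      exact Real.sqrt_lt_sqrt (Finset.sum_nonneg fun k _ => hμ0 k) h1
    calc M * √(∑ k ∈ F \ G, μ k) ≤ (M + 1) * √(∑ k ∈ F \ G, μ k) := by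
          nlinarith [Real.sqrt_nonneg (∑ k ∈ F \ G, μ k)]
      _ < (M + 1) * (ε / (M + 1)) := by gcongr
      _ = ε := by field_simp
  obtain ⟨t, ht⟩ := cauchySeq_tendsto_of_complete hc
  refine ⟨t, ?_⟩
  have := (Complex.continuous_ofReal.tendsto t).comp ht
  exact this.congr fun F => (hre F).symm

theorem primalValues_le (hE : 0 ≤ E) {c : ℝ}
    (hc : c ∈ upperBounds (finValues Δ H E)) : c ∈ upperBounds (primalValues Δ H E) := by
  rintro t ⟨ρ, V, h, ht⟩
  have h1 := (Complex.continuous_re.tendsto _).comp ht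
  exact le_of_tendsto' h1 fun F => hc ⟨F, _, _, h.finFeasible hE F, rfl⟩

end FinitePrimal

/-! ### The diamond norm is at most the value of the finite programmes -/

section UpperBound

variable {A B : Type*} [NormedAddCommGroup A] [InnerProductSpace ℂ A] [CompleteSpace A]
  [NormedAddCommGroup B] [InnerProductSpace ℂ B] [CompleteSpace B] {ι : Type*}
  {Δ : TraceClass A →ₗ[ℂ] TraceClass B} {H : Hamiltonian ι A} {E : ℝ}

theorem star_choi (hΔ : IsHermitianPreserving Δ) (H : Hamiltonian ι A) (k l : ι) :
    star (choi Δ H k l : B →L[ℂ] B) = choi Δ H l k := by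
  classical
  obtain ⟨Φ, Ψ, hΦ, hΨ, rfl⟩ := hΔ
  simp only [choi_sub, Submodule.coe_sub, star_sub]
  rw [(hΦ.posOn_choi H {k, l}).adjoint_eq (by simp) (by simp),
    (hΨ.posOn_choi H {k, l}).adjoint_eq (by simp) (by simp)]

theorem blockPairing_star (hΔ : IsHermitianPreserving Δ) (H : Hamiltonian ι A) (F : Finset ι)
    (V : ι → ι → B →L[ℂ] B) : blockPairing (choi Δ H) F (fun k l => star (V l k)) =
      starRingEnd ℂ (blockPairing (choi Δ H) F V) := by
  simp only [blockPairing, map_sum]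
  rw [Finset.sum_comm]
  refine Finset.sum_congr rfl fun k _ => Finset.sum_congr rfl fun l _ => ?_
  rw [conj_trace_mul, star_choi hΔ]

/-- The finite programme may be relaxed to operators `V` that are not Hermitian. -/
theorem re_blockPairing_le_of_norm_le (hΔ : IsHermitianPreserving Δ) {c : ℝ}
    (hc : c ∈ upperBounds (finValues Δ H E)) {F : Finset ι} {R : ι → ι → ℂ}
    {V : ι → ι → B →L[ℂ] B} (hR : ScalarPosOn F R)
    (hV : ∀ v : ι → B, ‖∑ k ∈ F, ∑ l ∈ F, ⟪v k, V k l (v l)⟫_ℂ‖ ≤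
      (∑ k ∈ F, ∑ l ∈ F, ⟪v k, (R k l • (1 : B →L[ℂ] B)) (v l)⟫_ℂ).re)
    (htr : ∑ k ∈ F, (R k k).re ≤ 1) (hen : ∑ k ∈ F, H.level k * (R k k).re ≤ E) :
    (blockPairing (choi Δ H) F V).re ≤ c := by
  -- Since `J` is Hermitian, passing to the Hermitian part of `V` does not change the real part of
  -- the pairing, while the form becomes the real part of that of `V`.
  set V' : ι → ι → B →L[ℂ] B := fun k l => ((1 / 2 : ℝ) : ℂ) • (V k l + star (V l k)) with hV'
  have hval : (blockPairing (choi Δ H) F V').re = (blockPairing (choi Δ H) F V).re := by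
    rw [hV', blockPairing_smul, blockPairing_add, blockPairing_star hΔ, Complex.re_ofReal_mul,
      Complex.add_re, Complex.conj_re]
    ring
  have hq : ∀ v : ι → B, ∑ k ∈ F, ∑ l ∈ F, ⟪v k, V' k l (v l)⟫_ℂ =
      (((∑ k ∈ F, ∑ l ∈ F, ⟪v k, V k l (v l)⟫_ℂ).re : ℝ) : ℂ) := by
    intro v
    have e : ∑ k ∈ F, ∑ l ∈ F, ⟪v k, (star (V l k)) (v l)⟫_ℂ =
        starRingEnd ℂ (∑ k ∈ F, ∑ l ∈ F, ⟪v k, V k l (v l)⟫_ℂ) := by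
      simp only [map_sum]
      rw [Finset.sum_comm]
      refine Finset.sum_congr rfl fun k _ => Finset.sum_congr rfl fun l _ => ?_
      rw [ContinuousLinearMap.star_eq_adjoint, ContinuousLinearMap.adjoint_inner_right,
        inner_conj_symm]
    simp only [hV', smul_apply, add_apply, inner_smul_right, inner_add_right, mul_add,
      Finset.sum_add_distrib, ← Finset.mul_sum, e]
    rw [← mul_add, Complex.add_conj]
    push_cast
    ring
  have hRr : ∀ v : ι → B, ∑ k ∈ F, ∑ l ∈ F, ⟪v k, (R k l • (1 : B →L[ℂ] B)) (v l)⟫_ℂ =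
      ((∑ k ∈ F, ∑ l ∈ F, ⟪v k, (R k l • (1 : B →L[ℂ] B)) (v l)⟫_ℂ).re : ℂ) := fun v =>
    Complex.ext (by simp) (by
      rw [Complex.ofReal_im]; exact (Complex.nonneg_iff.1 (hR.posOn (K := B) v)).2.symm)
  rw [← hval]
  refine hc ⟨F, R, V', ⟨hR, fun v => ?_, fun v => ?_, htr, hen⟩, rfl⟩
  · simp only [sub_apply, inner_sub_right, Finset.sum_sub_distrib]
    rw [hq, hRr, ← Complex.ofReal_sub]
    exact Complex.zero_le_real.2 (sub_nonneg.2 ((Complex.re_le_norm _).trans (hV v)))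
  · simp only [add_apply, inner_add_right, Finset.sum_add_distrib]
    rw [hq, hRr, ← Complex.ofReal_add]
    refine Complex.zero_le_real.2 ?_
    have := (abs_le.1 ((Complex.abs_re_le_norm _).trans (hV v))).1
    linarith

/-- Boundedness on positive operators holds for both completely positive parts of `Δ`, so
`tendsto_expansion` applies with the sum of the two constants. -/
theorem tendsto_trace_map (hΔ : IsHermitianPreserving Δ) (H : Hamiltonian ι A) (T : TraceClass A)
    (Y : B →L[ℂ] B) :
    Tendsto (fun F : Finset ι => ∑ k ∈ F, ∑ l ∈ F,
      ⟪H.basis k, (T : A →L[ℂ] A) (H.basis l)⟫_ℂ * trace ((choi Δ H k l : B →L[ℂ] B) * Y)) atTop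
      (𝓝 (trace ((Δ T : B →L[ℂ] B) * Y))) := by
  obtain ⟨Φ, Ψ, M, hM0, hΦ, hΨ, rfl, hMΦ, hMΨ⟩ := hΔ.exists_bound
  refine tendsto_expansion H.basis (traceMulL Y ∘ₗ (Φ - Ψ)) (‖Y‖ * (2 * M)) (fun T hT => ?_) T
  have h1 := norm_traceMulL_le Y _ (hΦ.map_nonneg T hT)
  have h2 := norm_traceMulL_le Y _ (hΨ.map_nonneg T hT)
  have h3 := mul_le_mul_of_nonneg_left (hMΦ T hT) (norm_nonneg Y)
  have h4 := mul_le_mul_of_nonneg_left (hMΨ T hT) (norm_nonneg Y)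
  rw [LinearMap.comp_apply, LinearMap.sub_apply, map_sub]
  refine (norm_sub_le _ _).trans ?_
  linarith

variable {C : Type*} [NormedAddCommGroup C] [InnerProductSpace ℂ C] [CompleteSpace C]

theorem slice_self_nonneg {ρ : HTensor A C →L[ℂ] HTensor A C} (hρ : 0 ≤ ρ) (c : C) :
    0 ≤ slice ρ c c := by
  rw [nonneg_iff_inner]
  intro x
  rw [inner_slice]
  exact nonneg_iff_inner.1 hρ _

theorem IsPartialTrace.nonneg {ρ : HTensor A C →L[ℂ] HTensor A C} {ρA : A →L[ℂ] A}
    (h : IsPartialTrace ρ ρA) (hρ : 0 ≤ ρ) : 0 ≤ ρA := by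
  rw [nonneg_iff_inner]
  intro x
  exact (h x x).nonneg fun j => nonneg_iff_inner.1 (slice_self_nonneg hρ _) x

theorem sum_gram_inner {α : Type*} {S : Finset α} {M : α → α → ℂ} {m : S → α → ℂ}
    (hm : ∀ a ∈ S, ∀ b ∈ S, M a b = ∑ r, starRingEnd ℂ (m r a) * m r b) (y : α → C)
    (X : C →L[ℂ] C) : ∑ a ∈ S, ∑ b ∈ S, M a b * ⟪y b, X (y a)⟫_ℂ =
      ∑ r, ⟪∑ a ∈ S, starRingEnd ℂ (m r a) • y a, X (∑ a ∈ S, starRingEnd ℂ (m r a) • y a)⟫_ℂ := by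
  have e : ∀ r : S, ⟪∑ a ∈ S, starRingEnd ℂ (m r a) • y a,
      X (∑ a ∈ S, starRingEnd ℂ (m r a) • y a)⟫_ℂ =
      ∑ a ∈ S, ∑ b ∈ S, starRingEnd ℂ (m r a) * m r b * ⟪y b, X (y a)⟫_ℂ := by
    intro r
    rw [map_sum, inner_sum]
    refine Finset.sum_congr rfl fun a _ => ?_
    rw [sum_inner]
    refine Finset.sum_congr rfl fun b _ => ?_
    rw [map_smul, inner_smul_left, inner_smul_right, Complex.conj_conj]
    ring
  simp only [e]
  rw [Finset.sum_comm (s := Finset.univ)]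
  refine Finset.sum_congr rfl fun a ha => ?_
  rw [Finset.sum_comm (s := Finset.univ)]
  refine Finset.sum_congr rfl fun b hb => ?_
  rw [hm a ha b hb, Finset.sum_mul]

theorem orthonormal_tmulRight {σ κ : Type*} {e : σ → C} {b : κ → A} (he : Orthonormal ℂ e)
    (hb : Orthonormal ℂ b) : Orthonormal ℂ fun a : σ × κ => tmulRight A (e a.1) (b a.2) := by
  classical
  rw [orthonormal_iff_ite]
  rintro ⟨i, k⟩ ⟨j, l⟩
  rw [inner_tmulRight, (orthonormal_iff_ite.1 he) i j, (orthonormal_iff_ite.1 hb) k l]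
  by_cases h1 : i = j <;> by_cases h2 : k = l <;> simp [h1, h2]

-- The reference indices of `ρ` and `X` are contracted first, leaving a pairing of `J` with `V`. A
-- Gram factorisation of the matrix of `ρ` over `D × F` yields vectors `η r` for which the form of
-- `V` is `∑ r, ⟪η r, X (η r)⟫` and that of `1 ⊗ R` is `∑ r, ‖η r‖²`. A contraction `X` therefore
-- gives `V` bounded by `1 ⊗ R`, although `V` need not be Hermitian.
set_option maxHeartbeats 800000 in
theorem re_sum_blocks_le (hΔ : IsHermitianPreserving Δ) (hE : 0 ≤ E) {c : ℝ}
    (hc : c ∈ upperBounds (finValues Δ H E)) {ρ : HTensor A C →L[ℂ] HTensor A C} (hρ : IsState ρ)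
    {ρA : A →L[ℂ] A} (hρA : IsPartialTrace ρ ρA) (hen : H.meanEnergy ρA ≤ ENNReal.ofReal E)
    (X : HTensor B C →L[ℂ] HTensor B C) (hX : ‖X‖ ≤ 1) (D : Finset (StdIndex C)) (F : Finset ι) :
    (∑ i ∈ D, ∑ j ∈ D, ∑ k ∈ F, ∑ l ∈ F,
      ⟪H.basis k, slice ρ (stdBasis C i) (stdBasis C j) (H.basis l)⟫_ℂ *
      trace ((choi Δ H k l : B →L[ℂ] B) * slice X (stdBasis C j) (stdBasis C i))).re ≤ c := by
  set e := stdBasis C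
  set b := H.basis
  set R : ι → ι → ℂ := fun l k => ∑ i ∈ D, ⟪b k, slice ρ (e i) (e i) (b l)⟫_ℂ with hR
  set V : ι → ι → B →L[ℂ] B := fun l k => ∑ i ∈ D, ∑ j ∈ D,
    ⟪b k, slice ρ (e i) (e j) (b l)⟫_ℂ • slice X (e j) (e i) with hV
  have hval : ∑ i ∈ D, ∑ j ∈ D, ∑ k ∈ F, ∑ l ∈ F, ⟪b k, slice ρ (e i) (e j) (b l)⟫_ℂ *
      trace ((choi Δ H k l : B →L[ℂ] B) * slice X (e j) (e i)) = blockPairing (choi Δ H) F V := by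
    rw [← sum_product_sum_product D F (fun a b' => ⟪b a.2, slice ρ (e a.1) (e b'.1) (b b'.2)⟫_ℂ *
      trace ((choi Δ H a.2 b'.2 : B →L[ℂ] B) * slice X (e b'.1) (e a.1))),
      Finset.sum_product_right]
    refine Finset.sum_congr rfl fun k _ => ?_
    simp only [Finset.sum_product_right]
    rw [Finset.sum_comm]
    refine Finset.sum_congr rfl fun l _ => ?_
    simp only [hV, ← mulTraceL_apply, map_sum, map_smul, smul_eq_mul]
  rw [hval]
  obtain ⟨m, hm⟩ := exists_gram (D ×ˢ F) (fun a b' => ⟪b a.2, slice ρ (e a.1) (e b'.1) (b b'.2)⟫_ℂ)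
    ((posOn_slice hρ.nonneg e D).expand b F)
  have hsum : ∀ (w : ι → B) (Y : HTensor B C →L[ℂ] HTensor B C),
      ∑ l ∈ F, ∑ k ∈ F, ⟪w l, (∑ i ∈ D, ∑ j ∈ D,
        ⟪b k, slice ρ (e i) (e j) (b l)⟫_ℂ • slice Y (e j) (e i)) (w k)⟫_ℂ =
      ∑ r, ⟪∑ a ∈ D ×ˢ F, starRingEnd ℂ (m r a) • tmulRight B (e a.1) (w a.2),
        Y (∑ a ∈ D ×ˢ F, starRingEnd ℂ (m r a) • tmulRight B (e a.1) (w a.2))⟫_ℂ := by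
    intro w Y
    rw [← sum_gram_inner hm, Finset.sum_product_right, Finset.sum_comm]
    refine Finset.sum_congr rfl fun k _ => ?_
    simp only [Finset.sum_product_right]
    rw [Finset.sum_comm]
    refine Finset.sum_congr rfl fun l _ => ?_
    simp only [sum_apply, inner_sum, smul_apply, inner_smul_right, inner_slice]
  have hone : ∀ i j, slice (1 : HTensor B C →L[ℂ] HTensor B C) (e i) (e j) =
      ⟪e i, e j⟫_ℂ • (1 : B →L[ℂ] B) := by
    intro i j
    ext y
    refine ext_inner_left ℂ fun x => ?_
    rw [inner_slice, smul_apply, inner_smul_right, mul_comm]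
    exact inner_tmulRight _ _ _ _
  have hsumR : ∀ w : ι → B, ∑ l ∈ F, ∑ k ∈ F, ⟪w l, (R l k • (1 : B →L[ℂ] B)) (w k)⟫_ℂ =
      ∑ r, ⟪∑ a ∈ D ×ˢ F, starRingEnd ℂ (m r a) • tmulRight B (e a.1) (w a.2),
        ∑ a ∈ D ×ˢ F, starRingEnd ℂ (m r a) • tmulRight B (e a.1) (w a.2)⟫_ℂ := by
    classical
    intro w
    refine Eq.trans ?_ (hsum w 1)
    refine Finset.sum_congr rfl fun l _ => Finset.sum_congr rfl fun k _ => ?_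
    congr 2
    rw [hR]
    simp only
    rw [Finset.sum_smul]
    refine Finset.sum_congr rfl fun i hi => ?_
    rw [Finset.sum_eq_single i]
    · rw [hone, (orthonormal_iff_ite.1 e.orthonormal) i i, if_pos rfl, one_smul]
    · intro j _ hj
      rw [hone, (orthonormal_iff_ite.1 e.orthonormal) j i, if_neg hj, zero_smul, smul_zero]
    · exact fun h => (h hi).elim
  have hterm : ∀ i, ∀ k, ⟪b k, slice ρ (e i) (e i) (b k)⟫_ℂ =
      ⟪tmulRight A (e i) (b k), ρ (tmulRight A (e i) (b k))⟫_ℂ := fun i k => inner_slice _ _ _ _ _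
  -- The partial trace restricted to `D` omits nonnegative diagonal terms, so the energy does not
  -- increase.
  have hRle : ∀ k, (R k k).re ≤ (⟪b k, ρA (b k)⟫_ℂ).re := by
    intro k
    have h1 := Complex.hasSum_re (hρA (b k) (b k))
    rw [hR, Complex.re_sum]
    exact sum_le_hasSum D (fun i _ => inner_re_nonneg (slice_self_nonneg hρ.nonneg _) _) h1
  refine re_blockPairing_le_of_norm_le hΔ hc (R := R) ?_ ?_ ?_ ?_
  · intro z
    have h1 : 0 ≤ ∑ i ∈ D, ∑ k ∈ F, ∑ l ∈ F, starRingEnd ℂ (starRingEnd ℂ (z k)) *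
        ⟪b k, slice ρ (e i) (e i) (b l)⟫_ℂ * starRingEnd ℂ (z l) :=
      Finset.sum_nonneg fun i _ =>
        scalarPosOn_of_nonneg (slice_self_nonneg hρ.nonneg (e i)) b F fun k => starRingEnd ℂ (z k)
    refine h1.trans_eq ?_
    rw [Finset.sum_comm, Finset.sum_comm (s := F) (t := F)]
    refine Finset.sum_congr rfl fun k _ => ?_
    rw [Finset.sum_comm]
    refine Finset.sum_congr rfl fun l _ => ?_
    rw [hR, Finset.mul_sum, Finset.sum_mul]
    refine Finset.sum_congr rfl fun i _ => ?_
    rw [Complex.conj_conj]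
    ring
  · intro w
    rw [hsum w X, hsumR w, Complex.re_sum]
    refine (norm_sum_le _ _).trans (Finset.sum_le_sum fun r _ => ?_)
    refine (norm_inner_le_norm _ _).trans ?_
    set η := ∑ a ∈ D ×ˢ F, starRingEnd ℂ (m r a) • tmulRight B (e a.1) (w a.2)
    have h2 : (⟪η, η⟫_ℂ).re = ‖η‖ ^ 2 := inner_self_eq_norm_sq (𝕜 := ℂ) _
    rw [h2, sq]
    refine mul_le_mul_of_nonneg_left ?_ (norm_nonneg _)
    exact (X.le_of_opNorm_le hX η).trans (by rw [one_mul])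
  · have h1 := sum_inner_le_trace hρ.nonneg hρ.mem_traceClass
      (orthonormal_tmulRight e.orthonormal b.orthonormal) (D ×ˢ F)
    rw [hρ.trace_eq_one, Finset.sum_product_right] at h1
    refine le_trans (le_of_eq ?_) h1
    refine Finset.sum_congr rfl fun k _ => ?_
    rw [hR, Complex.re_sum]
    exact Finset.sum_congr rfl fun i _ => by rw [hterm]
  · refine le_trans (Finset.sum_le_sum fun k _ => ?_)
      (sum_level_le_of_meanEnergy_le hE (hρA.nonneg hρ.nonneg) hen F)
    exact mul_le_mul_of_nonneg_left (hRle k) (H.level_nonneg k)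

theorem traceNorm_amplification_le (hΔ : IsHermitianPreserving Δ) (hE : 0 ≤ E) {c : ℝ}
    (hc : c ∈ upperBounds (finValues Δ H E)) {ρ : HTensor A C →L[ℂ] HTensor A C} (hρ : IsState ρ)
    {ρA : A →L[ℂ] A} (hρA : IsPartialTrace ρ ρA) (hen : H.meanEnergy ρA ≤ ENNReal.ofReal E)
    {σ : HTensor B C →L[ℂ] HTensor B C} (hσ : IsAmplification Δ ρ σ) :
    traceNorm σ ≤ ENNReal.ofReal c := by
  refine traceNorm_le_of_forall σ c fun W hW s => ?_
  set f := stdBasis (HTensor B C)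
  set e := stdBasis C
  choose ξ hξ hξ' using hσ
  -- This is `P W†` with `P` the projection onto the span of the `f i`, `i ∈ s`. It is a finite rank
  -- contraction, and its pairing with `σ` is the partial sum to be bounded.
  set X : HTensor B C →L[ℂ] HTensor B C := ∑ i ∈ s, (ketBra (f i) (W (f i)) : _ →L[ℂ] _) with hXdef
  have hX : ‖X‖ ≤ 1 := by
    refine ContinuousLinearMap.opNorm_le_bound _ zero_le_one fun η => ?_
    have h1 : X η = cutoff f s (star W η) := by
      rw [hXdef, sum_apply, cutoff]
      refine Finset.sum_congr rfl fun i _ => ?_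
      rw [ketBra_apply, ContinuousLinearMap.star_eq_adjoint, ContinuousLinearMap.adjoint_inner_right]
    rw [h1]
    refine (norm_cutoff_le _ _ _).trans ?_
    refine (star W).le_of_opNorm_le ?_ η
    rw [ContinuousLinearMap.star_eq_adjoint]
    exact (LinearIsometryEquiv.norm_map _ W).trans_le hW
  -- The limit over `F` is taken first, for fixed finite `D`, to recover `Δ` on whole blocks of `ρ`;
  -- the limit over `D` then recovers `σ`.
  have hfin : ∀ D : Finset (StdIndex C), (∑ i ∈ D, ∑ j ∈ D,
      trace ((Δ (ξ (e i) (e j)) : B →L[ℂ] B) * slice X (e j) (e i))).re ≤ c := by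
    intro D
    have h1 : Tendsto (fun F : Finset ι => ∑ i ∈ D, ∑ j ∈ D, ∑ k ∈ F, ∑ l ∈ F,
      ⟪H.basis k, slice ρ (e i) (e j) (H.basis l)⟫_ℂ *
      trace ((choi Δ H k l : B →L[ℂ] B) * slice X (e j) (e i))) atTop (𝓝 (∑ i ∈ D, ∑ j ∈ D,
      trace ((Δ (ξ (e i) (e j)) : B →L[ℂ] B) * slice X (e j) (e i)))) := by
      refine tendsto_finsetSum _ fun i _ => tendsto_finsetSum _ fun j _ => ?_
      have := tendsto_trace_map hΔ H (ξ (e i) (e j)) (slice X (e j) (e i))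
      rwa [hξ] at this
    exact le_of_tendsto' ((Complex.continuous_re.tendsto _).comp h1) fun F =>
      re_sum_blocks_le hΔ hE hc hρ hρA hen X hX D F
  have hlim : Tendsto (fun D : Finset (StdIndex C) => ∑ i' ∈ s, ∑ i ∈ D, ∑ j ∈ D,
      ⟪ContinuousLinearMap.adjoint (tmulRight B (e i)) (W (f i')), slice σ (e i) (e j)
        (ContinuousLinearMap.adjoint (tmulRight B (e j)) (f i'))⟫_ℂ) atTop
      (𝓝 (∑ i' ∈ s, ⟪W (f i'), σ (f i')⟫_ℂ)) :=
    tendsto_finsetSum _ fun i' _ => tendsto_inner_blockProj e σ _ _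
  rw [← Complex.re_sum]
  refine le_of_tendsto' ((Complex.continuous_re.tendsto _).comp hlim) fun D => ?_
  refine le_of_eq_of_le ?_ (hfin D)
  simp only [Function.comp]
  congr 1
  rw [Finset.sum_comm]
  refine Finset.sum_congr rfl fun i _ => ?_
  rw [Finset.sum_comm]
  refine Finset.sum_congr rfl fun j _ => ?_
  have h2 : slice X (e j) (e i) = ∑ i' ∈ s,
      (ketBra (ContinuousLinearMap.adjoint (tmulRight B (e j)) (f i'))
        (ContinuousLinearMap.adjoint (tmulRight B (e i)) (W (f i'))) : B →L[ℂ] B) := by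
    ext y
    refine ext_inner_left ℂ fun x => ?_
    rw [inner_slice, hXdef, sum_apply, sum_apply, inner_sum, inner_sum]
    refine Finset.sum_congr rfl fun i' _ => ?_
    rw [ketBra_apply, ketBra_apply, inner_smul_right, inner_smul_right,
      ContinuousLinearMap.adjoint_inner_left, ContinuousLinearMap.adjoint_inner_right]
  rw [h2, ← mulTraceL_apply, map_sum]
  refine Finset.sum_congr rfl fun i' _ => ?_
  rw [mulTraceL_apply, trace_mul_ketBra, hξ']

theorem ecDiamondNorm_le (hΔ : IsHermitianPreserving Δ) (hE : 0 ≤ E) {c : ℝ}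
    (hc : c ∈ upperBounds (finValues Δ H E)) : ecDiamondNorm Δ H E ≤ ENNReal.ofReal c := by
  refine sSup_le ?_
  rintro r ⟨C, _, _, _, _, ρ, ρA, σ, h1, h2, h3, h4, rfl⟩
  exact traceNorm_amplification_le hΔ hE hc h1 h2 h3 h4

end UpperBound

/-! ### Strictly feasible points and their completion to states -/

section StateOp

variable {A B : Type*} [NormedAddCommGroup A] [InnerProductSpace ℂ A] [CompleteSpace A]
  [NormedAddCommGroup B] [InnerProductSpace ℂ B] [CompleteSpace B] {ι : Type*}
  {Δ : TraceClass A →ₗ[ℂ] TraceClass B} {H : Hamiltonian ι A} {E : ℝ}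

/-- Feasibility for a finite programme with slack in the energy and with `R` positive definite. -/
structure StrictFeasible (H : Hamiltonian ι A) (E : ℝ) (F : Finset ι) (R : ι → ι → ℂ)
    (V : ι → ι → B →L[ℂ] B) : Prop extends FinFeasible H E F R V where
  energy_lt : ∑ k ∈ F, H.level k * (R k k).re < E
  posDef : ∃ η : ℝ, 0 < η ∧ ∀ c : ι → ℂ, η * ∑ k ∈ F, ‖c k‖ ^ 2 ≤
    (∑ k ∈ F, ∑ l ∈ F, starRingEnd ℂ (c k) * R k l * c l).re

theorem FinFeasible.exists_strict (hE : 0 < E) {F : Finset ι} {R : ι → ι → ℂ}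
    {V : ι → ι → B →L[ℂ] B} (h : FinFeasible H E F R V) {ε : ℝ} (h0 : 0 < ε) (h1 : ε < 1) :
    ∃ R' : ι → ι → ℂ, StrictFeasible H E F R' fun k l => ((1 - ε : ℝ) : ℂ) • V k l := by
  classical
  set S : ℝ := ∑ k ∈ F, H.level k with hS
  have hS0 : 0 ≤ S := Finset.sum_nonneg fun k _ => H.level_nonneg k
  -- Shrinking by `1 - ε` frees trace `ε` and energy `ε E`; adding `η` times the identity on `F`
  -- uses less than this energy and at most this trace. The added ones avoid division by zero.
  set η : ℝ := min (ε / (F.card + 1)) (ε * E / (S + 1)) with hη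
  have hη0 : 0 < η := lt_min (by positivity) (by positivity)
  have hη1 : F.card * η ≤ ε := by
    have : η ≤ ε / (F.card + 1) := min_le_left _ _
    rw [le_div_iff₀ (by positivity)] at this
    nlinarith
  have hη2 : S * η < ε * E := by
    have : η ≤ ε * E / (S + 1) := min_le_right _ _
    rw [le_div_iff₀ (by positivity)] at this
    nlinarith
  have hδ : ∀ c : ι → ℂ, ∑ k ∈ F, ∑ l ∈ F,
      starRingEnd ℂ (c k) * (if k = l then (1 : ℂ) else 0) * c l = ((∑ k ∈ F, ‖c k‖ ^ 2 : ℝ) : ℂ) := by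
    intro c
    push_cast
    refine Finset.sum_congr rfl fun k hk => ?_
    rw [Finset.sum_eq_single k]
    · rw [if_pos rfl, mul_one, Complex.conj_mul']
    · intro l _ hl; rw [if_neg hl.symm, mul_zero, zero_mul]
    · exact fun h => (h hk).elim
  have hone : ScalarPosOn F fun k l => if k = l then (1 : ℂ) else 0 := fun c => by
    rw [hδ]
    exact Complex.zero_le_real.2 (Finset.sum_nonneg fun _ _ => by positivity)
  have hpart : PosOn F fun k l => ((η : ℂ) * if k = l then (1 : ℂ) else 0) • (1 : B →L[ℂ] B) :=
    (hone.smul hη0.le).posOn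
  have h1' : 0 ≤ 1 - ε := by linarith
  have htr : ∑ k ∈ F, (((1 - ε : ℝ) : ℂ) * R k k + (η : ℂ) * if k = k then 1 else 0).re =
      (1 - ε) * (∑ k ∈ F, (R k k).re) + F.card * η := by
    simp only [if_true, mul_one, Complex.add_re, Complex.re_ofReal_mul, Complex.ofReal_re,
      Finset.sum_add_distrib, ← Finset.mul_sum, Finset.sum_const, nsmul_eq_mul]
  have hen : ∑ k ∈ F, H.level k * (((1 - ε : ℝ) : ℂ) * R k k + (η : ℂ) * if k = k then 1 else 0).re
      = (1 - ε) * (∑ k ∈ F, H.level k * (R k k).re) + S * η := by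
    simp only [if_true, mul_one, Complex.add_re, Complex.re_ofReal_mul, Complex.ofReal_re,
      mul_add, Finset.sum_add_distrib, hS, Finset.sum_mul, Finset.mul_sum]
    congr 1
    exact Finset.sum_congr rfl fun k _ => by ring
  have hlt : (1 - ε) * (∑ k ∈ F, H.level k * (R k k).re) + S * η < E := by
    have := mul_le_mul_of_nonneg_left h.energy_le h1'
    linarith
  refine ⟨fun k l => ((1 - ε : ℝ) : ℂ) * R k l + (η : ℂ) * if k = l then 1 else 0,
    ⟨⟨(h.scalar.smul h1').add (hone.smul hη0.le), ?_, ?_, ?_, ?_⟩, ?_, η, hη0, fun c => ?_⟩⟩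
  · refine ((h.upper.smul h1').add hpart).congr fun k _ l _ => ?_
    module
  · refine ((h.lower.smul h1').add hpart).congr fun k _ l _ => ?_
    module
  · rw [htr]
    have := mul_le_mul_of_nonneg_left h.trace_le h1'
    linarith
  · exact (hen.trans_lt hlt).le
  · exact hen.trans_lt hlt
  · have e : ∑ k ∈ F, ∑ l ∈ F, starRingEnd ℂ (c k) *
        (((1 - ε : ℝ) : ℂ) * R k l + (η : ℂ) * if k = l then 1 else 0) * c l =
        ((1 - ε : ℝ) : ℂ) * ∑ k ∈ F, ∑ l ∈ F, starRingEnd ℂ (c k) * R k l * c l +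
        (η : ℂ) * ((∑ k ∈ F, ‖c k‖ ^ 2 : ℝ) : ℂ) := by
      rw [← hδ]
      simp only [Finset.mul_sum, ← Finset.sum_add_distrib]
      exact Finset.sum_congr rfl fun k _ => Finset.sum_congr rfl fun l _ => by ring
    rw [e, Complex.add_re, Complex.re_ofReal_mul, Complex.re_ofReal_mul, Complex.ofReal_re]
    have := mul_nonneg h1' (Complex.nonneg_iff.1 (h.scalar c)).1
    linarith

/-- To bound the finite values it is enough to bound the strictly feasible ones. -/
theorem mem_upperBounds_finValues (hE : 0 < E) {b : ℝ}
    (hb : ∀ (F : Finset ι) (R : ι → ι → ℂ) (V : ι → ι → B →L[ℂ] B), StrictFeasible H E F R V →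
      (blockPairing (choi Δ H) F V).re ≤ b) : b ∈ upperBounds (finValues Δ H E) := by
  rintro t ⟨F, R, V, h, rfl⟩
  set t := (blockPairing (choi Δ H) F V).re with ht
  have h1 : ∀ ε : ℝ, 0 < ε → ε < 1 → (1 - ε) * t ≤ b := by
    intro ε h0 h1
    obtain ⟨R', hR'⟩ := h.exists_strict hE h0 h1
    have := hb _ _ _ hR'
    rwa [blockPairing_smul, Complex.re_ofReal_mul] at this
  have h2 : Tendsto (fun ε : ℝ => (1 - ε) * t) (𝓝[>] 0) (𝓝 ((1 - 0) * t)) :=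
    ((continuous_const.sub continuous_id).mul continuous_const).continuousWithinAt.tendsto
  rw [sub_zero, one_mul] at h2
  refine le_of_tendsto h2 ?_
  filter_upwards [Ioo_mem_nhdsGT (zero_lt_one' ℝ)] with ε hε using h1 ε hε.1 hε.2

theorem ScalarPosOn.transpose {κ : Type*} {F : Finset κ} {R : κ → κ → ℂ} (h : ScalarPosOn F R) :
    ScalarPosOn F fun k l => R l k := fun c => by
  refine (h fun k => starRingEnd ℂ (c k)).trans_eq ?_
  rw [Finset.sum_comm]
  refine Finset.sum_congr rfl fun k _ => Finset.sum_congr rfl fun l _ => ?_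
  rw [Complex.conj_conj]
  ring

/-- The operator with transposed matrix `R`, plus a multiple of an eigenprojection of `H`. -/
def stateOp (H : Hamiltonian ι A) (F : Finset ι) (R : ι → ι → ℂ) (δ : ℝ) (g : ι) : TraceClass A :=
  transposeOp H F R + (δ : ℂ) • ketBra (H.basis g) (H.basis g)

theorem smul_nonneg_of_nonneg {T : A →L[ℂ] A} (hT : 0 ≤ T) {r : ℝ} (hr : 0 ≤ r) :
    0 ≤ (r : ℂ) • T := by
  rw [nonneg_iff_inner] at hT ⊢
  intro x
  rw [smul_apply, inner_smul_right]
  exact mul_nonneg (Complex.zero_le_real.2 hr) (hT x)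

theorem ScalarPosOn.sum_diag {κ : Type*} {F : Finset κ} {R : κ → κ → ℂ} (h : ScalarPosOn F R) :
    ∑ k ∈ F, R k k = ((∑ k ∈ F, (R k k).re : ℝ) : ℂ) := by
  push_cast
  refine Finset.sum_congr rfl fun k hk => Complex.ext (by simp) ?_
  rw [Complex.ofReal_im]
  exact (Complex.nonneg_iff.1 (h.diag hk)).2.symm

theorem isState_stateOp {F : Finset ι} {R : ι → ι → ℂ} (hR : ScalarPosOn F R)
    (htr : ∑ k ∈ F, (R k k).re ≤ 1) (g : ι) :
    IsState (stateOp H F R (1 - ∑ k ∈ F, (R k k).re) g : A →L[ℂ] A) where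
  nonneg := by
    rw [stateOp, Submodule.coe_add, Submodule.coe_smul]
    exact add_nonneg (transposeOp_nonneg H hR)
      (smul_nonneg_of_nonneg (ketBra_self_nonneg _) (by linarith))
  mem_traceClass := Subtype.property _
  trace_eq_one := by
    rw [← traceL_apply, stateOp, map_add, map_smul, traceL_apply, traceL_apply, trace_transposeOp,
      trace_ketBra, hR.sum_diag, inner_self_eq_norm_sq_to_K, H.basis.orthonormal.norm_eq_one]
    push_cast
    simp

theorem inner_transposeOp (F : Finset ι) (R : ι → ι → ℂ) (x y : A) :
    ⟪x, (transposeOp H F R : A →L[ℂ] A) y⟫_ℂ =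
      ∑ k ∈ F, ∑ l ∈ F, ⟪x, H.basis k⟫_ℂ * ⟪H.basis l, y⟫_ℂ * R l k := by
  simp only [transposeOp, Submodule.coe_sum, Submodule.coe_smul, sum_apply, inner_sum, smul_apply,
    inner_smul_right, ketBra_apply]
  exact Finset.sum_congr rfl fun k _ => Finset.sum_congr rfl fun l _ => by ring

open scoped Classical in
theorem inner_transposeOp_diag (F : Finset ι) (R : ι → ι → ℂ) (k : ι) :
    ⟪H.basis k, (transposeOp H F R : A →L[ℂ] A) (H.basis k)⟫_ℂ = if k ∈ F then R k k else 0 := by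
  rw [inner_transposeOp]
  simp only [orthonormal_iff_ite.1 H.basis.orthonormal]
  by_cases hk : k ∈ F <;> simp [hk]

theorem meanEnergy_stateOp_le {F : Finset ι} {R : ι → ι → ℂ} (hR : ScalarPosOn F R) {δ : ℝ}
    (hδ : 0 ≤ δ) (g : ι) (hen : ∑ k ∈ F, H.level k * (R k k).re + δ * H.level g ≤ E) :
    H.meanEnergy (stateOp H F R δ g : A →L[ℂ] A) ≤ ENNReal.ofReal E := by
  classical
  have hdiag : ∀ k, (⟪H.basis k, (stateOp H F R δ g : A →L[ℂ] A) (H.basis k)⟫_ℂ).re =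
      (if k ∈ F then (R k k).re else 0) + if k = g then δ else 0 := by
    intro k
    rw [stateOp, Submodule.coe_add, Submodule.coe_smul, add_apply, smul_apply, inner_add_right,
      inner_smul_right, ketBra_apply, inner_smul_right, inner_transposeOp_diag,
      orthonormal_iff_ite.1 H.basis.orthonormal k g, orthonormal_iff_ite.1 H.basis.orthonormal g k]
    by_cases h1 : k ∈ F <;> by_cases h2 : k = g <;> simp [h1, h2]
    · subst h2; simp [h1]
    · subst h2; simp [h1]
  have hRk : ∀ k ∈ F, 0 ≤ (R k k).re := fun k hk => (Complex.nonneg_iff.1 (hR.diag hk)).1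
  unfold Hamiltonian.meanEnergy
  rw [ENNReal.tsum_eq_iSup_sum]
  refine iSup_le fun s => ?_
  rw [← ENNReal.ofReal_sum_of_nonneg]
  · refine ENNReal.ofReal_le_ofReal (le_trans ?_ hen)
    simp only [hdiag, mul_add, Finset.sum_add_distrib]
    refine add_le_add ?_ ?_
    · simp only [mul_ite, mul_zero]
      rw [← Finset.sum_filter]
      refine Finset.sum_le_sum_of_subset_of_nonneg (fun k hk => (Finset.mem_filter.1 hk).2)
        fun k hk _ => mul_nonneg (H.level_nonneg k) (hRk k hk)
    · simp only [mul_ite, mul_zero]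
      rw [Finset.sum_ite_eq']
      split_ifs
      · rw [mul_comm]
      · exact mul_nonneg hδ (H.level_nonneg g)
  · intro k _
    rw [hdiag]
    refine mul_nonneg (H.level_nonneg k) (add_nonneg ?_ ?_)
    · split_ifs with h1
      · exact hRk k h1
      · exact le_rfl
    · split_ifs
      · exact hδ
      · exact le_rfl

theorem exists_low_level (hH : H.IsGrounded) {s : ℝ} (hs : 0 < s) : ∃ g, H.level g < s := by
  by_contra! hcon
  have : s ≤ 0 := hH.2 (by rintro _ ⟨k, rfl⟩; exact hcon k)
  linarith

/-- The ground energy `0` is only an infimum and need not be a level; strict slack in the energy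
pays for a level slightly above it. -/
theorem StrictFeasible.exists_energy_le (hH : H.IsGrounded) {F : Finset ι} {R : ι → ι → ℂ}
    {V : ι → ι → B →L[ℂ] B} (h : StrictFeasible H E F R V) :
    ∃ g, ∑ k ∈ F, H.level k * (R k k).re + (1 - ∑ k ∈ F, (R k k).re) * H.level g ≤ E := by
  obtain ⟨g, hg⟩ := exists_low_level hH (sub_pos.2 h.energy_lt)
  refine ⟨g, ?_⟩
  have h1 : 0 ≤ ∑ k ∈ F, (R k k).re :=
    Finset.sum_nonneg fun k hk => (Complex.nonneg_iff.1 (h.scalar.diag hk)).1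
  nlinarith [H.level_nonneg g]

theorem ext_slice {κ K L : Type*} [NormedAddCommGroup K] [InnerProductSpace ℂ K] [CompleteSpace K]
    [NormedAddCommGroup L] [InnerProductSpace ℂ L] [CompleteSpace L] (b : HilbertBasis κ ℂ L)
    {S T : HTensor K L →L[ℂ] HTensor K L}
    (h : ∀ k l, slice S (b k) (b l) = slice T (b k) (b l)) : S = T := by
  ext v
  refine ext_inner_left ℂ fun u => ?_
  have h1 := tendsto_inner_blockProj b S u v
  simp only [h] at h1
  exact tendsto_nhds_unique h1 (tendsto_inner_blockProj b T u v)

theorem oneTensor_stateOp (H : Hamiltonian ι A) (F : Finset ι) (R : ι → ι → ℂ) (δ : ℝ) (g : ι) :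
    oneTensor B (stateOp H F R δ g : A →L[ℂ] A) =
      ofBlocks H.basis F (fun k l => R l k • (1 : B →L[ℂ] B)) +
      (δ : ℂ) • ofBlocks H.basis {g} fun _ _ => (1 : B →L[ℂ] B) := by
  refine ext_slice H.basis fun i j => ?_
  rw [slice_oneTensor, slice_add, slice_smul, slice_ofBlocks, slice_ofBlocks, stateOp,
    Submodule.coe_add, Submodule.coe_smul, add_apply, smul_apply, inner_add_right,
    inner_smul_right, inner_transposeOp, ketBra_apply, inner_smul_right, add_smul]
  congr 1
  · simp only [Finset.sum_smul, smul_smul]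
  · rw [Finset.sum_singleton, Finset.sum_singleton, smul_smul, mul_comm ⟪H.basis g, _⟫_ℂ]

theorem slice_ofBlocks_basis (b : HilbertBasis ι ℂ A) (F : Finset ι) (V : ι → ι → B →L[ℂ] B)
    [DecidableEq ι] (i j : ι) :
    slice (ofBlocks b F V) (b i) (b j) = if i ∈ F ∧ j ∈ F then V i j else 0 := by
  rw [slice_ofBlocks]
  simp only [orthonormal_iff_ite.1 b.orthonormal]
  by_cases hi : i ∈ F
  · rw [Finset.sum_eq_single i]
    · by_cases hj : j ∈ F
      · rw [Finset.sum_eq_single j]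
        · simp [hi, hj]
        · intro l _ hl; simp [hl]
        · exact fun h => (h hj).elim
      · rw [if_neg (fun h : i ∈ F ∧ j ∈ F => hj h.2)]
        refine Finset.sum_eq_zero fun l hl => ?_
        rw [if_neg (fun h : l = j => hj (h ▸ hl)), mul_zero, zero_smul]
    · intro k _ hk
      refine Finset.sum_eq_zero fun l _ => ?_
      rw [if_neg hk.symm, zero_mul, zero_smul]
    · exact fun h => (h hi).elim
  · rw [if_neg (fun h : i ∈ F ∧ j ∈ F => hi h.1)]
    refine Finset.sum_eq_zero fun k hk => Finset.sum_eq_zero fun l _ => ?_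
    rw [if_neg (fun h : i = k => hi (h ▸ hk)), zero_mul, zero_smul]

theorem blockPairing_slice_ofBlocks (J : ι → ι → TraceClass B) (b : HilbertBasis ι ℂ A)
    {F G : Finset ι} (hFG : F ⊆ G) (V : ι → ι → B →L[ℂ] B) :
    blockPairing J G (fun k l => slice (ofBlocks b F V) (b k) (b l)) = blockPairing J F V := by
  classical
  simp only [slice_ofBlocks_basis]
  unfold blockPairing
  symm
  rw [← Finset.sum_subset hFG]
  · refine Finset.sum_congr rfl fun k hk => ?_
    rw [← Finset.sum_subset hFG]
    · exact Finset.sum_congr rfl fun l hl => by simp only [if_pos (And.intro hl hk)]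
    · intro l _ hl
      simp [hl, trace]
  · intro k _ hk
    refine Finset.sum_eq_zero fun l _ => ?_
    simp [hk, trace]

theorem ofBlocks_add {κ K L : Type*} [NormedAddCommGroup K] [InnerProductSpace ℂ K]
    [CompleteSpace K] [NormedAddCommGroup L] [InnerProductSpace ℂ L] [CompleteSpace L]
    (e : κ → L) (F : Finset κ) (X Y : κ → κ → K →L[ℂ] K) :
    ofBlocks e F X + ofBlocks e F Y = ofBlocks e F fun k l => X k l + Y k l := by
  simp only [ofBlocks, ContinuousLinearMap.comp_add, ContinuousLinearMap.add_comp,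
    Finset.sum_add_distrib]

theorem ofBlocks_sub {κ K L : Type*} [NormedAddCommGroup K] [InnerProductSpace ℂ K]
    [CompleteSpace K] [NormedAddCommGroup L] [InnerProductSpace ℂ L] [CompleteSpace L]
    (e : κ → L) (F : Finset κ) (X Y : κ → κ → K →L[ℂ] K) :
    ofBlocks e F X - ofBlocks e F Y = ofBlocks e F fun k l => X k l - Y k l := by
  simp only [ofBlocks, ContinuousLinearMap.comp_sub, ContinuousLinearMap.sub_comp,
    Finset.sum_sub_distrib]

/-- Strictly feasible points of finite programmes give feasible operators. -/
theorem StrictFeasible.mem_primalValues (hΔ : IsHermitianPreserving Δ) (hH : H.IsGrounded)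
    {F : Finset ι} {R : ι → ι → ℂ} {V : ι → ι → B →L[ℂ] B} (h : StrictFeasible H E F R V) :
    (blockPairing (choi Δ H) F V).re ∈ primalValues Δ H E := by
  obtain ⟨g, hg⟩ := h.exists_energy_le hH
  have hδ : 0 ≤ 1 - ∑ k ∈ F, (R k k).re := by linarith [h.trace_le]
  have hg0 : 0 ≤ ofBlocks H.basis {g} fun _ _ => (1 : B →L[ℂ] B) := by
    refine ofBlocks_nonneg _ _ fun v => ?_
    simp only [Finset.sum_singleton]
    exact inner_self_nonneg_complex _
  -- `stateOp` transposes its matrix, so the transpose is inserted to obtain `1 ⊗ R` in the operator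
  -- inequalities.
  refine ⟨stateOp H F (fun k l => R l k) (1 - ∑ k ∈ F, (R k k).re) g, ofBlocks H.basis F V,
    ⟨isState_stateOp h.scalar.transpose h.trace_le g,
      meanEnergy_stateOp_le h.scalar.transpose hδ g hg, ?_, ?_⟩, ?_⟩
  · rw [neg_le_iff_add_nonneg', oneTensor_stateOp, add_right_comm, ofBlocks_add]
    exact add_nonneg (ofBlocks_nonneg _ _ h.lower) (smul_nonneg_of_nonneg hg0 hδ)
  · rw [← sub_nonneg, oneTensor_stateOp, add_sub_right_comm, ofBlocks_sub]
    exact add_nonneg (ofBlocks_nonneg _ _ h.upper) (smul_nonneg_of_nonneg hg0 hδ)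
  · have e : blockPairing (choi Δ H) F V = ((blockPairing (choi Δ H) F V).re : ℂ) :=
      Complex.ext (by simp) (by
        rw [Complex.ofReal_im]; exact im_blockPairing_choi_eq_zero hΔ h.toFinFeasible)
    unfold HasTraceAgainstChoi
    rw [← e]
    -- All blocks of this `V` lie in `F`, so the truncated traces are constant from `F` on.
    refine tendsto_const_nhds.congr' ?_
    filter_upwards [eventually_ge_atTop F] with G hG
    rw [truncTrace_eq_blockPairing, blockPairing_slice_ofBlocks _ _ hG]

end StateOp

/-! ### Testing the trace norm on finitely many blocks -/

section LowerBound

/-- The hypotheses make `Y` self-adjoint and bound its Rayleigh quotients by one; their supremum is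
the norm. -/
theorem norm_le_one_of_nonneg {K : Type*} [NormedAddCommGroup K] [InnerProductSpace ℂ K]
    [CompleteSpace K] {Y : K →L[ℂ] K} (h1 : 0 ≤ 1 - Y) (h2 : 0 ≤ 1 + Y) : ‖Y‖ ≤ 1 := by
  have hs : Y.toLinearMap.IsSymmetric := by
    have h3 : IsSelfAdjoint Y := by
      have := h2.isSelfAdjoint.sub (IsSelfAdjoint.one (K →L[ℂ] K))
      rwa [add_sub_cancel_left] at this
    exact h3.isSymmetric
  rw [ContinuousLinearMap.norm_eq_iSup_rayleighQuotient _ hs]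
  refine ciSup_le fun x => ?_
  have e1 := inner_re_nonneg h1 x
  have e2 := inner_re_nonneg h2 x
  have hx : (⟪x, x⟫_ℂ).re = ‖x‖ ^ 2 := inner_self_eq_norm_sq (𝕜 := ℂ) x
  rw [sub_apply, inner_sub_right, Complex.sub_re, one_apply_eq_self, hx] at e1
  rw [add_apply, inner_add_right, Complex.add_re, one_apply_eq_self, hx] at e2
  rw [ContinuousLinearMap.rayleighQuotient, ContinuousLinearMap.reApplyInnerSelf_apply, abs_div,
    abs_of_nonneg (sq_nonneg ‖x‖)]
  refine div_le_one_of_le₀ ?_ (sq_nonneg _)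
  rw [inner_re_symm]
  change |(⟪x, Y x⟫_ℂ).re| ≤ _
  rw [abs_le]
  constructor <;> linarith

variable {B C : Type*} [NormedAddCommGroup B] [InnerProductSpace ℂ B] [CompleteSpace B]
  [NormedAddCommGroup C] [InnerProductSpace ℂ C] [CompleteSpace C]

theorem inner_cutoff_cutoff {κ : Type*} (b : HilbertBasis κ ℂ B) (G : Finset κ) (X : B →L[ℂ] B)
    (x y : B) : ⟪cutoff b G x, X (cutoff b G y)⟫_ℂ =
      ∑ i ∈ G, ∑ j ∈ G, ⟪b j, X (b i)⟫_ℂ * (⟪x, b j⟫_ℂ * ⟪b i, y⟫_ℂ) := by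
  rw [cutoff, cutoff, map_sum, inner_sum]
  refine Finset.sum_congr rfl fun i _ => ?_
  rw [sum_inner]
  refine Finset.sum_congr rfl fun j _ => ?_
  rw [map_smul, inner_smul_left, inner_smul_right, inner_conj_symm]
  ring

/-- A lower bound for the trace norm by finitely many blocks. -/
theorem ofReal_le_traceNorm {α : Type*} [Fintype α] {e : α → C} (he : Orthonormal ℂ e)
    (σ : HTensor B C →L[ℂ] HTensor B C) (S : α → α → TraceClass B)
    (hS : ∀ p q, slice σ (e p) (e q) = S p q) (X : α → α → B →L[ℂ] B)
    (hX1 : ∀ u : α → B, 0 ≤ ∑ p, ⟪u p, u p⟫_ℂ - ∑ p, ∑ q, ⟪u p, X p q (u q)⟫_ℂ)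
    (hX2 : ∀ u : α → B, 0 ≤ ∑ p, ⟪u p, u p⟫_ℂ + ∑ p, ∑ q, ⟪u p, X p q (u q)⟫_ℂ) :
    ENNReal.ofReal (∑ p, ∑ q, trace ((S p q : B →L[ℂ] B) * X q p)).re ≤ traceNorm σ := by
  by_cases hσ : σ ∈ TraceClass (HTensor B C)
  swap
  · have : traceNorm σ = ∞ := by
      by_contra h
      exact hσ (lt_top_iff_ne_top.2 h)
    rw [this]
    exact le_top
  set b := stdBasis B
  -- A finite rank cutoff of the block operator `X`: its trace against `σ` is an explicit finite
  -- sum, its norm is at most one by `hX1` and `hX2`, and its pairings converge as `G` grows.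
  set Y : Finset (StdIndex B) → TraceClass (HTensor B C) := fun G =>
    ∑ p, ∑ q, ∑ i ∈ G, ∑ j ∈ G, ⟪b j, X q p (b i)⟫_ℂ •
      ketBra (tmulRight B (e q) (b j)) (tmulRight B (e p) (b i)) with hY
  have hYin : ∀ G u, ⟪u, (Y G : HTensor B C →L[ℂ] HTensor B C) u⟫_ℂ =
      ∑ p, ∑ q, ⟪cutoff b G (ContinuousLinearMap.adjoint (tmulRight B (e p)) u),
        X p q (cutoff b G (ContinuousLinearMap.adjoint (tmulRight B (e q)) u))⟫_ℂ := by
    intro G u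
    rw [Finset.sum_comm]
    simp only [hY, Submodule.coe_sum, Submodule.coe_smul, sum_apply, inner_sum, smul_apply,
      inner_smul_right, ketBra_apply, inner_cutoff_cutoff]
    refine Finset.sum_congr rfl fun p _ => Finset.sum_congr rfl fun q _ =>
      Finset.sum_congr rfl fun i _ => Finset.sum_congr rfl fun j _ => ?_
    rw [ContinuousLinearMap.adjoint_inner_left, ContinuousLinearMap.adjoint_inner_right]
    ring
  have hcut : ∀ G u, 0 ≤ ⟪u, u⟫_ℂ -
      ∑ p, ⟪cutoff b G (ContinuousLinearMap.adjoint (tmulRight B (e p)) u),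
        cutoff b G (ContinuousLinearMap.adjoint (tmulRight B (e p)) u)⟫_ℂ := by
    intro G u
    have h1 := sum_norm_sq_adjoint_le he Finset.univ u
    have h2 : ∑ p, ‖cutoff b G (ContinuousLinearMap.adjoint (tmulRight B (e p)) u)‖ ^ 2 ≤
        ∑ p, ‖ContinuousLinearMap.adjoint (tmulRight B (e p)) u‖ ^ 2 :=
      Finset.sum_le_sum fun p _ => pow_le_pow_left₀ (norm_nonneg _) (norm_cutoff_le _ _ _) 2
    simp only [inner_self_eq_norm_sq_to_K]
    have h3 := Complex.zero_le_real.2 (sub_nonneg.2 (h2.trans h1))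
    push_cast at h3
    exact h3
  have hYle : ∀ G, ‖(Y G : HTensor B C →L[ℂ] HTensor B C)‖ ≤ 1 := by
    intro G
    refine norm_le_one_of_nonneg (nonneg_iff_inner.2 fun u => ?_) (nonneg_iff_inner.2 fun u => ?_)
    · rw [sub_apply, inner_sub_right, one_apply_eq_self, hYin]
      have := add_nonneg (hcut G u) (hX1 fun p =>
        cutoff b G (ContinuousLinearMap.adjoint (tmulRight B (e p)) u))
      refine this.trans_eq ?_
      ring
    · rw [add_apply, inner_add_right, one_apply_eq_self, hYin]
      have := add_nonneg (hcut G u) (hX2 fun p =>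
        cutoff b G (ContinuousLinearMap.adjoint (tmulRight B (e p)) u))
      refine this.trans_eq ?_
      ring
  have htr : ∀ G, trace (σ * (Y G : HTensor B C →L[ℂ] HTensor B C)) = ∑ p, ∑ q,
      ∑ i ∈ G, ∑ j ∈ G, ⟪b i, (S p q : B →L[ℂ] B) (b j)⟫_ℂ * ⟪b j, X q p (b i)⟫_ℂ := by
    intro G
    change mulTraceL ⟨σ, hσ⟩ (Y G : HTensor B C →L[ℂ] HTensor B C) = _
    simp only [hY, Submodule.coe_sum, Submodule.coe_smul, map_sum, map_smul, smul_eq_mul,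
      mulTraceL_apply, trace_mul_ketBra, ← inner_slice, hS]
    refine Finset.sum_congr rfl fun p _ => Finset.sum_congr rfl fun q _ =>
      Finset.sum_congr rfl fun i _ => Finset.sum_congr rfl fun j _ => mul_comm _ _
  have hlim : Tendsto (fun G => trace (σ * (Y G : HTensor B C →L[ℂ] HTensor B C))) atTop
      (𝓝 (∑ p, ∑ q, trace ((S p q : B →L[ℂ] B) * X q p))) := by
    simp only [htr]
    exact tendsto_finsetSum _ fun p _ => tendsto_finsetSum _ fun q _ =>
      tendsto_trace_mul b (S p q) (X q p)
  rw [ENNReal.ofReal_le_iff_le_toReal hσ.ne]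
  refine le_of_tendsto' ((Complex.continuous_re.tendsto _).comp hlim) fun G => ?_
  refine (Complex.re_le_norm _).trans ((norm_trace_mul_le hσ _).trans ?_)
  exact mul_le_of_le_one_left ENNReal.toReal_nonneg (hYle G)

theorem slice_ketBra (ψ φ : HTensor B C) (c d : C) :
    slice (ketBra ψ φ : HTensor B C →L[ℂ] HTensor B C) c d =
      ketBra (ContinuousLinearMap.adjoint (tmulRight B c) ψ)
        (ContinuousLinearMap.adjoint (tmulRight B d) φ) := by
  ext y
  refine ext_inner_left ℂ fun x => ?_
  rw [inner_slice, ketBra_apply, ketBra_apply, inner_smul_right, inner_smul_right,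
    ContinuousLinearMap.adjoint_inner_left, ContinuousLinearMap.adjoint_inner_right]

theorem slice_eq_sum {α : Type*} [Fintype α] (e : OrthonormalBasis α ℂ C)
    (T : HTensor B C →L[ℂ] HTensor B C) (c d : C) :
    slice T c d = ∑ p, ∑ q, (⟪c, e p⟫_ℂ * ⟪e q, d⟫_ℂ) • slice T (e p) (e q) := by
  ext y
  refine ext_inner_left ℂ fun x => ?_
  rw [inner_slice]
  conv_lhs => rw [← e.sum_repr' c, ← e.sum_repr' d]
  simp only [tmulRight_sum_smul, map_sum, sum_inner, inner_sum, map_smul, inner_smul_left,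
    inner_smul_right, inner_conj_symm, sum_apply, smul_apply, ← inner_slice]
  rw [Finset.sum_comm]
  refine Finset.sum_congr rfl fun p _ => ?_
  rw [Finset.mul_sum]
  exact Finset.sum_congr rfl fun q _ => by ring

/-- The partial trace is defined in `stdBasis`; expanding those vectors in `e` and using Parseval
leaves the diagonal blocks in `e`. -/
theorem isPartialTrace_of_sum {α : Type*} [Fintype α] (e : OrthonormalBasis α ℂ C)
    {T : HTensor B C →L[ℂ] HTensor B C} {S : B →L[ℂ] B}
    (h : ∑ p, slice T (e p) (e p) = S) : IsPartialTrace T S := by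
  classical
  intro x y
  have h1 : ∀ j, ⟪x, slice T (stdBasis C j) (stdBasis C j) y⟫_ℂ = ∑ p, ∑ q,
      ⟪e q, stdBasis C j⟫_ℂ * ⟪stdBasis C j, e p⟫_ℂ * ⟪x, slice T (e p) (e q) y⟫_ℂ := by
    intro j
    rw [slice_eq_sum e]
    simp only [sum_apply, inner_sum, smul_apply, inner_smul_right]
    exact Finset.sum_congr rfl fun p _ => Finset.sum_congr rfl fun q _ => by ring
  simp only [h1]
  have h2 : ⟪x, S y⟫_ℂ = ∑ p, ∑ q, ⟪e q, e p⟫_ℂ * ⟪x, slice T (e p) (e q) y⟫_ℂ := by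
    rw [← h, sum_apply, inner_sum]
    refine Finset.sum_congr rfl fun p _ => ?_
    rw [Finset.sum_eq_single p]
    · rw [(orthonormal_iff_ite.1 e.orthonormal) p p, if_pos rfl, one_mul]
    · intro q _ hq
      rw [(orthonormal_iff_ite.1 e.orthonormal) q p, if_neg hq, zero_mul]
    · simp
  rw [h2]
  exact hasSum_sum fun p _ => hasSum_sum fun q _ =>
    ((stdBasis C).hasSum_inner_mul_inner _ _).mul_right _

end LowerBound

/-! ### Purifications show that the diamond norm is at least the finite values -/

section DiamondLower

variable {A B : Type*} [NormedAddCommGroup A] [InnerProductSpace ℂ A] [CompleteSpace A]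
  [NormedAddCommGroup B] [InnerProductSpace ℂ B] [CompleteSpace B] {ι : Type*}
  {Δ : TraceClass A →ₗ[ℂ] TraceClass B} {H : Hamiltonian ι A} {E : ℝ}

open scoped Classical in
/-- A positive definite matrix is a Gram matrix `m† m` with `m` invertible. -/
theorem exists_gram_inverse {F : Finset ι} {R : ι → ι → ℂ} (hR : ScalarPosOn F R) {η : ℝ}
    (hη : 0 < η) (hd : ∀ c : ι → ℂ, η * ∑ k ∈ F, ‖c k‖ ^ 2 ≤
      (∑ k ∈ F, ∑ l ∈ F, starRingEnd ℂ (c k) * R k l * c l).re) :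
    ∃ (m : F → ι → ℂ) (N : ι → F → ℂ),
      (∀ k ∈ F, ∀ l ∈ F, R k l = ∑ r, starRingEnd ℂ (m r k) * m r l) ∧
      (∀ k ∈ F, ∀ l ∈ F, ∑ r, N k r * m r l = if k = l then 1 else 0) ∧
      ∀ r s, ∑ k ∈ F, m r k * N k s = if r = s then 1 else 0 := by
  obtain ⟨m, hm⟩ := exists_gram F R hR
  set M : Matrix F F ℂ := fun r k => m r k with hM
  -- A kernel vector would annihilate the quadratic form of `R`, contradicting the lower bound by
  -- `η`.
  have hinj : Function.Injective M.mulVec := by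
    rw [← Matrix.coe_mulVecLin, ← LinearMap.ker_eq_bot, LinearMap.ker_eq_bot']
    intro c hc
    rw [Matrix.mulVecLin_apply] at hc
    set c' : ι → ℂ := fun k => if h : k ∈ F then c ⟨k, h⟩ else 0 with hc'
    have e1 : ∀ k : F, c' k = c k := fun k => by simp [hc']
    have e2 : ∑ k ∈ F, ∑ l ∈ F, starRingEnd ℂ (c' k) * R k l * c' l = 0 := by
      have : ∑ k ∈ F, ∑ l ∈ F, starRingEnd ℂ (c' k) * R k l * c' l =
          ∑ r : F, starRingEnd ℂ (∑ k ∈ F, m r k * c' k) * ∑ l ∈ F, m r l * c' l := by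
        simp only [map_sum, map_mul, Finset.sum_mul_sum]
        symm
        rw [Finset.sum_comm]
        refine Finset.sum_congr rfl fun k hk => ?_
        rw [Finset.sum_comm]
        refine Finset.sum_congr rfl fun l hl => ?_
        rw [hm k hk l hl, Finset.mul_sum, Finset.sum_mul]
        exact Finset.sum_congr rfl fun r _ => by ring
      rw [this]
      refine Finset.sum_eq_zero fun r _ => ?_
      have h3 : ∑ l ∈ F, m r l * c' l = 0 := by
        rw [← Finset.sum_coe_sort]
        simp only [e1]
        exact congrFun hc r
      rw [h3, mul_zero]
    have h4 := hd c'
    rw [e2, Complex.zero_re] at h4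
    have h5 : ∑ k ∈ F, ‖c' k‖ ^ 2 = 0 := by
      have h6 : 0 ≤ ∑ k ∈ F, ‖c' k‖ ^ 2 := Finset.sum_nonneg fun _ _ => by positivity
      nlinarith
    rw [Finset.sum_eq_zero_iff_of_nonneg fun _ _ => by positivity] at h5
    ext k
    have := h5 k k.2
    rw [e1] at this
    simpa using this
  have hunit := (Matrix.mulVec_injective_iff_isUnit).1 hinj
  have hdet := (Matrix.isUnit_iff_isUnit_det M).1 hunit
  refine ⟨m, fun k r => if h : k ∈ F then M⁻¹ ⟨k, h⟩ r else 0, hm, fun k hk l hl => ?_,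
    fun r s => ?_⟩
  · have := congrFun (congrFun (Matrix.nonsing_inv_mul M hdet) ⟨k, hk⟩) ⟨l, hl⟩
    rw [Matrix.mul_apply, Matrix.one_apply] at this
    simpa [hk] using this
  · have := congrFun (congrFun (Matrix.mul_nonsing_inv M hdet) r) s
    rw [Matrix.mul_apply, Matrix.one_apply] at this
    rw [← Finset.sum_coe_sort]
    simpa using this

theorem sum_inner_gram {F : Finset ι} {α : Type*} [Fintype α] {R : ι → ι → ℂ} {m : α → ι → ℂ}
    (hm : ∀ k ∈ F, ∀ l ∈ F, R k l = ∑ r, starRingEnd ℂ (m r k) * m r l) (w : ι → B) :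
    ∑ k ∈ F, ∑ l ∈ F, ⟪w k, (R k l • (1 : B →L[ℂ] B)) (w l)⟫_ℂ =
      ∑ r, ⟪∑ k ∈ F, m r k • w k, ∑ k ∈ F, m r k • w k⟫_ℂ := by
  simp only [sum_inner, inner_sum, inner_smul_left, inner_smul_right, smul_apply,
    one_apply_eq_self, Finset.mul_sum]
  rw [Finset.sum_comm (s := Finset.univ), Finset.sum_comm]
  refine Finset.sum_congr rfl fun l hl => ?_
  rw [Finset.sum_comm (s := Finset.univ)]
  refine Finset.sum_congr rfl fun k hk => ?_
  rw [hm k hk l hl, Finset.sum_mul]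
  exact Finset.sum_congr rfl fun r _ => by ring

theorem sum_inner_transform {F : Finset ι} {α : Type*} [Fintype α] (N : ι → α → ℂ)
    (V : ι → ι → B →L[ℂ] B) (u : α → B) :
    ∑ p, ∑ q, ⟪u p, (∑ l ∈ F, ∑ k ∈ F, (starRingEnd ℂ (N l p) * N k q) • V l k) (u q)⟫_ℂ =
      ∑ l ∈ F, ∑ k ∈ F, ⟪∑ p, N l p • u p, V l k (∑ q, N k q • u q)⟫_ℂ := by
  simp only [map_sum, sum_inner, inner_sum, map_smul, inner_smul_left, inner_smul_right, smul_apply,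
    sum_apply, Finset.mul_sum]
  have e : ∀ f : α → α → ι → ι → ℂ, ∑ p, ∑ q, ∑ l ∈ F, ∑ k ∈ F, f p q l k =
      ∑ l ∈ F, ∑ k ∈ F, ∑ q, ∑ p, f p q l k := by
    intro f
    calc _ = ∑ p, ∑ l ∈ F, ∑ k ∈ F, ∑ q, f p q l k :=
          Finset.sum_congr rfl fun p _ => by
            rw [Finset.sum_comm]
            exact Finset.sum_congr rfl fun l _ => Finset.sum_comm
      _ = ∑ l ∈ F, ∑ p, ∑ k ∈ F, ∑ q, f p q l k := Finset.sum_comm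
      _ = _ := Finset.sum_congr rfl fun l _ => by
            rw [Finset.sum_comm]
            exact Finset.sum_congr rfl fun k _ => Finset.sum_comm
  rw [e]
  refine Finset.sum_congr rfl fun l _ => Finset.sum_congr rfl fun k _ =>
    Finset.sum_congr rfl fun q _ => Finset.sum_congr rfl fun p _ => by ring

/-- The matrix `N` reconstructs the eigenvectors from the `x p`, so the change of basis in the
output blocks cancels against the one in the test operator. -/
theorem sum_trace_transform {F : Finset ι} {α : Type*} [Fintype α] (N : ι → α → ℂ) (x : α → A)
    (hx : ∀ k ∈ F, ∑ p, N k p • x p = H.basis k) (V : ι → ι → B →L[ℂ] B) :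
    ∑ p, ∑ q, trace ((Δ (ketBra (x p) (x q)) : B →L[ℂ] B) *
      ∑ l ∈ F, ∑ k ∈ F, (starRingEnd ℂ (N l q) * N k p) • V l k) =
      blockPairing (choi Δ H) F V := by
  have h1 : ∀ k ∈ F, ∀ l ∈ F, trace ((choi Δ H k l : B →L[ℂ] B) * V l k) =
      ∑ p, ∑ q, starRingEnd ℂ (N l q) * N k p *
        trace ((Δ (ketBra (x p) (x q)) : B →L[ℂ] B) * V l k) := by
    intro k hk l hl
    rw [← traceMulL_apply, choi, ← hx k hk, ← hx l hl]
    simp only [ketBra_sum_left, ketBra_sum_right, ketBra_smul_left, ketBra_smul_right, map_sum,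
      map_smul, smul_eq_mul, traceMulL_apply, Finset.mul_sum]
    rw [Finset.sum_comm]
    exact Finset.sum_congr rfl fun p _ => Finset.sum_congr rfl fun q _ => by ring
  have h2 : blockPairing (choi Δ H) F V = ∑ k ∈ F, ∑ l ∈ F, ∑ p, ∑ q,
      starRingEnd ℂ (N l q) * N k p * trace ((Δ (ketBra (x p) (x q)) : B →L[ℂ] B) * V l k) :=
    Finset.sum_congr rfl fun k hk => Finset.sum_congr rfl fun l hl => h1 k hk l hl
  rw [h2]
  have e : ∀ f : ι → ι → α → α → ℂ, ∑ k ∈ F, ∑ l ∈ F, ∑ p, ∑ q, f k l p q =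
      ∑ p, ∑ q, ∑ l ∈ F, ∑ k ∈ F, f k l p q := by
    intro f
    calc _ = ∑ k ∈ F, ∑ p, ∑ q, ∑ l ∈ F, f k l p q :=
          Finset.sum_congr rfl fun p _ => by
            rw [Finset.sum_comm]
            exact Finset.sum_congr rfl fun l _ => Finset.sum_comm
      _ = ∑ p, ∑ k ∈ F, ∑ q, ∑ l ∈ F, f k l p q := Finset.sum_comm
      _ = _ := Finset.sum_congr rfl fun l _ => by
            rw [Finset.sum_comm]
            exact Finset.sum_congr rfl fun k _ => Finset.sum_comm
  rw [e]
  refine Finset.sum_congr rfl fun p _ => Finset.sum_congr rfl fun q _ => ?_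
  rw [← mulTraceL_apply]
  simp only [map_sum, map_smul, smul_eq_mul, mulTraceL_apply]

theorem sum_ketBra_gram {F : Finset ι} {α : Type*} [Fintype α] {R : ι → ι → ℂ} {m : α → ι → ℂ}
    (hm : ∀ k ∈ F, ∀ l ∈ F, R k l = ∑ r, starRingEnd ℂ (m r k) * m r l) :
    ∑ r, ketBra (∑ k ∈ F, m r k • H.basis k) (∑ k ∈ F, m r k • H.basis k) =
      transposeOp H F R := by
  simp only [ketBra_sum_left, ketBra_sum_right, ketBra_smul_left, ketBra_smul_right, transposeOp,
    Finset.smul_sum]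
  symm
  rw [Finset.sum_comm]
  symm
  rw [Finset.sum_comm]
  refine Finset.sum_congr rfl fun l hl => ?_
  rw [Finset.sum_comm]
  refine Finset.sum_congr rfl fun k hk => ?_
  rw [hm l hl k hk, Finset.sum_smul]
  exact Finset.sum_congr rfl fun r _ => by rw [smul_smul]

variable (Δ) in
/-- An operator amplifying a family of blocks over a finite dimensional reference system. -/
theorem isAmplification_ofBlocks {C α : Type*} [NormedAddCommGroup C] [InnerProductSpace ℂ C]
    [CompleteSpace C] [Fintype α] (e : OrthonormalBasis α ℂ C)
    {ρ : HTensor A C →L[ℂ] HTensor A C} (Y : α → α → TraceClass A)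
    (hY : ∀ p q, (Y p q : A →L[ℂ] A) = slice ρ (e p) (e q)) :
    IsAmplification Δ ρ (ofBlocks e Finset.univ fun p q => (Δ (Y p q) : B →L[ℂ] B)) := by
  intro c d
  refine ⟨∑ p, ∑ q, (⟪c, e p⟫_ℂ * ⟪e q, d⟫_ℂ) • Y p q, ?_, ?_⟩
  · simp only [Submodule.coe_sum, Submodule.coe_smul, hY]
    exact (slice_eq_sum e ρ c d).symm
  · simp only [slice_ofBlocks, map_sum, map_smul, Submodule.coe_sum, Submodule.coe_smul]

/-- For `R = m† m` the vector `ψ = ∑ r, x r ⊗ e r` with `x r = ∑ k, m r k |k⟩` has marginal the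
transpose of `R`. With `N = m⁻¹` the output is tested against `N† V N`, which is a self-adjoint
contraction because `N† R N = 1`; the pairing is the objective value. -/
theorem StrictFeasible.le_traceNorm {C : Type*} [NormedAddCommGroup C] [InnerProductSpace ℂ C]
    [CompleteSpace C] {F : Finset ι} (e : OrthonormalBasis (Option F) ℂ C) {R : ι → ι → ℂ}
    {V : ι → ι → B →L[ℂ] B} (h : StrictFeasible H E F R V) (g : ι) :
    ∃ (ρ : HTensor A C →L[ℂ] HTensor A C) (σ : HTensor B C →L[ℂ] HTensor B C),
      IsState ρ ∧
      IsPartialTrace ρ (stateOp H F R (1 - ∑ k ∈ F, (R k k).re) g : A →L[ℂ] A) ∧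
      IsAmplification Δ ρ σ ∧
      ENNReal.ofReal (blockPairing (choi Δ H) F V).re ≤ traceNorm σ := by
  classical
  obtain ⟨η, hη, hd⟩ := h.posDef
  obtain ⟨m, N, hm, hNm, hmN⟩ := exists_gram_inverse h.scalar hη hd
  set δ : ℝ := 1 - ∑ k ∈ F, (R k k).re with hδ
  have hδ0 : 0 ≤ δ := by linarith [h.trace_le]
  set x : F → A := fun r => ∑ k ∈ F, m r k • H.basis k with hx
  set ψ : HTensor A C := ∑ r, tmulRight A (e (some r)) (x r) with hψ
  -- The missing trace `δ` sits on the extra reference vector `e none`, so it leaves the blocks used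
  -- in the test unchanged.
  set φ : HTensor A C := tmulRight A (e none) (H.basis g) with hφ
  have hee := orthonormal_iff_ite.1 e.orthonormal
  have hψs : ∀ r, ContinuousLinearMap.adjoint (tmulRight A (e (some r))) ψ = x r := by
    intro r
    simp [hψ, adjoint_tmulRight_tmulRight, hee]
  have hψn : ContinuousLinearMap.adjoint (tmulRight A (e none)) ψ = 0 := by
    simp [hψ, adjoint_tmulRight_tmulRight, hee]
  have hφs : ∀ r, ContinuousLinearMap.adjoint (tmulRight A (e (some r))) φ = 0 := by
    intro r
    simp [hφ, adjoint_tmulRight_tmulRight, hee]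
  have hφn : ContinuousLinearMap.adjoint (tmulRight A (e none)) φ = H.basis g := by
    simp [hφ, adjoint_tmulRight_tmulRight]
  set Y : Option F → Option F → TraceClass A := fun p q =>
    ketBra (ContinuousLinearMap.adjoint (tmulRight A (e p)) ψ)
      (ContinuousLinearMap.adjoint (tmulRight A (e q)) ψ) + (δ : ℂ) •
    ketBra (ContinuousLinearMap.adjoint (tmulRight A (e p)) φ)
      (ContinuousLinearMap.adjoint (tmulRight A (e q)) φ) with hY
  set ρ : TraceClass (HTensor A C) := ketBra ψ ψ + (δ : ℂ) • ketBra φ φ with hρ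
  have hslice : ∀ p q, (Y p q : A →L[ℂ] A) =
      slice (ρ : HTensor A C →L[ℂ] HTensor A C) (e p) (e q) := by
    intro p q
    change _ = slice ((ketBra ψ ψ : HTensor A C →L[ℂ] HTensor A C) +
      (δ : ℂ) • (ketBra φ φ : HTensor A C →L[ℂ] HTensor A C)) (e p) (e q)
    rw [slice_add, slice_smul, slice_ketBra, slice_ketBra]
    rfl
  have hYs : ∀ r s, Y (some r) (some s) = ketBra (x r) (x s) := by
    intro r s
    simp only [hY, hψs, hφs, ketBra_zero_left, smul_zero, add_zero]
  have hYn : Y none none = (δ : ℂ) • ketBra (H.basis g) (H.basis g) := by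
    simp only [hY, hψn, hφn, ketBra_zero_left, zero_add]
  refine ⟨ρ, ofBlocks e Finset.univ fun p q => (Δ (Y p q) : B →L[ℂ] B), ⟨?_, ρ.2, ?_⟩, ?_,
    isAmplification_ofBlocks Δ e Y hslice, ?_⟩
  · rw [hρ, Submodule.coe_add, Submodule.coe_smul]
    exact add_nonneg (ketBra_self_nonneg _) (smul_nonneg_of_nonneg (ketBra_self_nonneg _) hδ0)
  · have h1 : ⟪φ, φ⟫_ℂ = 1 := by
      rw [hφ, inner_tmulRight, inner_self_eq_norm_sq_to_K, inner_self_eq_norm_sq_to_K,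
        H.basis.orthonormal.norm_eq_one, e.orthonormal.norm_eq_one]
      simp
    have h2 : ⟪ψ, ψ⟫_ℂ = trace (transposeOp H F R : A →L[ℂ] A) := by
      rw [← sum_ketBra_gram hm, ← traceL_apply, map_sum]
      simp only [traceL_apply, trace_ketBra, hψ, sum_inner, inner_sum, inner_tmulRight, hee]
      simp [hx, Finset.mul_sum]
    rw [← traceL_apply, hρ, map_add, map_smul, traceL_apply, traceL_apply, trace_ketBra,
      trace_ketBra, h1, h2, trace_transposeOp, h.scalar.sum_diag, hδ]
    push_cast
    simp
  · refine isPartialTrace_of_sum e ?_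
    simp only [← hslice, Fintype.sum_option, hYn, hYs]
    rw [← Submodule.coe_sum, ← Submodule.coe_add, hx, sum_ketBra_gram hm, add_comm]
    rfl
  · have hxN : ∀ k ∈ F, ∑ p, N k p • x p = H.basis k := by
      intro k hk
      simp only [hx, Finset.smul_sum, smul_smul]
      rw [Finset.sum_comm]
      simp only [← Finset.sum_smul]
      rw [Finset.sum_eq_single k]
      · rw [hNm k hk k hk, if_pos rfl, one_smul]
      · intro l hl hlk
        rw [hNm k hk l hl, if_neg hlk.symm, zero_smul]
      · exact fun h => (h hk).elim
    rw [← sum_trace_transform N x hxN V]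
    -- This is `N† R N = 1`, which turns the bounds of `V` by `1 ⊗ R` into bounds by the identity.
    have hu : ∀ u : F → B, ∑ p, ⟪u p, u p⟫_ℂ = ∑ k ∈ F, ∑ l ∈ F,
        ⟪∑ p, N k p • u p, (R k l • (1 : B →L[ℂ] B)) (∑ p, N l p • u p)⟫_ℂ := by
      intro u
      rw [sum_inner_gram hm fun k => ∑ p, N k p • u p]
      refine Finset.sum_congr rfl fun r _ => ?_
      have : ∑ k ∈ F, m r k • ∑ p, N k p • u p = u r := by
        simp only [Finset.smul_sum, smul_smul]
        rw [Finset.sum_comm]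
        simp only [← Finset.sum_smul, hmN]
        simp
      rw [this]
    refine ofReal_le_traceNorm (e := fun r => e (some r))
      (e.orthonormal.comp _ (Option.some_injective _)) _ (fun p q => Δ (ketBra (x p) (x q)))
      (fun p q => ?_) (fun p q => ∑ l ∈ F, ∑ k ∈ F, (starRingEnd ℂ (N l p) * N k q) • V l k)
      (fun u => ?_) fun u => ?_
    · rw [slice_ofBlocks, Finset.sum_eq_single (some p), Finset.sum_eq_single (some q)]
      · simp [hYs]
      · intro q' _ hq'
        simp [hee, hq']
      · simp
      · intro p' _ hp'
        refine Finset.sum_eq_zero fun q' _ => ?_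
        simp [hee, hp'.symm]
      · simp
    · rw [sum_inner_transform, hu, ← Finset.sum_sub_distrib]
      refine (h.upper fun k => ∑ p, N k p • u p).trans_eq ?_
      refine Finset.sum_congr rfl fun k _ => ?_
      rw [← Finset.sum_sub_distrib]
      exact Finset.sum_congr rfl fun l _ => by rw [sub_apply, inner_sub_right]
    · rw [sum_inner_transform, hu, ← Finset.sum_add_distrib]
      refine (h.lower fun k => ∑ p, N k p • u p).trans_eq ?_
      refine Finset.sum_congr rfl fun k _ => ?_
      rw [← Finset.sum_add_distrib]
      exact Finset.sum_congr rfl fun l _ => by rw [add_apply, inner_add_right]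

theorem StrictFeasible.le_ecDiamondNorm (hH : H.IsGrounded) {F : Finset ι} {R : ι → ι → ℂ}
    {V : ι → ι → B →L[ℂ] B} (h : StrictFeasible H E F R V) :
    ENNReal.ofReal (blockPairing (choi Δ H) F V).re ≤ ecDiamondNorm Δ H E := by
  classical
  obtain ⟨g, hg⟩ := h.exists_energy_le hH
  have hδ : 0 ≤ 1 - ∑ k ∈ F, (R k k).re := by linarith [h.trace_le]
  -- `ecDiamondNorm` ranges over reference systems in `Type`, whereas `F` may live in a higher
  -- universe, hence the renumbering.
  let e : OrthonormalBasis (Option F) ℂ (EuclideanSpace ℂ (Option (Fin F.card))) :=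
    (EuclideanSpace.basisFun _ ℂ).reindex (Equiv.optionCongr F.equivFin).symm
  obtain ⟨ρ, σ, hρ, hpt, ham, hle⟩ := h.le_traceNorm (Δ := Δ) e g
  refine hle.trans (le_sSup ?_)
  exact ⟨EuclideanSpace ℂ (Option (Fin F.card)), inferInstance, inferInstance, inferInstance,
    inferInstance, ρ, _, σ, hρ, hpt, meanEnergy_stateOp_le h.scalar hδ g hg, ham, rfl⟩

end DiamondLower

/-! ### Values of the primal programmes -/

section PrimalProgramme

variable {A B : Type*} [NormedAddCommGroup A] [InnerProductSpace ℂ A] [CompleteSpace A]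
  [NormedAddCommGroup B] [InnerProductSpace ℂ B] [CompleteSpace B] {ι : Type*}
  {Δ : TraceClass A →ₗ[ℂ] TraceClass B} {H : Hamiltonian ι A} {E : ℝ}

theorem isLUB_finValues (hΔ : IsHermitianPreserving Δ) (hE : 0 ≤ E) :
    IsLUB (finValues Δ H E) (sSup (finValues Δ H E)) :=
  isLUB_csSup ⟨0, zero_mem_finValues hE⟩ (bddAbove_finValues hΔ)

theorem sSup_finValues_nonneg (hΔ : IsHermitianPreserving Δ) (hE : 0 ≤ E) :
    0 ≤ sSup (finValues Δ H E) := (isLUB_finValues hΔ hE).1 (zero_mem_finValues hE)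

theorem ecDiamondNorm_lt_top (hΔ : IsHermitianPreserving Δ) (hE : 0 ≤ E) :
    ecDiamondNorm Δ H E < ∞ :=
  (ecDiamondNorm_le hΔ hE (isLUB_finValues hΔ hE).1).trans_lt ENNReal.ofReal_lt_top

theorem toReal_ecDiamondNorm (hΔ : IsHermitianPreserving Δ) (hH : H.IsGrounded) (hE : 0 < E) :
    (ecDiamondNorm Δ H E).toReal = sSup (finValues Δ H E) := by
  have hc := isLUB_finValues (H := H) hΔ hE.le
  refine le_antisymm ?_ ?_
  · exact ENNReal.toReal_le_of_le_ofReal (sSup_finValues_nonneg hΔ hE.le)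
      (ecDiamondNorm_le hΔ hE.le hc.1)
  · refine hc.2 (mem_upperBounds_finValues hE fun F R V h => ?_)
    exact (ENNReal.ofReal_le_iff_le_toReal (ecDiamondNorm_lt_top hΔ hE.le).ne).1
      (h.le_ecDiamondNorm hH)

theorem isLUB_primalValues (hΔ : IsHermitianPreserving Δ) (hH : H.IsGrounded) (hE : 0 < E) :
    IsLUB (primalValues Δ H E) (ecDiamondNorm Δ H E).toReal := by
  have hc := isLUB_finValues (H := H) hΔ hE.le
  rw [toReal_ecDiamondNorm hΔ hH hE]
  refine ⟨primalValues_le hE.le hc.1, fun b hb => hc.2 ?_⟩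
  exact mem_upperBounds_finValues hE fun F R V h => hb (h.mem_primalValues hΔ hH)

theorem truncTrace_oneTensor (hΔ : IsTraceAnnihilating Δ) (ρ : A →L[ℂ] A) (F : Finset ι) :
    truncTrace Δ H (oneTensor B ρ) F = 0 := by
  rw [truncTrace_eq_blockPairing]
  simp only [slice_oneTensor]
  rw [blockPairing_choi_scalar, hΔ]

theorem truncTrace_add (Δ : TraceClass A →ₗ[ℂ] TraceClass B) (H : Hamiltonian ι A)
    (V W : HTensor B A →L[ℂ] HTensor B A) (F : Finset ι) :
    truncTrace Δ H (V + W) F = truncTrace Δ H V F + truncTrace Δ H W F := by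
  simp only [truncTrace_eq_blockPairing, slice_add, blockPairing_add]

theorem truncTrace_smul (Δ : TraceClass A →ₗ[ℂ] TraceClass B) (H : Hamiltonian ι A) (z : ℂ)
    (V : HTensor B A →L[ℂ] HTensor B A) (F : Finset ι) :
    truncTrace Δ H (z • V) F = z * truncTrace Δ H V F := by
  simp only [truncTrace_eq_blockPairing, slice_smul, blockPairing_smul]

/-- The substitution `V = 2 W - 1 ⊗ ρ` exchanges the two constraint sets, and `1 ⊗ ρ` contributes
nothing to any truncated trace. -/
theorem mem_simplifiedPrimalValues_iff (hΔ : IsTraceAnnihilating Δ) {t : ℝ} :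
    t ∈ simplifiedPrimalValues Δ H E ↔ 2 * t ∈ primalValues Δ H E := by
  constructor
  · rintro ⟨ρ, W, h1, h2, h3, h4, h5⟩
    refine ⟨ρ, (2 : ℂ) • W + (-1 : ℂ) • oneTensor B ρ, ⟨h1, h2, ?_, ?_⟩, ?_⟩
    · rw [← sub_nonneg]
      convert smul_nonneg_of_nonneg h3 (zero_le_two (α := ℝ)) using 1
      push_cast
      module
    · rw [← sub_nonneg] at h4 ⊢
      convert smul_nonneg_of_nonneg h4 (zero_le_two (α := ℝ)) using 1
      push_cast
      module
    · unfold HasTraceAgainstChoi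
      push_cast
      refine (h5.const_mul 2).congr fun F => ?_
      rw [truncTrace_add, truncTrace_smul, truncTrace_smul, truncTrace_oneTensor hΔ, mul_zero,
        add_zero]
  · rintro ⟨ρ, V, ⟨h1, h2, h3, h4⟩, h5⟩
    refine ⟨ρ, (1 / 2 : ℂ) • V + (1 / 2 : ℂ) • oneTensor B ρ, h1, h2, ?_, ?_, ?_⟩
    · rw [← sub_nonneg] at h3
      convert smul_nonneg_of_nonneg h3 (one_half_pos (α := ℝ)).le using 1
      push_cast
      module
    · rw [← sub_nonneg] at h4 ⊢
      convert smul_nonneg_of_nonneg h4 (one_half_pos (α := ℝ)).le using 1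
      push_cast
      module
    · unfold HasTraceAgainstChoi
      have := h5.const_mul (1 / 2)
      push_cast at this
      rw [one_div, inv_mul_cancel_left₀ two_ne_zero] at this
      refine this.congr fun F => ?_
      rw [truncTrace_add, truncTrace_smul, truncTrace_smul, truncTrace_oneTensor hΔ, mul_zero,
        add_zero, one_div]

theorem isLUB_simplifiedPrimalValues (hΔ : IsTraceAnnihilating Δ) {c : ℝ}
    (hc : IsLUB (primalValues Δ H E) c) : IsLUB (simplifiedPrimalValues Δ H E) (1 / 2 * c) := by
  refine ⟨fun t ht => ?_, fun b hb => ?_⟩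
  · have := hc.1 ((mem_simplifiedPrimalValues_iff hΔ).1 ht)
    linarith
  · have : c ≤ 2 * b := hc.2 fun t ht => by
      have h1 : 1 / 2 * t ∈ simplifiedPrimalValues Δ H E := by
        rw [mem_simplifiedPrimalValues_iff hΔ]
        convert ht using 1
        ring
      linarith [hb h1]
    linarith

theorem isGreatest_simplifiedPrimalValues (hΔ : IsTraceAnnihilating Δ) {c : ℝ}
    (hc : IsGreatest (primalValues Δ H E) c) :
    IsGreatest (simplifiedPrimalValues Δ H E) (1 / 2 * c) := by
  refine ⟨?_, (isLUB_simplifiedPrimalValues hΔ hc.isLUB).1⟩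
  rw [mem_simplifiedPrimalValues_iff hΔ]
  convert hc.1 using 1
  ring

end PrimalProgramme

/-! ### Weak compactness of bounded sets of operators -/

section WeakLimit

variable {K : Type*} [NormedAddCommGroup K] [InnerProductSpace ℂ K] [CompleteSpace K]

/-- A bounded sesquilinear form comes from an operator. -/
theorem exists_operator_of_sesquilinear (f : K → K → ℂ)
    (h1 : ∀ x x' y, f (x + x') y = f x y + f x' y)
    (h2 : ∀ (c : ℂ) x y, f (c • x) y = starRingEnd ℂ c * f x y)
    (h3 : ∀ x y y', f x (y + y') = f x y + f x y')
    (h4 : ∀ (c : ℂ) x y, f x (c • y) = c * f x y) (C : ℝ)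
    (h5 : ∀ x y, ‖f x y‖ ≤ C * ‖x‖ * ‖y‖) :
    ∃ S : K →L[ℂ] K, ∀ x y, ⟪x, S y⟫_ℂ = f x y := by
  let b : K →ₗ⋆[ℂ] K →ₗ[ℂ] ℂ := LinearMap.mk₂'ₛₗ (starRingEnd ℂ) (RingHom.id ℂ) f h1 h2 h3 h4
  let b' : K →L⋆[ℂ] K →L[ℂ] ℂ := b.mkContinuous₂ C h5
  refine ⟨ContinuousLinearMap.adjoint (InnerProductSpace.continuousLinearMapOfBilin b'),
    fun x y => ?_⟩
  rw [ContinuousLinearMap.adjoint_inner_right,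
    InnerProductSpace.continuousLinearMapOfBilin_apply]
  rfl

theorem exists_tendsto_of_norm_le (u : Ultrafilter ℕ) {f : ℕ → ℂ} {C : ℝ}
    (hf : ∀ n, ‖f n‖ ≤ C) : ∃ z, ‖z‖ ≤ C ∧ Tendsto f u (𝓝 z) := by
  have h := (isCompact_closedBall (0 : ℂ) C).ultrafilter_le_nhds (u.map f) (by
    rw [Ultrafilter.coe_map, le_principal_iff, Filter.mem_map]
    exact univ_mem' fun n => mem_closedBall_zero_iff.2 (hf n))
  obtain ⟨z, hz, hz'⟩ := h
  exact ⟨z, mem_closedBall_zero_iff.1 hz, hz'⟩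

/-- Bounded sets of operators are compact for the weak operator topology. -/
theorem exists_weak_limit (u : Ultrafilter ℕ) {T : ℕ → K →L[ℂ] K} {C : ℝ} (hT : ∀ n, ‖T n‖ ≤ C) :
    ∃ S : K →L[ℂ] K, ∀ x y, Tendsto (fun n => ⟪x, T n y⟫_ℂ) u (𝓝 ⟪x, S y⟫_ℂ) := by
  have hb : ∀ x y n, ‖⟪x, T n y⟫_ℂ‖ ≤ C * ‖x‖ * ‖y‖ := fun x y n => by
    refine (norm_inner_le_norm _ _).trans ?_
    calc ‖x‖ * ‖T n y‖ ≤ ‖x‖ * (C * ‖y‖) := by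
          gcongr
          exact (T n).le_of_opNorm_le (hT n) y
      _ = C * ‖x‖ * ‖y‖ := by ring
  -- Each matrix element converges along the ultrafilter without choosing subsequences; the limits
  -- form a bounded sesquilinear form.
  choose f hf hlim using fun x y => exists_tendsto_of_norm_le u (hb x y)
  obtain ⟨S, hS⟩ := exists_operator_of_sesquilinear f
    (fun x x' y => tendsto_nhds_unique (hlim _ _) (((hlim x y).add (hlim x' y)).congr fun n => by
      rw [inner_add_left]))
    (fun c x y => tendsto_nhds_unique (hlim _ _) (((hlim x y).const_mul _).congr fun n => by
      rw [inner_smul_left]))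
    (fun x y y' => tendsto_nhds_unique (hlim _ _) (((hlim x y).add (hlim x y')).congr fun n => by
      rw [map_add, inner_add_right]))
    (fun c x y => tendsto_nhds_unique (hlim _ _) (((hlim x y).const_mul c).congr fun n => by
      rw [map_smul, inner_smul_right])) C hf
  exact ⟨S, fun x y => by rw [hS]; exact hlim x y⟩

/-- The limits of `tr (T X n)` along `u` define a functional of `T` with the same bound on positive
operators. By `tendsto_expansion` it is determined by rank one operators, where weak convergence
identifies it with `T ↦ tr (T Y)`. -/
theorem tendsto_trace_mul_of_weak (u : Ultrafilter ℕ) {X : ℕ → K →L[ℂ] K} {C : ℝ}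
    (hX : ∀ n, ‖X n‖ ≤ C) {Y : K →L[ℂ] K}
    (hY : ∀ x y, Tendsto (fun n => ⟪x, X n y⟫_ℂ) u (𝓝 ⟪x, Y y⟫_ℂ)) (T : TraceClass K) :
    Tendsto (fun n => trace ((T : K →L[ℂ] K) * X n)) u
      (𝓝 (trace ((T : K →L[ℂ] K) * Y))) := by
  have hb : ∀ (T : TraceClass K) n, ‖traceMulL (X n) T‖ ≤
      C * (traceNorm (T : K →L[ℂ] K)).toReal := fun T n =>
    (norm_trace_mul_le T.2 _).trans (mul_le_mul_of_nonneg_right (hX n) ENNReal.toReal_nonneg)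
  choose f hf hlim using fun T => exists_tendsto_of_norm_le u (hb T)
  let φ : TraceClass K →ₗ[ℂ] ℂ :=
    { toFun := f
      map_add' := fun S T => tendsto_nhds_unique (hlim _) (((hlim S).add (hlim T)).congr fun n => by
        rw [map_add])
      map_smul' := fun c T => tendsto_nhds_unique (hlim _) (((hlim T).const_mul c).congr fun n => by
        rw [map_smul, smul_eq_mul]) }
  have h1 := tendsto_expansion (stdBasis K) φ C (fun T hT => by
    have := hf T
    rwa [← Complex.ofReal_re (traceNorm _).toReal, ← trace_of_nonneg hT] at this) T
  have h2 := tendsto_expansion (stdBasis K) (traceMulL Y) ‖Y‖ (norm_traceMulL_le Y) T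
  have h3 : ∀ x y, φ (ketBra x y) = traceMulL Y (ketBra x y) := fun x y =>
    tendsto_nhds_unique (hlim _) (by
      simp only [traceMulL_apply, trace_ketBra_mul]
      exact hY y x)
  simp only [h3] at h1
  have h4 := tendsto_nhds_unique h1 h2
  rw [← traceMulL_apply, ← h4]
  exact hlim T

theorem hasSum_trace_of_basis {κ : Type*} (b : HilbertBasis κ ℂ K) (T : TraceClass K) :
    HasSum (fun k => ⟪b k, (T : K →L[ℂ] K) (b k)⟫_ℂ) (trace (T : K →L[ℂ] K)) := by
  classical
  have h := tendsto_trace_mul b T 1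
  rw [mul_one] at h
  refine h.congr fun F => Finset.sum_congr rfl fun k hk => ?_
  rw [Finset.sum_eq_single k]
  · rw [one_apply_eq_self, orthonormal_iff_ite.1 b.orthonormal, if_pos rfl, mul_one]
  · intro l _ hl
    rw [one_apply_eq_self, orthonormal_iff_ite.1 b.orthonormal, if_neg hl, mul_zero]
  · exact fun h => (h hk).elim

end WeakLimit

/-! ### Attainment of the primal supremum for discrete Hamiltonians -/

section Attained

variable {A B : Type*} [NormedAddCommGroup A] [InnerProductSpace ℂ A] [CompleteSpace A]
  [NormedAddCommGroup B] [InnerProductSpace ℂ B] [CompleteSpace B] {ι : Type*}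
  {Δ : TraceClass A →ₗ[ℂ] TraceClass B} {H : Hamiltonian ι A} {E : ℝ}

theorem IsState.norm_le_one {ρ : A →L[ℂ] A} (h : IsState ρ) : ‖ρ‖ ≤ 1 := by
  simpa [h.trace_eq_one] using norm_le_trace h.nonneg h.mem_traceClass

theorem one_sub_oneTensor_nonneg (b : HilbertBasis ι ℂ A) {ρ : A →L[ℂ] A} (h : 0 ≤ 1 - ρ) :
    0 ≤ 1 - oneTensor B ρ := by
  refine nonneg_of_posOn b fun F => ((scalarPosOn_of_nonneg h b F).posOn (K := B)).congr
    fun k _ l _ => ?_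
  rw [slice_sub, slice_oneTensor, sub_apply, one_apply_eq_self, inner_sub_right, sub_smul]
  congr 1
  ext y
  refine ext_inner_left ℂ fun x => ?_
  rw [inner_slice, one_apply_eq_self, inner_tmulRight, smul_apply, inner_smul_right,
    one_apply_eq_self, mul_comm]

/-- A state satisfies `ρ ≤ 1`, so `V` lies between `-1` and `1`; this supplies the uniform bound for
weak compactness. -/
theorem IsFeasible.norm_le_one {ρ : A →L[ℂ] A} {V : HTensor B A →L[ℂ] HTensor B A}
    (H : Hamiltonian ι A) (h : IsFeasible H E ρ V) : ‖V‖ ≤ 1 := by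
  have h1 : 0 ≤ 1 - ρ := by
    rw [sub_nonneg]
    exact (CStarAlgebra.norm_le_one_iff_of_nonneg ρ h.1.nonneg).1 h.1.norm_le_one
  have h2 := one_sub_oneTensor_nonneg (B := B) H.basis h1
  refine norm_le_one_of_nonneg ?_ ?_
  · convert add_nonneg h2 (sub_nonneg.2 h.2.2.2) using 1
    abel
  · convert add_nonneg h2 (sub_nonneg.2 h.2.2.1) using 1
    abel

/-- Tightness: states of bounded energy have little weight on high levels. -/
theorem sum_diag_high_le (hE : 0 ≤ E) {ρ : A →L[ℂ] A} (h0 : 0 ≤ ρ)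
    (h : H.meanEnergy ρ ≤ ENNReal.ofReal E) {e : ℝ} (he : 0 < e) (F : Finset ι)
    (hF : ∀ k ∈ F, e ≤ H.level k) :
    ∑ k ∈ F, (⟪H.basis k, ρ (H.basis k)⟫_ℂ).re ≤ E / e := by
  rw [le_div_iff₀ he, mul_comm, Finset.mul_sum]
  refine le_trans (Finset.sum_le_sum fun k hk => ?_) (sum_level_le_of_meanEnergy_le hE h0 h F)
  exact mul_le_mul_of_nonneg_right (hF k hk) (inner_re_nonneg h0 _)

theorem one_sub_le_sum_diag (hE : 0 ≤ E) {ρ : A →L[ℂ] A} (h : IsState ρ)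
    (hen : H.meanEnergy ρ ≤ ENNReal.ofReal E) {e : ℝ} (he : 0 < e) (F : Finset ι)
    (hF : ∀ k ∉ F, e ≤ H.level k) :
    1 - E / e ≤ ∑ k ∈ F, (⟪H.basis k, ρ (H.basis k)⟫_ℂ).re := by
  classical
  have h1 := Complex.hasSum_re (hasSum_trace_of_basis H.basis ⟨ρ, h.mem_traceClass⟩)
  change HasSum _ (trace ρ).re at h1
  rw [h.trace_eq_one, Complex.one_re] at h1
  have h2 : (1 : ℝ) ≤ ∑ k ∈ F, (⟪H.basis k, ρ (H.basis k)⟫_ℂ).re + E / e := by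
    refine le_of_tendsto h1 ?_
    filter_upwards [eventually_ge_atTop F] with G hG
    rw [← Finset.sum_sdiff hG, add_comm]
    refine add_le_add le_rfl (sum_diag_high_le hE h.nonneg hen he _ fun k hk => ?_)
    exact hF k (Finset.mem_sdiff.1 hk).2
  linarith

open scoped Classical in
-- The energy bound limits the weight outside `F` to `E / e` by Markov's inequality, so the
-- truncation error is uniform over feasible points.
theorem abs_sub_truncTrace_le {M : ℝ} (hM0 : 0 ≤ M) (hM : ∀ (R : ι → ι → ℂ) (V : ι → ι → B →L[ℂ] B),
      (∀ F : Finset ι, FinFeasible H E F R V) → ∀ F G : Finset ι, G ⊆ F →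
        |(blockPairing (choi Δ H) F V).re - (blockPairing (choi Δ H) G V).re| ≤
          M * √(∑ k ∈ F \ G, (R k k).re))
    (hE : 0 ≤ E) {ρ : A →L[ℂ] A} {V : HTensor B A →L[ℂ] HTensor B A}
    (h : IsFeasible H E ρ V) {t : ℝ} (ht : HasTraceAgainstChoi Δ H V t) {e : ℝ} (he : 0 < e)
    (F : Finset ι) (hF : ∀ k ∉ F, e ≤ H.level k) :
    |t - (truncTrace Δ H V F).re| ≤ M * √(E / e) := by
  have h1 := ((Complex.continuous_re.tendsto _).comp ht).sub_const (truncTrace Δ H V F).re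
  refine le_of_tendsto h1.abs ?_
  filter_upwards [eventually_ge_atTop F] with G hG
  refine (hM _ _ (fun F => h.finFeasible hE F) G F hG).trans ?_
  refine mul_le_mul_of_nonneg_left (Real.sqrt_le_sqrt ?_) hM0
  exact sum_diag_high_le hE h.1.nonneg h.2.1 he _ fun k hk => hF k (Finset.mem_sdiff.1 hk).2

theorem nonneg_of_tendsto {u : Ultrafilter ℕ} {T : ℕ → A →L[ℂ] A} {S : A →L[ℂ] A}
    (hT : ∀ n, 0 ≤ T n)
    (h : ∀ x y, Tendsto (fun n => ⟪x, T n y⟫_ℂ) u (𝓝 ⟪x, S y⟫_ℂ)) : 0 ≤ S :=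
  nonneg_iff_inner.2 fun x => ge_of_tendsto' (h x x) fun n => nonneg_iff_inner.1 (hT n) x

theorem tendsto_slice {u : Ultrafilter ℕ} {V : ℕ → HTensor B A →L[ℂ] HTensor B A}
    {W : HTensor B A →L[ℂ] HTensor B A}
    (h : ∀ x y, Tendsto (fun n => ⟪x, V n y⟫_ℂ) u (𝓝 ⟪x, W y⟫_ℂ)) (c d : A) (x y : B) :
    Tendsto (fun n => ⟪x, slice (V n) c d y⟫_ℂ) u (𝓝 ⟪x, slice W c d y⟫_ℂ) := by
  simp only [inner_slice]
  exact h _ _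

/-- The operator inequality `0 ≤ 1 ⊗ ρ + V` survives weak limits. -/
theorem oneTensor_add_nonneg_of_tendsto (b : HilbertBasis ι ℂ A) {u : Ultrafilter ℕ}
    {T : ℕ → A →L[ℂ] A} {S : A →L[ℂ] A} {V : ℕ → HTensor B A →L[ℂ] HTensor B A}
    {W : HTensor B A →L[ℂ] HTensor B A} (hV : ∀ n, 0 ≤ oneTensor B (T n) + V n)
    (hT : ∀ x y, Tendsto (fun n => ⟪x, T n y⟫_ℂ) u (𝓝 ⟪x, S y⟫_ℂ))
    (hW : ∀ x y, Tendsto (fun n => ⟪x, V n y⟫_ℂ) u (𝓝 ⟪x, W y⟫_ℂ)) :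
    0 ≤ oneTensor B S + W := by
  refine nonneg_of_posOn b fun F v => ?_
  have h : Tendsto (fun n => ∑ k ∈ F, ∑ l ∈ F,
      ⟪v k, slice (oneTensor B (T n) + V n) (b k) (b l) (v l)⟫_ℂ) u
      (𝓝 (∑ k ∈ F, ∑ l ∈ F, ⟪v k, slice (oneTensor B S + W) (b k) (b l) (v l)⟫_ℂ)) := by
    refine tendsto_finsetSum _ fun k _ => tendsto_finsetSum _ fun l _ => ?_
    simp only [slice_add, add_apply, inner_add_right, slice_oneTensor, smul_apply,
      inner_smul_right]
    exact ((hT _ _).mul_const _).add (tendsto_slice hW _ _ _ _)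
  exact ge_of_tendsto' h fun n => posOn_slice (hV n) b F v

theorem meanEnergy_le_of_tendsto (hE : 0 ≤ E) {u : Ultrafilter ℕ} {T : ℕ → A →L[ℂ] A}
    {S : A →L[ℂ] A} (hT : ∀ n, 0 ≤ T n) (hen : ∀ n, H.meanEnergy (T n) ≤ ENNReal.ofReal E)
    (h : ∀ x y, Tendsto (fun n => ⟪x, T n y⟫_ℂ) u (𝓝 ⟪x, S y⟫_ℂ)) :
    H.meanEnergy S ≤ ENNReal.ofReal E := by
  have hS := nonneg_of_tendsto hT h
  unfold Hamiltonian.meanEnergy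
  rw [ENNReal.tsum_eq_iSup_sum]
  refine iSup_le fun s => ?_
  rw [← ENNReal.ofReal_sum_of_nonneg fun k _ =>
    mul_nonneg (H.level_nonneg k) (inner_re_nonneg hS _)]
  refine ENNReal.ofReal_le_ofReal ?_
  exact le_of_tendsto' (tendsto_finsetSum _ fun k _ =>
    ((Complex.continuous_re.tendsto _).comp (h _ _)).const_mul _)
    fun n => sum_level_le_of_meanEnergy_le hE (hT n) (hen n) s

theorem tendsto_sum_diag {u : Ultrafilter ℕ} {T : ℕ → A →L[ℂ] A} {S : A →L[ℂ] A}
    (h : ∀ x y, Tendsto (fun n => ⟪x, T n y⟫_ℂ) u (𝓝 ⟪x, S y⟫_ℂ)) {κ : Type*} (f : κ → A)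
    (s : Finset κ) : Tendsto (fun n => ∑ i ∈ s, (⟪f i, T n (f i)⟫_ℂ).re) u
      (𝓝 (∑ i ∈ s, (⟪f i, S (f i)⟫_ℂ).re)) :=
  tendsto_finsetSum _ fun _ _ => (Complex.continuous_re.tendsto _).comp (h _ _)

/-- A weak limit may lose trace in general. Here the finitely many levels up to `e` carry weight at
least `1 - E / e` in every `T n`; this finite sum passes to the limit, and `e` is then sent to
infinity. -/
theorem isState_of_tendsto (hE : 0 ≤ E) (hH : H.IsDiscrete) {u : Ultrafilter ℕ}
    {T : ℕ → A →L[ℂ] A} {S : A →L[ℂ] A} (hT : ∀ n, IsState (T n))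
    (hen : ∀ n, H.meanEnergy (T n) ≤ ENNReal.ofReal E)
    (h : ∀ x y, Tendsto (fun n => ⟪x, T n y⟫_ℂ) u (𝓝 ⟪x, S y⟫_ℂ)) : IsState S := by
  have hS := nonneg_of_tendsto (fun n => (hT n).nonneg) h
  have hle : ∀ s : Finset (StdIndex A), ∑ i ∈ s, (⟪stdBasis A i, S (stdBasis A i)⟫_ℂ).re ≤ 1 :=
    fun s => le_of_tendsto' (tendsto_sum_diag h _ s) fun n => by
      simpa [(hT n).trace_eq_one] using
        sum_inner_le_trace (hT n).nonneg (hT n).mem_traceClass (stdBasis A).orthonormal s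
  have hmem := mem_traceClass_of_nonneg hS 1 hle
  refine ⟨hS, hmem, ?_⟩
  have h1 : (trace S).re ≤ 1 :=
    le_of_tendsto' (Complex.hasSum_re (hasSum_trace hmem)) hle
  have h2 : ∀ e : ℝ, 0 < e → 1 - E / e ≤ (trace S).re := by
    intro e he
    refine le_trans ?_ (sum_inner_le_trace hS hmem H.basis.orthonormal (hH e).toFinset)
    refine ge_of_tendsto' (tendsto_sum_diag h _ _) fun n =>
      one_sub_le_sum_diag hE (hT n) (hen n) he _ fun k hk => ?_
    simp only [Set.Finite.mem_toFinset, Set.mem_ofPred_eq, not_le] at hk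
    exact hk.le
  have h3 : Tendsto (fun e : ℝ => 1 - E / e) atTop (𝓝 (1 - 0)) :=
    tendsto_const_nhds.sub (tendsto_const_nhds.div_atTop tendsto_id)
  rw [sub_zero] at h3
  have h4 : 1 ≤ (trace S).re := le_of_tendsto h3 (by
    filter_upwards [eventually_gt_atTop 0] with e he using h2 e he)
  have h5 := trace_of_nonneg hS
  rw [h5, Complex.ofReal_re] at h1 h4
  rw [h5, le_antisymm h1 h4, Complex.ofReal_one]

theorem tendsto_truncTrace {u : Ultrafilter ℕ} {V : ℕ → HTensor B A →L[ℂ] HTensor B A}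
    {W : HTensor B A →L[ℂ] HTensor B A} {C : ℝ} (hC : ∀ n, ‖V n‖ ≤ C)
    (h : ∀ x y, Tendsto (fun n => ⟪x, V n y⟫_ℂ) u (𝓝 ⟪x, W y⟫_ℂ)) (F : Finset ι) :
    Tendsto (fun n => truncTrace Δ H (V n) F) u (𝓝 (truncTrace Δ H W F)) := by
  refine tendsto_finsetSum _ fun k _ => tendsto_finsetSum _ fun l _ => ?_
  refine tendsto_trace_mul_of_weak u (C := ‖ContinuousLinearMap.adjoint
    (tmulRight B (H.basis l))‖ * (C * ‖tmulRight B (H.basis k)‖)) (fun n => ?_)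
    (fun x y => tendsto_slice h _ _ x y) _
  refine (ContinuousLinearMap.opNorm_comp_le _ _).trans ?_
  refine mul_le_mul_of_nonneg_left ((ContinuousLinearMap.opNorm_comp_le _ _).trans ?_)
    (norm_nonneg _)
  exact mul_le_mul_of_nonneg_right (hC n) (norm_nonneg _)

/-- For a discrete Hamiltonian the supremum of the primal programme is attained. -/
theorem mem_primalValues_of_isLUB (hΔ : IsHermitianPreserving Δ) (hE : 0 ≤ E) (hH : H.IsDiscrete)
    {c : ℝ} (hc : IsLUB (primalValues Δ H E) c) : c ∈ primalValues Δ H E := by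
  obtain ⟨t, -, -, htc, ht⟩ := hc.exists_seq_monotone_tendsto hc.nonempty
  choose ρ V hf htr using ht
  let u : Ultrafilter ℕ := Ultrafilter.of atTop
  have hu : (u : Filter ℕ) ≤ atTop := Ultrafilter.of_le atTop
  obtain ⟨S, hS⟩ := exists_weak_limit u fun n => (hf n).1.norm_le_one
  obtain ⟨W, hW⟩ := exists_weak_limit u fun n => (hf n).norm_le_one H
  have hfeas : IsFeasible H E S W := by
    refine ⟨isState_of_tendsto hE hH (fun n => (hf n).1) (fun n => (hf n).2.1) hS,
      meanEnergy_le_of_tendsto hE (fun n => (hf n).1.nonneg) (fun n => (hf n).2.1) hS, ?_, ?_⟩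
    · rw [neg_le_iff_add_nonneg']
      exact oneTensor_add_nonneg_of_tendsto H.basis
        (fun n => neg_le_iff_add_nonneg'.1 (hf n).2.2.1) hS hW
    · rw [← sub_nonneg, sub_eq_add_neg]
      refine oneTensor_add_nonneg_of_tendsto (V := fun n => -V n) H.basis (fun n => ?_) hS
        fun x y => ?_
      · rw [← sub_eq_add_neg, sub_nonneg]
        exact (hf n).2.2.2
      · simp only [neg_apply, inner_neg_right]
        exact (hW x y).neg
  obtain ⟨s, hs⟩ := exists_hasTraceAgainstChoi hΔ hE hfeas
  obtain ⟨M, hM0, hM⟩ := exists_tail_bound hΔ H E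
  -- Truncated objectives converge along `u`. One error term compares the maximising sequence with
  -- its truncations, the other compares the limit point with its own.
  have key : ∀ e : ℝ, 0 < e → |c - s| ≤ M * √(E / e) + M * √(E / e) := by
    intro e he
    have hF : ∀ k ∉ (hH e).toFinset, e ≤ H.level k := fun k hk => by
      simp only [Set.Finite.mem_toFinset, Set.mem_ofPred_eq, not_le] at hk
      exact hk.le
    have h1 := abs_sub_truncTrace_le hM0 hM hE hfeas hs he _ hF
    have h2 : |c - (truncTrace Δ H W (hH e).toFinset).re| ≤ M * √(E / e) := by
      refine le_of_tendsto' (((htc.mono_left hu).sub ((Complex.continuous_re.tendsto _).comp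
        (tendsto_truncTrace (fun n => (hf n).norm_le_one H) hW _))).abs) fun n => ?_
      exact abs_sub_truncTrace_le hM0 hM hE (hf n) (htr n) he _ hF
    rw [abs_sub_comm] at h1
    exact (abs_sub_le _ _ _).trans (add_le_add h2 h1)
  have h0 : Tendsto (fun e : ℝ => M * √(E / e) + M * √(E / e)) atTop (𝓝 (M * √0 + M * √0)) := by
    have h3 : Tendsto (fun e : ℝ => √(E / e)) atTop (𝓝 (√0)) :=
      (Real.continuous_sqrt.tendsto _).comp (tendsto_const_nhds.div_atTop tendsto_id)
    exact (h3.const_mul M).add (h3.const_mul M)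
  rw [Real.sqrt_zero, mul_zero, add_zero] at h0
  have h4 : |c - s| ≤ 0 := ge_of_tendsto h0 (by
    filter_upwards [eventually_gt_atTop 0] with e he using key e he)
  have h5 : c = s := by
    have := abs_nonpos_iff.1 h4
    linarith
  exact ⟨S, W, hfeas, h5 ▸ hs⟩

end Attained

/-! ### Weak duality -/

section WeakDuality

variable {A B : Type*} [NormedAddCommGroup A] [InnerProductSpace ℂ A] [CompleteSpace A]
  [NormedAddCommGroup B] [InnerProductSpace ℂ B] [CompleteSpace B] {ι : Type*}
  {Δ : TraceClass A →ₗ[ℂ] TraceClass B} {H : Hamiltonian ι A} {E : ℝ}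

/-- The bound of the simplified finite programmes, in homogeneous form. -/
theorem re_blockPairing_le_half_mul (hΔ : IsTraceAnnihilating Δ) {c : ℝ}
    (hc : c ∈ upperBounds (finValues Δ H E)) (hE : 0 ≤ E) {F : Finset ι} {R : ι → ι → ℂ}
    {W : ι → ι → B →L[ℂ] B} (hR : ScalarPosOn F R) (hW : PosOn F W)
    (hRW : PosOn F fun k l => R k l • (1 : B →L[ℂ] B) - W k l) {t : ℝ} (ht : 0 ≤ t)
    (htr : ∑ k ∈ F, (R k k).re ≤ t) (hen : ∑ k ∈ F, H.level k * (R k k).re ≤ t * E) :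
    (blockPairing (choi Δ H) F W).re ≤ 1 / 2 * c * t := by
  -- The point is normalised by `t + s` rather than by `t`, which covers `t = 0`; afterwards `s`
  -- tends to zero.
  have key : ∀ s : ℝ, 0 < s → (blockPairing (choi Δ H) F W).re ≤ 1 / 2 * c * (t + s) := by
    intro s hs
    have hr : 0 < t + s := by linarith
    have hr' : 0 ≤ (t + s)⁻¹ := (inv_pos.2 hr).le
    have hfeas : FinFeasible H E F (fun k l => (((t + s)⁻¹ : ℝ) : ℂ) * R k l)
        (fun k l => (((t + s)⁻¹ : ℝ) : ℂ) • ((2 : ℂ) • W k l - R k l • (1 : B →L[ℂ] B))) := by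
      refine ⟨hR.smul hr', ?_, ?_, ?_, ?_⟩
      · refine ((hRW.smul zero_le_two).smul hr').congr fun k _ l _ => ?_
        push_cast
        module
      · refine ((hW.smul zero_le_two).smul hr').congr fun k _ l _ => ?_
        push_cast
        module
      · simp only [Complex.re_ofReal_mul, ← Finset.mul_sum]
        rw [inv_mul_le_iff₀ hr]
        linarith
      · have e : ∑ k ∈ F, H.level k * ((((t + s)⁻¹ : ℝ) : ℂ) * R k k).re =
            (t + s)⁻¹ * ∑ k ∈ F, H.level k * (R k k).re := by
          simp only [Complex.re_ofReal_mul, Finset.mul_sum]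
          exact Finset.sum_congr rfl fun k _ => by ring
        rw [e, inv_mul_le_iff₀ hr]
        nlinarith [mul_nonneg hs.le hE]
    have h1 := hc ⟨F, _, _, hfeas, rfl⟩
    rw [blockPairing_smul, blockPairing_sub, blockPairing_smul, blockPairing_choi_scalar, hΔ,
      sub_zero, Complex.re_ofReal_mul, inv_mul_le_iff₀ hr] at h1
    have h2 : ((2 : ℂ) * blockPairing (choi Δ H) F W).re = 2 * (blockPairing (choi Δ H) F W).re := by
      simp
    rw [h2] at h1
    linarith
  have hlim : Tendsto (fun s : ℝ => 1 / 2 * c * (t + s)) (𝓝[>] 0) (𝓝 (1 / 2 * c * (t + 0))) :=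
    (continuous_const.mul (continuous_const.add continuous_id)).continuousWithinAt.tendsto
  rw [add_zero] at hlim
  refine ge_of_tendsto hlim ?_
  filter_upwards [self_mem_nhdsWithin] with s hs using key s hs

/-- Weak duality. -/
theorem half_mem_lowerBounds_dualValues (hΔ : IsTraceAnnihilating Δ) {c : ℝ}
    (hc : IsLUB (finValues Δ H E) c) : 1 / 2 * c ∈ lowerBounds (dualValues Δ H E) := by
  classical
  rintro d ⟨Z, x, y, hZJ, hZ, hx, hy, hp, rfl⟩
  suffices h : c ≤ 2 * (x + y * E) by linarith
  refine hc.2 ?_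
  rintro _ ⟨F, R, V, hf, rfl⟩
  set W : ι → ι → B →L[ℂ] B := fun k l =>
    ((1 / 2 : ℝ) : ℂ) • (R k l • (1 : B →L[ℂ] B) + V k l) with hW
  have hWp : PosOn F W := hf.lower.smul (by norm_num)
  have hRW : PosOn F fun k l => R k l • (1 : B →L[ℂ] B) - W k l := by
    refine (hf.upper.smul (one_half_pos (α := ℝ)).le).congr fun k _ l _ => ?_
    simp only [hW]
    module
  have e1 : (blockPairing (choi Δ H) F V).re = 2 * (blockPairing (choi Δ H) F W).re := by
    rw [hW, blockPairing_smul, blockPairing_add, blockPairing_choi_scalar, hΔ, zero_add,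
      Complex.re_ofReal_mul]
    ring
  have e2 : (blockPairing (choi Δ H) F W).re ≤ (blockPairing Z F W).re := by
    have := blockPairing_nonneg (J := fun k l => Z k l - choi Δ H k l) (hZJ.posOn F) hWp
    rw [blockPairing_sub_left, Complex.nonneg_iff, Complex.sub_re] at this
    linarith [this.1]
  have e3 := re_blockPairing_mono (J := Z) (hZ.posOn F) hRW
  have e4 : (blockPairing Z F fun k l => R k l • (1 : B →L[ℂ] B)).re ≤
      ∑ k ∈ F, (x + y * H.level k) * (R k k).re := by
    have h1 : ∀ a : ι → ℂ, ∑ k ∈ F, ∑ l ∈ F, starRingEnd ℂ (a k) *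
        (if k = l then ((x + y * H.level k : ℝ) : ℂ) else 0) * a l =
        ((∑ k ∈ F, (x + y * H.level k) * ‖a k‖ ^ 2 : ℝ) : ℂ) := by
      intro a
      push_cast
      refine Finset.sum_congr rfl fun k hk => ?_
      rw [Finset.sum_eq_single k]
      · rw [if_pos rfl, ← Complex.conj_mul']
        ring
      · intro l _ hl; rw [if_neg hl.symm, mul_zero, zero_mul]
      · exact fun h => (h hk).elim
    -- The positive matrix `x 1 + y H - tr_B Z` is paired with `R`; this is where the partial trace
    -- constraint enters.
    have h2 := scalar_pairing_nonneg F (fun k l =>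
      (if k = l then ((x + y * H.level k : ℝ) : ℂ) else 0) - trace (Z k l : B →L[ℂ] B)) R
      (fun a => by
        simp only [mul_sub, sub_mul, Finset.sum_sub_distrib]
        rw [h1, sub_nonneg]
        exact hp F a) hf.scalar
    have h3 : ∑ k ∈ F, ∑ l ∈ F, ((if k = l then ((x + y * H.level k : ℝ) : ℂ) else 0) -
        trace (Z k l : B →L[ℂ] B)) * R l k = ∑ k ∈ F, ((x + y * H.level k : ℝ) : ℂ) * R k k -
        blockPairing Z F fun k l => R k l • (1 : B →L[ℂ] B) := by
      simp only [sub_mul, Finset.sum_sub_distrib]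
      congr 1
      · refine Finset.sum_congr rfl fun k hk => ?_
        simp [hk]
      · refine Finset.sum_congr rfl fun k _ => Finset.sum_congr rfl fun l _ => ?_
        rw [trace_mul_smul, mul_one, mul_comm]
    rw [h3, Complex.nonneg_iff, Complex.sub_re, Complex.re_sum] at h2
    simp only [Complex.re_ofReal_mul] at h2
    linarith [h2.1]
  have e5 : ∑ k ∈ F, (x + y * H.level k) * (R k k).re =
      x * ∑ k ∈ F, (R k k).re + y * ∑ k ∈ F, H.level k * (R k k).re := by
    rw [Finset.mul_sum, Finset.mul_sum, ← Finset.sum_add_distrib]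
    exact Finset.sum_congr rfl fun k _ => by ring
  have e6 := mul_le_mul_of_nonneg_left hf.trace_le hx
  have e7 := mul_le_mul_of_nonneg_left hf.energy_le hy
  linarith

end WeakDuality

/-! ### The algebraic space of finite block matrices -/

section FiniteBlocks

variable {B : Type*} [NormedAddCommGroup B] [InnerProductSpace ℂ B] [CompleteSpace B] {ι : Type*}

open scoped Classical in
theorem exists_support_subset_product {M : Type*} [Zero M] (X : ι × ι →₀ M) :
    ∃ F₀ : Finset ι, ∀ F, F₀ ⊆ F → X.support ⊆ F ×ˢ F := by
  refine ⟨X.support.image Prod.fst ∪ X.support.image Prod.snd, fun F hF p hp => ?_⟩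
  rw [Finset.mem_product]
  exact ⟨hF (Finset.mem_union_left _ (Finset.mem_image_of_mem _ hp)),
    hF (Finset.mem_union_right _ (Finset.mem_image_of_mem _ hp))⟩

theorem lsum_eq_sum_sum {S M N : Type*} [Semiring S] [AddCommMonoid M] [AddCommMonoid N]
    [Module S M] [Module S N] (f : ι × ι → M →ₗ[S] N) {X : ι × ι →₀ M} {F : Finset ι}
    (hF : X.support ⊆ F ×ˢ F) :
    Finsupp.lsum ℕ f X = ∑ k ∈ F, ∑ l ∈ F, f (k, l) (X (k, l)) := by
  rw [Finsupp.lsum_apply, Finsupp.sum_of_support_subset _ hF _ fun p _ => map_zero _,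
    Finset.sum_product]

variable (B ι) in
/-- Finite block matrices. -/
abbrev Blocks : Type _ := ι × ι →₀ (B →L[ℂ] B)

/-- The quadratic form of a finite block matrix, at `v`. -/
def blockForm (v : ι → B) : Blocks B ι →ₗ[ℂ] ℂ :=
  Finsupp.lsum ℕ fun p => (innerSL ℂ (v p.1)).toLinearMap ∘ₗ
    ((ContinuousLinearMap.apply ℂ B (v p.2)).toLinearMap : (B →L[ℂ] B) →ₗ[ℂ] B)

/-- The quadratic form of a finite matrix, at `c`. -/
def scalarForm (c : ι → ℂ) : (ι × ι →₀ ℂ) →ₗ[ℂ] ℂ :=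
  Finsupp.lsum ℕ fun p => (starRingEnd ℂ (c p.1) * c p.2) • LinearMap.id

/-- The pairing of finite block matrices with `J`. -/
def pairingL (J : ι → ι → TraceClass B) : Blocks B ι →ₗ[ℂ] ℂ :=
  Finsupp.lsum ℕ fun p => mulTraceL (J p.2 p.1)

open scoped Classical in
/-- The real part of the weighted trace of a finite matrix. -/
def weightedTrace (w : ι → ℝ) : (ι × ι →₀ ℂ) →ₗ[ℝ] ℝ :=
  Finsupp.lsum ℕ fun p => if p.1 = p.2 then w p.1 • Complex.reLm else 0

variable (B) in
/-- The block matrix `1 ⊗ R`. -/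
def scalarBlocks : (ι × ι →₀ ℂ) →ₗ[ℂ] Blocks B ι :=
  Finsupp.mapRange.linearMap (LinearMap.toSpanSingleton ℂ (B →L[ℂ] B) 1)

theorem blockForm_single (v : ι → B) (k l : ι) (T : B →L[ℂ] B) :
    blockForm v (Finsupp.single (k, l) T) = ⟪v k, T (v l)⟫_ℂ := by
  rw [blockForm, Finsupp.lsum_single]; rfl

theorem scalarForm_single (c : ι → ℂ) (k l : ι) (z : ℂ) :
    scalarForm c (Finsupp.single (k, l) z) = starRingEnd ℂ (c k) * c l * z := by
  rw [scalarForm, Finsupp.lsum_single]; rfl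

theorem pairingL_single (J : ι → ι → TraceClass B) (k l : ι) (T : B →L[ℂ] B) :
    pairingL J (Finsupp.single (k, l) T) = trace ((J l k : B →L[ℂ] B) * T) := by
  rw [pairingL, Finsupp.lsum_single]; rfl

open scoped Classical in
theorem weightedTrace_single (w : ι → ℝ) (k l : ι) (z : ℂ) :
    weightedTrace w (Finsupp.single (k, l) z) = if k = l then w k * z.re else 0 := by
  rw [weightedTrace, Finsupp.lsum_single]
  split_ifs <;> rfl

theorem scalarBlocks_apply (R : ι × ι →₀ ℂ) (p : ι × ι) :
    scalarBlocks B R p = R p • (1 : B →L[ℂ] B) := rfl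

theorem scalarBlocks_single (p : ι × ι) (z : ℂ) :
    scalarBlocks B (Finsupp.single p z) = Finsupp.single p (z • (1 : B →L[ℂ] B)) := by
  rw [scalarBlocks, Finsupp.mapRange.linearMap_apply, Finsupp.mapRange_single]; rfl

theorem blockForm_eq_sum (v : ι → B) {X : Blocks B ι} {F : Finset ι} (hF : X.support ⊆ F ×ˢ F) :
    blockForm v X = ∑ k ∈ F, ∑ l ∈ F, ⟪v k, X (k, l) (v l)⟫_ℂ :=
  lsum_eq_sum_sum _ hF

theorem scalarForm_eq_sum (c : ι → ℂ) {X : ι × ι →₀ ℂ} {F : Finset ι}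
    (hF : X.support ⊆ F ×ˢ F) :
    scalarForm c X = ∑ k ∈ F, ∑ l ∈ F, starRingEnd ℂ (c k) * X (k, l) * c l := by
  rw [scalarForm, lsum_eq_sum_sum _ hF]
  refine Finset.sum_congr rfl fun k _ => Finset.sum_congr rfl fun l _ => ?_
  simp only [LinearMap.smul_apply, LinearMap.id_apply, smul_eq_mul]
  ring

theorem pairingL_eq_blockPairing (J : ι → ι → TraceClass B) {X : Blocks B ι} {F : Finset ι}
    (hF : X.support ⊆ F ×ˢ F) : pairingL J X = blockPairing J F fun k l => X (k, l) := by
  rw [pairingL, lsum_eq_sum_sum _ hF, blockPairing, Finset.sum_comm]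
  rfl

theorem weightedTrace_eq_sum (w : ι → ℝ) {X : ι × ι →₀ ℂ} {F : Finset ι}
    (hF : X.support ⊆ F ×ˢ F) : weightedTrace w X = ∑ k ∈ F, w k * (X (k, k)).re := by
  classical
  rw [weightedTrace, lsum_eq_sum_sum _ hF]
  refine Finset.sum_congr rfl fun k hk => ?_
  rw [Finset.sum_eq_single k]
  · simp
  · intro l _ hl
    simp [hl.symm]
  · exact fun h => (h hk).elim

theorem support_scalarBlocks_subset (R : ι × ι →₀ ℂ) : (scalarBlocks B R).support ⊆ R.support :=
  Finsupp.support_mapRange (hf := map_zero _)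

end FiniteBlocks

/-! ### Strong duality by the Riesz extension theorem -/

section Separation

variable {A B : Type*} [NormedAddCommGroup A] [InnerProductSpace ℂ A] [CompleteSpace A]
  [NormedAddCommGroup B] [InnerProductSpace ℂ B] [CompleteSpace B] {ι : Type*}
  {Δ : TraceClass A →ₗ[ℂ] TraceClass B} {H : Hamiltonian ι A} {E : ℝ}

/-- The cone that encodes the simplified finite programmes, with slack in all constraints. -/
def slackCone (J : ι → ι → TraceClass B) (H : Hamiltonian ι A) (E d : ℝ) :
    PointedCone ℝ (Blocks B ι × ℝ × ℝ × ℝ) where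
  -- The four coordinates relax `W ≤ 1 ⊗ R`, `tr R ≤ t`, `tr R H ≤ t E` and `tr J W ≥ d t` in turn,
  -- with `t` the homogenising variable. If `d` bounds the finite values, `(0, 0, 0, r)` lies in the
  -- cone only for `r ≥ 0`.
  carrier := {p | ∃ (t : ℝ) (W : Blocks B ι) (R : ι × ι →₀ ℂ), 0 ≤ t ∧
    (∀ v, 0 ≤ blockForm v W) ∧ (∀ c, 0 ≤ scalarForm c R) ∧
    (∀ v, 0 ≤ (blockForm v (p.1 + scalarBlocks B R - W)).re) ∧
    0 ≤ p.2.1 - weightedTrace 1 R + t ∧ 0 ≤ p.2.2.1 - weightedTrace H.level R + t * E ∧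
    0 ≤ p.2.2.2 + (pairingL J W).re - d * t}
  zero_mem' := ⟨0, 0, 0, by simp⟩
  add_mem' := by
    rintro p q ⟨t, W, R, h1, h2, h3, h4, h5, h6, h7⟩ ⟨t', W', R', k1, k2, k3, k4, k5, k6, k7⟩
    refine ⟨t + t', W + W', R + R', add_nonneg h1 k1, fun v => ?_, fun c => ?_, fun v => ?_, ?_,
      ?_, ?_⟩
    · rw [map_add]; exact add_nonneg (h2 v) (k2 v)
    · rw [map_add]; exact add_nonneg (h3 c) (k3 c)
    · refine (add_nonneg (h4 v) (k4 v)).trans_eq ?_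
      rw [← Complex.add_re, ← map_add]
      congr 2
      rw [map_add, Prod.fst_add]
      abel
    · rw [map_add, Prod.snd_add, Prod.fst_add]; linarith
    · rw [map_add, Prod.snd_add, Prod.snd_add, Prod.fst_add]; linarith
    · rw [map_add, Prod.snd_add, Prod.snd_add, Prod.snd_add, Complex.add_re]; linarith
  smul_mem' := by
    rintro ⟨r, hr⟩ p ⟨t, W, R, h1, h2, h3, h4, h5, h6, h7⟩
    have hr' : (0 : ℂ) ≤ r := Complex.zero_le_real.2 hr
    refine ⟨r * t, (r : ℂ) • W, (r : ℂ) • R, mul_nonneg hr h1, fun v => ?_, fun c => ?_,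
      fun v => ?_, ?_, ?_, ?_⟩
    · rw [map_smul]; exact mul_nonneg hr' (h2 v)
    · rw [map_smul]; exact mul_nonneg hr' (h3 c)
    · refine (mul_nonneg hr (h4 v)).trans_eq ?_
      rw [← Complex.re_ofReal_mul, ← smul_eq_mul, ← map_smul]
      congr 2
      rw [smul_sub, smul_add, map_smul, Complex.coe_smul]
      rfl
    · have := mul_nonneg hr h5
      rw [Complex.coe_smul, map_smul]
      change 0 ≤ r * p.2.1 - r * _ + _
      linarith
    · have := mul_nonneg hr h6
      rw [Complex.coe_smul, map_smul]
      change 0 ≤ r * p.2.2.1 - r * _ + _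
      linarith
    · have := mul_nonneg hr h7
      rw [map_smul, smul_eq_mul, Complex.re_ofReal_mul]
      change 0 ≤ r * p.2.2.2 + _ - _
      linarith

/-- The real cone only controls real parts of forms; the imaginary part of the slack vanishes
because the forms of `1 ⊗ R` and `W` are real. -/
theorem re_pairingL_le (hΔ : IsTraceAnnihilating Δ) {c : ℝ}
    (hc : c ∈ upperBounds (finValues Δ H E)) (hE : 0 ≤ E) {t : ℝ} (ht : 0 ≤ t)
    {W : Blocks B ι} {R : ι × ι →₀ ℂ} (hW : ∀ v, 0 ≤ blockForm v W)
    (hR : ∀ c, 0 ≤ scalarForm c R) (hRW : ∀ v, 0 ≤ (blockForm v (scalarBlocks B R - W)).re)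
    (htr : weightedTrace 1 R ≤ t) (hen : weightedTrace H.level R ≤ t * E) :
    (pairingL (choi Δ H) W).re ≤ 1 / 2 * c * t := by
  classical
  obtain ⟨F₁, h1⟩ := exists_support_subset_product W
  obtain ⟨F₂, h2⟩ := exists_support_subset_product R
  set F := F₁ ∪ F₂
  have hWF := h1 F Finset.subset_union_left
  have hRF := h2 F Finset.subset_union_right
  have hR' : ScalarPosOn F fun k l => R (k, l) := fun c => by
    rw [← scalarForm_eq_sum c hRF]; exact hR c
  have hW' : PosOn F fun k l => W (k, l) := fun v => by
    rw [← blockForm_eq_sum v hWF]; exact hW v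
  rw [pairingL_eq_blockPairing _ hWF]
  refine re_blockPairing_le_half_mul hΔ hc hE hR' hW' (fun v => ?_) ht ?_ ?_
  · have hsF : (scalarBlocks B R).support ⊆ F ×ˢ F := (support_scalarBlocks_subset R).trans hRF
    have e : ∑ k ∈ F, ∑ l ∈ F, ⟪v k, (R (k, l) • (1 : B →L[ℂ] B) - W (k, l)) (v l)⟫_ℂ =
        blockForm v (scalarBlocks B R) - blockForm v W := by
      rw [blockForm_eq_sum v hsF, blockForm_eq_sum v hWF, ← Finset.sum_sub_distrib]
      refine Finset.sum_congr rfl fun k _ => ?_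
      rw [← Finset.sum_sub_distrib]
      exact Finset.sum_congr rfl fun l _ => by
        rw [sub_apply, inner_sub_right, scalarBlocks_apply]
    have h3 : 0 ≤ blockForm v (scalarBlocks B R) := by
      rw [blockForm_eq_sum v hsF]
      exact hR'.posOn v
    rw [e, Complex.nonneg_iff]
    refine ⟨by rw [← map_sub]; exact hRW v, ?_⟩
    rw [Complex.sub_im, ← (Complex.nonneg_iff.1 h3).2, ← (Complex.nonneg_iff.1 (hW v)).2, sub_zero]
  · rw [weightedTrace_eq_sum _ hRF] at htr
    simpa using htr
  · rwa [weightedTrace_eq_sum _ hRF] at hen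

/-- Every finite block matrix is dominated by a multiple of an identity. -/
theorem exists_dominating (X : Blocks B ι) : ∃ R : ι × ι →₀ ℂ, (∀ c, 0 ≤ scalarForm c R) ∧
    ∀ v, 0 ≤ (blockForm v (X + scalarBlocks B R)).re := by
  classical
  obtain ⟨F, hF⟩ := exists_support_subset_product X
  have hXF := hF F subset_rfl
  set M : ℝ := ∑ k ∈ F, ∑ l ∈ F, ‖X (k, l)‖ with hM
  have hM0 : 0 ≤ M := Finset.sum_nonneg fun _ _ => Finset.sum_nonneg fun _ _ => norm_nonneg _
  refine ⟨∑ k ∈ F, Finsupp.single (k, k) (M : ℂ), fun c => ?_, fun v => ?_⟩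
  · rw [map_sum]
    refine Finset.sum_nonneg fun k _ => ?_
    rw [scalarForm_single, Complex.conj_mul']
    exact mul_nonneg (by exact_mod_cast sq_nonneg ‖c k‖) (Complex.zero_le_real.2 hM0)
  · have e1 : (blockForm v (scalarBlocks B (∑ k ∈ F, Finsupp.single (k, k) (M : ℂ)))).re =
        M * ∑ k ∈ F, ‖v k‖ ^ 2 := by
      simp only [map_sum, scalarBlocks_single, blockForm_single, smul_apply, inner_smul_right,
        one_apply_eq_self, Complex.re_sum, Complex.re_ofReal_mul, Finset.mul_sum]
      exact Finset.sum_congr rfl fun k _ => by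
        congr 1
        exact inner_self_eq_norm_sq (𝕜 := ℂ) _
    have e2 : ‖blockForm v X‖ ≤ M * ∑ k ∈ F, ‖v k‖ ^ 2 := by
      rw [blockForm_eq_sum v hXF, hM, Finset.sum_mul]
      refine norm_sum_le_of_le _ fun k hk => ?_
      rw [Finset.sum_mul]
      refine norm_sum_le_of_le _ fun l hl => ?_
      have h1 := Finset.single_le_sum (f := fun k => ‖v k‖ ^ 2) (fun _ _ => sq_nonneg _) hk
      have h2 := Finset.single_le_sum (f := fun k => ‖v k‖ ^ 2) (fun _ _ => sq_nonneg _) hl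
      calc ‖⟪v k, X (k, l) (v l)⟫_ℂ‖ ≤ ‖v k‖ * ‖X (k, l) (v l)‖ := norm_inner_le_norm _ _
        _ ≤ ‖v k‖ * (‖X (k, l)‖ * ‖v l‖) := by gcongr; exact (X (k, l)).le_opNorm _
        _ = ‖X (k, l)‖ * (‖v k‖ * ‖v l‖) := by ring
        _ ≤ ‖X (k, l)‖ * ∑ k ∈ F, ‖v k‖ ^ 2 := by
          gcongr
          nlinarith [sq_nonneg (‖v k‖ - ‖v l‖)]
    rw [map_add, Complex.add_re, e1]
    have := (abs_le.1 (Complex.abs_re_le_norm (blockForm v X))).1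
    linarith

/-- A dual solution as a linear functional on finite block matrices. -/
theorem exists_dual_functional (hΔ : IsTraceAnnihilating Δ) {c : ℝ}
    (hc : c ∈ upperBounds (finValues Δ H E)) (hE : 0 < E) :
    ∃ (ω : Blocks B ι →ₗ[ℂ] ℂ) (x y : ℝ), 0 ≤ x ∧ 0 ≤ y ∧ x + y * E ≤ 1 / 2 * c ∧
      (∀ X, (∀ v, 0 ≤ (blockForm v X).re) → 0 ≤ (ω X).re) ∧
      (∀ W, (∀ v, 0 ≤ blockForm v W) → (pairingL (choi Δ H) W).re ≤ (ω W).re) ∧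
      ∀ R, (∀ a, 0 ≤ scalarForm a R) →
        (ω (scalarBlocks B R)).re ≤ x * weightedTrace 1 R + y * weightedTrace H.level R := by
  set d : ℝ := 1 / 2 * c
  set e : Blocks B ι × ℝ × ℝ × ℝ := (0, 0, 0, 1) with he
  have he0 : e ≠ 0 := fun h => one_ne_zero (congrArg (fun p => p.2.2.2) h)
  -- The functional `r • e ↦ r` is nonnegative on the cone by the primal bound, and every vector
  -- enters the cone after adding a multiple of `e`. These are the two hypotheses of the extension
  -- theorem.
  obtain ⟨g, hg1, hg2⟩ := riesz_extension (slackCone (choi Δ H) H E d)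
    (LinearPMap.mkSpanSingleton e (1 : ℝ) he0) (by
      rintro ⟨p, hp⟩ ⟨t, W, R, h1, h2, h3, h4, h5, h6, h7⟩
      obtain ⟨r, rfl⟩ := Submodule.mem_span_singleton.1 hp
      rw [LinearPMap.mkSpanSingleton'_apply]
      have e1 : (r • e).1 = 0 := smul_zero r
      have e2 : (r • e).2.1 = 0 := smul_zero r
      have e3 : (r • e).2.2.1 = 0 := smul_zero r
      have e4 : (r • e).2.2.2 = r := mul_one r
      simp only [e1, e2, e3, e4, zero_add, zero_sub] at h4 h5 h6 h7
      have : (pairingL (choi Δ H) W).re ≤ d * t :=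
        re_pairingL_le hΔ hc hE.le h1 h2 h3 h4 (by linarith) (by linarith)
      simp only [smul_eq_mul, mul_one, RingHom.id_apply]
      linarith) (by
      rintro ⟨X, a, b, r⟩
      obtain ⟨R, hR1, hR2⟩ := exists_dominating X
      -- Large enough that `t` and `t E` absorb the deficits in the trace and energy constraints;
      -- this uses `E > 0`.
      set t : ℝ := |weightedTrace 1 R - a| + |weightedTrace H.level R - b| / E with ht
      have ht1 : |weightedTrace 1 R - a| ≤ t := le_add_of_nonneg_right (by positivity)
      have ht2 : |weightedTrace H.level R - b| ≤ t * E := by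
        rw [← div_le_iff₀ hE]
        exact le_add_of_nonneg_left (abs_nonneg _)
      refine ⟨⟨(d * t - r) • e, Submodule.mem_span_singleton.2 ⟨_, rfl⟩⟩, t, 0, R, by positivity,
        fun v => by rw [map_zero], hR1, fun v => ?_, ?_, ?_, ?_⟩
      · have : ((d * t - r) • e + (X, a, b, r)).1 = X := by simp [he]
        simp only [this, sub_zero]
        exact hR2 v
      · have : ((d * t - r) • e + (X, a, b, r)).2.1 = a := by simp [he]
        simp only [this]
        linarith [le_abs_self (weightedTrace 1 R - a)]
      · have : ((d * t - r) • e + (X, a, b, r)).2.2.1 = b := by simp [he]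
        simp only [this]
        linarith [le_abs_self (weightedTrace H.level R - b)]
      · have : ((d * t - r) • e + (X, a, b, r)).2.2.2 = d * t := by simp [he]
        simp only [this, map_zero]
        simp)
  have hge : g e = 1 := (hg1 ⟨e, Submodule.mem_span_singleton_self e⟩).trans
    (LinearPMap.mkSpanSingleton'_apply_self _ _ _ _)
  set ω₀ : Blocks B ι →ₗ[ℝ] ℝ := g ∘ₗ LinearMap.inl ℝ (Blocks B ι) (ℝ × ℝ × ℝ) with hω₀
  set x : ℝ := g (0, 1, 0, 0) with hx
  set y : ℝ := g (0, 0, 1, 0) with hy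
  have hsplit : ∀ X a b r, g (X, a, b, r) = ω₀ X + x * a + y * b + r := by
    intro X a b r
    have : ((X, a, b, r) : Blocks B ι × ℝ × ℝ × ℝ) =
        (X, 0) + a • (0, 1, 0, 0) + b • (0, 0, 1, 0) + r • e := by simp [he]
    rw [this, map_add, map_add, map_add, map_smul, map_smul, map_smul, hge]
    simp only [smul_eq_mul, hω₀, LinearMap.comp_apply, LinearMap.inl_apply]
    ring
  have hω : ∀ X, ((Module.Dual.extendRCLike ω₀ : Module.Dual ℂ (Blocks B ι)) X).re = ω₀ X :=
    fun X => Module.Dual.re_extendRCLike_apply (𝕜 := ℂ) ω₀ X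
  refine ⟨Module.Dual.extendRCLike ω₀, x, y, ?_, ?_, ?_, fun X hX => ?_, fun W hW => ?_,
    fun R hR => ?_⟩
  -- Each dual property is nonnegativity of `g` at one point of the cone. In particular `(0, -1, -E,
  -- d)`, with `t = 1`, gives `x + y E ≤ d`.
  · refine hg2 _ ⟨0, 0, 0, le_rfl, ?_, ?_, ?_, ?_, ?_, ?_⟩ <;> simp
  · refine hg2 _ ⟨0, 0, 0, le_rfl, ?_, ?_, ?_, ?_, ?_, ?_⟩ <;> simp
  · have := hg2 (0, -1, -E, d) ⟨1, 0, 0, zero_le_one, by simp, by simp, by simp, by simp, by simp,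
      by simp⟩
    rw [hsplit, map_zero] at this
    linarith
  · rw [hω]
    have := hg2 (X, 0, 0, 0) ⟨0, 0, 0, le_rfl, by simp, by simp, by simpa using hX, by simp,
      by simp, by simp⟩
    rw [hsplit] at this
    linarith
  · rw [hω]
    have := hg2 (W, 0, 0, -(pairingL (choi Δ H) W).re) ⟨0, W, 0, le_rfl, hW, by simp, by simp,
      by simp, by simp, by simp⟩
    rw [hsplit] at this
    linarith
  · rw [hω]
    have := hg2 (-scalarBlocks B R, weightedTrace 1 R, weightedTrace H.level R, 0)
      ⟨0, 0, R, le_rfl, by simp, hR, by simp, by simp, by simp, by simp⟩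
    rw [hsplit, map_neg] at this
    linarith

end Separation

/-! ### From the functional to the blocks of `Z` -/

section DualAttained

variable {A B : Type*} [NormedAddCommGroup A] [InnerProductSpace ℂ A] [CompleteSpace A]
  [NormedAddCommGroup B] [InnerProductSpace ℂ B] [CompleteSpace B] {ι : Type*}
  {Δ : TraceClass A →ₗ[ℂ] TraceClass B} {H : Hamiltonian ι A} {E : ℝ}
  {ω : Blocks B ι →ₗ[ℂ] ℂ} {x y : ℝ}

/-- The multiples of `W` by `±i` have forms with zero real part, so the hypothesis on `ω`, used with
both signs, makes `ω W` real. -/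
theorem functional_nonneg (hω : ∀ X, (∀ v, 0 ≤ (blockForm v X).re) → 0 ≤ (ω X).re)
    {W : Blocks B ι} (hW : ∀ v, 0 ≤ blockForm v W) : 0 ≤ ω W := by
  have h : ∀ z : ℂ, z.re = 0 → 0 ≤ (ω (z • W)).re := by
    intro z hz
    refine hω _ fun v => ?_
    rw [map_smul, smul_eq_mul, Complex.mul_re, hz, ← (Complex.nonneg_iff.1 (hW v)).2]
    simp
  have h1 := h Complex.I Complex.I_re
  have h2 := h (-Complex.I) (by simp)
  rw [map_smul, smul_eq_mul, Complex.mul_re] at h1 h2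
  simp only [Complex.neg_re, Complex.neg_im, Complex.I_re, Complex.I_im] at h1 h2
  rw [Complex.nonneg_iff]
  exact ⟨hω W fun v => (Complex.nonneg_iff.1 (hW v)).1, by linarith⟩

theorem abs_re_functional_single_le (hω : ∀ X, (∀ v, 0 ≤ (blockForm v X).re) → 0 ≤ (ω X).re)
    (hR : ∀ R, (∀ a, 0 ≤ scalarForm a R) →
      (ω (scalarBlocks B R)).re ≤ x * weightedTrace 1 R + y * weightedTrace H.level R)
    (k l : ι) (T : B →L[ℂ] B) :
    |(ω (Finsupp.single (k, l) T)).re| ≤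
      ((x + y * H.level k) + (x + y * H.level l)) * ‖T‖ := by
  -- The block matrix `1 ⊗ R` dominates the single block `T` with either sign, and `ω (1 ⊗ R)` is
  -- bounded by the weighted traces.
  set R : ι × ι →₀ ℂ := Finsupp.single (k, k) (‖T‖ : ℂ) + Finsupp.single (l, l) (‖T‖ : ℂ) with hRdef
  have hpos : ∀ a, 0 ≤ scalarForm a R := by
    intro a
    have h : ∀ i, 0 ≤ scalarForm a (Finsupp.single (i, i) (‖T‖ : ℂ)) := fun i => by
      rw [scalarForm_single, Complex.conj_mul']
      exact_mod_cast mul_nonneg (sq_nonneg ‖a i‖) (norm_nonneg T)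
    rw [map_add]
    exact add_nonneg (h k) (h l)
  have hle := hR R hpos
  simp only [hRdef, map_add, weightedTrace_single, if_true, Complex.ofReal_re, Pi.one_apply,
    one_mul] at hle
  have hform : ∀ v, (blockForm v (scalarBlocks B R)).re = ‖T‖ * (‖v k‖ ^ 2 + ‖v l‖ ^ 2) := by
    intro v
    have h : ∀ i, (⟪v i, v i⟫_ℂ).re = ‖v i‖ ^ 2 := fun i => inner_self_eq_norm_sq (𝕜 := ℂ) _
    simp only [hRdef, map_add, scalarBlocks_single, blockForm_single, smul_apply,
      inner_smul_right, one_apply_eq_self, Complex.add_re, Complex.re_ofReal_mul, h]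
    ring
  have hT : ∀ v, |(blockForm v (Finsupp.single (k, l) T)).re| ≤
      ‖T‖ * (‖v k‖ ^ 2 + ‖v l‖ ^ 2) := by
    intro v
    rw [blockForm_single]
    refine (Complex.abs_re_le_norm _).trans ?_
    calc ‖⟪v k, T (v l)⟫_ℂ‖ ≤ ‖v k‖ * ‖T (v l)‖ := norm_inner_le_norm _ _
      _ ≤ ‖v k‖ * (‖T‖ * ‖v l‖) := by gcongr; exact T.le_opNorm _
      _ = ‖T‖ * (‖v k‖ * ‖v l‖) := by ring
      _ ≤ _ := by
        gcongr
        nlinarith [sq_nonneg (‖v k‖ - ‖v l‖), sq_nonneg (‖v k‖), sq_nonneg (‖v l‖)]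
  have h1 := hω (scalarBlocks B R - Finsupp.single (k, l) T) fun v => by
    rw [map_sub, Complex.sub_re, hform]
    linarith [(abs_le.1 (hT v)).2]
  have h2 := hω (scalarBlocks B R + Finsupp.single (k, l) T) fun v => by
    rw [map_add, Complex.add_re, hform]
    linarith [(abs_le.1 (hT v)).1]
  rw [map_sub, Complex.sub_re] at h1
  rw [map_add, Complex.add_re] at h2
  simp only [hRdef, map_add] at h1 h2
  rw [abs_le]
  constructor <;> linarith

theorem norm_functional_single_le (hω : ∀ X, (∀ v, 0 ≤ (blockForm v X).re) → 0 ≤ (ω X).re)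
    (hR : ∀ R, (∀ a, 0 ≤ scalarForm a R) →
      (ω (scalarBlocks B R)).re ≤ x * weightedTrace 1 R + y * weightedTrace H.level R)
    (k l : ι) (T : B →L[ℂ] B) :
    ‖ω (Finsupp.single (k, l) T)‖ ≤
      2 * ((x + y * H.level k) + (x + y * H.level l)) * ‖T‖ := by
  have h1 := abs_re_functional_single_le hω hR k l T
  have h2 := abs_re_functional_single_le hω hR k l (Complex.I • T)
  rw [← Finsupp.smul_single, map_smul, norm_smul, Complex.norm_I, one_mul, smul_eq_mul,
    Complex.I_mul_re, abs_neg] at h2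
  refine (Complex.norm_le_abs_re_add_abs_im _).trans ?_
  linarith

/-- The block matrix `T ⊗ |c⟩⟨c|`, with the conventions of transposed indices. -/
def gramBlocks (s : Finset ι) (c : ι → ℂ) : (B →L[ℂ] B) →ₗ[ℂ] Blocks B ι :=
  ∑ k ∈ s, ∑ l ∈ s, (starRingEnd ℂ (c k) * c l) • Finsupp.lsingle (l, k)

theorem gramBlocks_apply (s : Finset ι) (c : ι → ℂ) (T : B →L[ℂ] B) :
    gramBlocks s c T =
      ∑ k ∈ s, ∑ l ∈ s, (starRingEnd ℂ (c k) * c l) • Finsupp.single (l, k) T := by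
  simp only [gramBlocks, LinearMap.sum_apply, LinearMap.smul_apply, Finsupp.lsingle_apply]

theorem blockForm_gramBlocks_nonneg (s : Finset ι) (c : ι → ℂ) {T : B →L[ℂ] B} (hT : 0 ≤ T)
    (v : ι → B) : 0 ≤ blockForm v (gramBlocks s c T) := by
  refine (nonneg_iff_inner.1 hT (∑ k ∈ s, starRingEnd ℂ (c k) • v k)).trans_eq ?_
  simp only [gramBlocks_apply, map_sum, map_smul, blockForm_single, smul_eq_mul, sum_inner,
    inner_sum, inner_smul_left, inner_smul_right, Complex.conj_conj, Finset.mul_sum]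
  refine Finset.sum_congr rfl fun k _ => Finset.sum_congr rfl fun l _ => ?_
  ring

theorem re_functional_gramBlocks_one_le
    (hR : ∀ R, (∀ a, 0 ≤ scalarForm a R) →
      (ω (scalarBlocks B R)).re ≤ x * weightedTrace 1 R + y * weightedTrace H.level R)
    (s : Finset ι) (c : ι → ℂ) :
    (ω (gramBlocks s c 1)).re ≤ ∑ k ∈ s, (x + y * H.level k) * ‖c k‖ ^ 2 := by
  classical
  set R : ι × ι →₀ ℂ :=
    ∑ k ∈ s, ∑ l ∈ s, Finsupp.single (l, k) (starRingEnd ℂ (c k) * c l) with hRdef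
  have e1 : gramBlocks s c (1 : B →L[ℂ] B) = scalarBlocks B R := by
    simp only [gramBlocks_apply, hRdef, map_sum, scalarBlocks_single, Finsupp.smul_single]
  have hpos : ∀ a, 0 ≤ scalarForm a R := by
    intro a
    have e : scalarForm a R = starRingEnd ℂ (∑ k ∈ s, c k * starRingEnd ℂ (a k)) *
        ∑ k ∈ s, c k * starRingEnd ℂ (a k) := by
      simp only [hRdef, map_sum, scalarForm_single, map_mul, Complex.conj_conj, Finset.sum_mul_sum]
      exact Finset.sum_congr rfl fun k _ => Finset.sum_congr rfl fun l _ => by ring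
    rw [e, Complex.conj_mul']
    exact_mod_cast sq_nonneg ‖_‖
  have hw : ∀ w : ι → ℝ, weightedTrace w R = ∑ k ∈ s, w k * ‖c k‖ ^ 2 := by
    intro w
    simp only [hRdef, map_sum, weightedTrace_single]
    refine Finset.sum_congr rfl fun k hk => ?_
    rw [Finset.sum_ite_eq' s k, if_pos hk, Complex.conj_mul', ← Complex.ofReal_pow,
      Complex.ofReal_re]
  rw [e1]
  refine (hR R hpos).trans_eq ?_
  rw [hw, hw, Finset.mul_sum, Finset.mul_sum, ← Finset.sum_add_distrib]
  exact Finset.sum_congr rfl fun k _ => by rw [Pi.one_apply]; ring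

theorem one_sub_sum_ketBra_nonneg {α : Type*} {e : α → B} (he : Orthonormal ℂ e) (S : Finset α) :
    0 ≤ 1 - ∑ i ∈ S, (ketBra (e i) (e i) : B →L[ℂ] B) := by
  rw [nonneg_iff_inner]
  intro u
  have h1 := he.sum_inner_products_le u (s := S)
  have h2 : ⟪u, (1 - ∑ i ∈ S, (ketBra (e i) (e i) : B →L[ℂ] B)) u⟫_ℂ =
      ((‖u‖ ^ 2 - ∑ i ∈ S, ‖⟪e i, u⟫_ℂ‖ ^ 2 : ℝ) : ℂ) := by
    rw [sub_apply, inner_sub_right, one_apply_eq_self, sum_apply, inner_sum]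
    push_cast
    congr 1
    · exact inner_self_eq_norm_sq_to_K u
    · refine Finset.sum_congr rfl fun i _ => ?_
      rw [ketBra_apply, inner_smul_right, ← inner_conj_symm u (e i), Complex.mul_conj']
  rw [h2]
  exact Complex.zero_le_real.2 (sub_nonneg.2 h1)

/-- Blocks of a functional against the rank one operators. -/
theorem exists_blocks (hω : ∀ X, (∀ v, 0 ≤ (blockForm v X).re) → 0 ≤ (ω X).re)
    (hR : ∀ R, (∀ a, 0 ≤ scalarForm a R) →
      (ω (scalarBlocks B R)).re ≤ x * weightedTrace 1 R + y * weightedTrace H.level R) :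
    ∃ Z : ι → ι → B →L[ℂ] B, ∀ k l u v,
      ⟪u, Z k l v⟫_ℂ = ω (Finsupp.single (l, k) (ketBra v u : B →L[ℂ] B)) := by
  have h : ∀ k l, ∃ S : B →L[ℂ] B, ∀ u v,
      ⟪u, S v⟫_ℂ = ω (Finsupp.single (l, k) (ketBra v u : B →L[ℂ] B)) := by
    intro k l
    refine exists_operator_of_sesquilinear _ (fun u u' v => ?_) (fun c u v => ?_)
      (fun u v v' => ?_) (fun c u v => ?_)
      (2 * ((x + y * H.level l) + (x + y * H.level k))) fun u v => ?_
    · rw [ketBra_add_right, Submodule.coe_add, Finsupp.single_add, map_add]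
    · rw [ketBra_smul_right, Submodule.coe_smul, ← Finsupp.smul_single, map_smul, smul_eq_mul]
    · rw [ketBra_add_left, Submodule.coe_add, Finsupp.single_add, map_add]
    · rw [ketBra_smul_left, Submodule.coe_smul, ← Finsupp.smul_single, map_smul, smul_eq_mul]
    · refine (norm_functional_single_le hω hR l k _).trans_eq ?_
      have : ‖(ketBra v u : B →L[ℂ] B)‖ = ‖v‖ * ‖u‖ := InnerProductSpace.norm_rankOne v u
      rw [this]
      ring
  choose Z hZ using h
  exact ⟨Z, hZ⟩

/-- Partial sums of the trace are values of `ω` on finite rank projections tensored with a rank one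
matrix. Each is at most the value with the identity in place of the projection, so a part of `ω`
that vanishes on finite rank operators does no harm. -/
theorem gram_blocks_mem (hω : ∀ X, (∀ v, 0 ≤ (blockForm v X).re) → 0 ≤ (ω X).re)
    (hR : ∀ R, (∀ a, 0 ≤ scalarForm a R) →
      (ω (scalarBlocks B R)).re ≤ x * weightedTrace 1 R + y * weightedTrace H.level R)
    {Z : ι → ι → B →L[ℂ] B} (hZ : ∀ k l u v,
      ⟪u, Z k l v⟫_ℂ = ω (Finsupp.single (l, k) (ketBra v u : B →L[ℂ] B)))
    (s : Finset ι) (c : ι → ℂ) :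
    0 ≤ ∑ k ∈ s, ∑ l ∈ s, (starRingEnd ℂ (c k) * c l) • Z k l ∧
    (∑ k ∈ s, ∑ l ∈ s, (starRingEnd ℂ (c k) * c l) • Z k l) ∈ TraceClass B ∧
    (trace (∑ k ∈ s, ∑ l ∈ s, (starRingEnd ℂ (c k) * c l) • Z k l)).re ≤
      ∑ k ∈ s, (x + y * H.level k) * ‖c k‖ ^ 2 := by
  set T : B →L[ℂ] B := ∑ k ∈ s, ∑ l ∈ s, (starRingEnd ℂ (c k) * c l) • Z k l with hT
  have hin : ∀ u v, ⟪u, T v⟫_ℂ = ω (gramBlocks s c (ketBra v u : B →L[ℂ] B)) := by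
    intro u v
    simp only [hT, sum_apply, inner_sum, smul_apply, inner_smul_right, hZ, gramBlocks_apply,
      map_sum, map_smul, smul_eq_mul]
  have hT0 : 0 ≤ T := nonneg_iff_inner.2 fun u => by
    rw [hin]
    exact functional_nonneg hω (blockForm_gramBlocks_nonneg s c (ketBra_self_nonneg u))
  have hle : ∀ S : Finset (StdIndex B), ∑ i ∈ S, (⟪stdBasis B i, T (stdBasis B i)⟫_ℂ).re ≤
      ∑ k ∈ s, (x + y * H.level k) * ‖c k‖ ^ 2 := by
    intro S
    refine le_trans ?_ (re_functional_gramBlocks_one_le hR s c)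
    have h1 := functional_nonneg hω (blockForm_gramBlocks_nonneg s c
      (one_sub_sum_ketBra_nonneg (stdBasis B).orthonormal S))
    rw [map_sub, map_sub, Complex.nonneg_iff, Complex.sub_re, map_sum, map_sum,
      Complex.re_sum] at h1
    simp only [hin]
    linarith [h1.1]
  have hmem := mem_traceClass_of_nonneg hT0 _ hle
  exact ⟨hT0, hmem, le_of_tendsto' (Complex.hasSum_re (hasSum_trace hmem)) hle⟩

/-- Off-diagonal blocks are recovered by polarization from the Gram sums with coefficients `(1, 1)`
and `(1, i)`, which are already known to be trace class. -/
theorem blocks_mem_traceClass (hω : ∀ X, (∀ v, 0 ≤ (blockForm v X).re) → 0 ≤ (ω X).re)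
    (hR : ∀ R, (∀ a, 0 ≤ scalarForm a R) →
      (ω (scalarBlocks B R)).re ≤ x * weightedTrace 1 R + y * weightedTrace H.level R)
    {Z : ι → ι → B →L[ℂ] B} (hZ : ∀ k l u v,
      ⟪u, Z k l v⟫_ℂ = ω (Finsupp.single (l, k) (ketBra v u : B →L[ℂ] B))) (k l : ι) :
    Z k l ∈ TraceClass B := by
  classical
  have hmem := fun s c => (gram_blocks_mem hω hR hZ s c).2.1
  have hd : ∀ k, Z k k ∈ TraceClass B := fun k => by simpa using hmem {k} 1
  by_cases hkl : k = l
  · subst hkl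
    exact hd k
  have h1 := hmem {k, l} 1
  have h2 := hmem {k, l} (Function.update 1 l Complex.I)
  simp only [Finset.sum_pair hkl, Pi.one_apply, map_one, one_mul, one_smul] at h1
  simp only [Finset.sum_pair hkl, Function.update_self, Function.update_of_ne hkl, Pi.one_apply,
    map_one, one_mul, mul_one, one_smul, Complex.conj_I] at h2
  have h3 : Z k l = (1 / 2 : ℂ) • ((Z k k + Z k l + (Z l k + Z l l)) - (Z k k + Z l l)) -
      (Complex.I / 2) • ((Z k k + Complex.I • Z k l +
        (-Complex.I • Z l k + (-Complex.I * Complex.I) • Z l l)) - (Z k k + Z l l)) := by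
    have hI : Complex.I * Complex.I = -1 := Complex.I_mul_I
    rw [neg_mul, hI, neg_neg]
    match_scalars <;> simp <;>
      first | linear_combination (1 / 2) * hI | linear_combination (-1 / 2) * hI
  rw [h3]
  have h4 := (TraceClass B).add_mem (hd k) (hd l)
  exact (TraceClass B).sub_mem ((TraceClass B).smul_mem _ ((TraceClass B).sub_mem h1 h4))
    ((TraceClass B).smul_mem _ ((TraceClass B).sub_mem h2 h4))

/-- The dual programme attains the value. -/
theorem exists_mem_dualValues_le (hΔ : IsHermitianPreserving Δ) (hTA : IsTraceAnnihilating Δ)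
    {c : ℝ} (hc : c ∈ upperBounds (finValues Δ H E)) (hE : 0 < E) :
    ∃ t ∈ dualValues Δ H E, t ≤ 1 / 2 * c := by
  obtain ⟨ω, x, y, hx, hy, hxy, hω, hJ, hR⟩ := exists_dual_functional hTA hc hE
  obtain ⟨Z, hZ⟩ := exists_blocks hω hR
  have hmem := blocks_mem_traceClass hω hR hZ
  -- The quadratic forms of `Z` and of `J` at `v` are `ω` and `pairingL` evaluated at this positive
  -- rank one block matrix, so both `Z ≥ 0` and `Z ≥ J` are tested on it.
  have hform : ∀ (s : Finset ι) (v w : ι → B), 0 ≤ blockForm w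
      (∑ k ∈ s, ∑ l ∈ s, Finsupp.single (l, k) (ketBra (v l) (v k) : B →L[ℂ] B)) := by
    intro s v w
    have e : blockForm w
        (∑ k ∈ s, ∑ l ∈ s, Finsupp.single (l, k) (ketBra (v l) (v k) : B →L[ℂ] B)) =
        (∑ k ∈ s, ⟪v k, w k⟫_ℂ) * starRingEnd ℂ (∑ k ∈ s, ⟪v k, w k⟫_ℂ) := by
      simp only [map_sum, blockForm_single, ketBra_apply, inner_smul_right, inner_conj_symm,
        Finset.sum_mul_sum]
    rw [e, Complex.mul_conj']
    exact_mod_cast sq_nonneg ‖_‖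
  have hZω : ∀ (s : Finset ι) (v : ι → B), ∑ k ∈ s, ∑ l ∈ s, ⟪v k, Z k l (v l)⟫_ℂ =
      ω (∑ k ∈ s, ∑ l ∈ s, Finsupp.single (l, k) (ketBra (v l) (v k) : B →L[ℂ] B)) := by
    intro s v
    simp only [map_sum, hZ]
  have hZpos : ∀ (s : Finset ι) (v : ι → B), 0 ≤ ∑ k ∈ s, ∑ l ∈ s, ⟪v k, Z k l (v l)⟫_ℂ :=
    fun s v => by rw [hZω]; exact functional_nonneg hω (hform s v)
  -- The functional compares real parts only, so the form of `J` must be known to be real.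
  have hJim : ∀ (s : Finset ι) (v : ι → B),
      (∑ k ∈ s, ∑ l ∈ s, ⟪v k, (choi Δ H k l : B →L[ℂ] B) (v l)⟫_ℂ).im = 0 := by
    obtain ⟨Φ, Ψ, hΦ, hΨ, rfl⟩ := hΔ
    intro s v
    have h1 := (Complex.nonneg_iff.1 (hΦ.posOn_choi H s v)).2
    have h2 := (Complex.nonneg_iff.1 (hΨ.posOn_choi H s v)).2
    simp only [choi_sub, Submodule.coe_sub, sub_apply, inner_sub_right, Finset.sum_sub_distrib,
      Complex.sub_im, ← h1, ← h2, sub_zero]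
  refine ⟨x + y * E, ⟨fun k l => ⟨Z k l, hmem k l⟩, x, y, fun s v => ?_, hZpos, hx, hy,
    fun s a => ?_, rfl⟩, hxy⟩
  · have h1 := hJ _ (hform s v)
    rw [← hZω] at h1
    have h2 : pairingL (choi Δ H)
        (∑ k ∈ s, ∑ l ∈ s, Finsupp.single (l, k) (ketBra (v l) (v k) : B →L[ℂ] B)) =
        ∑ k ∈ s, ∑ l ∈ s, ⟪v k, (choi Δ H k l : B →L[ℂ] B) (v l)⟫_ℂ := by
      simp only [map_sum, pairingL_single, trace_mul_ketBra]
    rw [h2] at h1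
    have h3 := (Complex.nonneg_iff.1 (hZpos s v)).2
    simp only [Submodule.coe_sub, sub_apply, inner_sub_right, Finset.sum_sub_distrib]
    rw [Complex.nonneg_iff, Complex.sub_re, Complex.sub_im, ← h3, hJim, sub_zero]
    exact ⟨by linarith, rfl⟩
  · obtain ⟨h1, h2, h3⟩ := gram_blocks_mem hω hR hZ s a
    have e : ∑ k ∈ s, ∑ l ∈ s, starRingEnd ℂ (a k) * trace (Z k l) * a l =
        trace (∑ k ∈ s, ∑ l ∈ s, (starRingEnd ℂ (a k) * a l) • Z k l) := by
      have : (∑ k ∈ s, ∑ l ∈ s, (starRingEnd ℂ (a k) * a l) • Z k l) =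
          ((∑ k ∈ s, ∑ l ∈ s, (starRingEnd ℂ (a k) * a l) •
            (⟨Z k l, hmem k l⟩ : TraceClass B) : TraceClass B) : B →L[ℂ] B) := by
        simp only [Submodule.coe_sum, Submodule.coe_smul]
      rw [this, ← traceL_apply]
      simp only [map_sum, map_smul, traceL_apply, smul_eq_mul]
      exact Finset.sum_congr rfl fun k _ => Finset.sum_congr rfl fun l _ => by ring
    change ∑ k ∈ s, ∑ l ∈ s, starRingEnd ℂ (a k) * trace (Z k l) * a l ≤ _
    rw [e, trace_of_nonneg h1]
    rw [trace_of_nonneg h1, Complex.ofReal_re] at h3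
    exact_mod_cast h3

theorem isLeast_dualValues (hΔ : IsHermitianPreserving Δ) (hTA : IsTraceAnnihilating Δ) {c : ℝ}
    (hc : IsLUB (finValues Δ H E) c) (hE : 0 < E) : IsLeast (dualValues Δ H E) (1 / 2 * c) := by
  have h := half_mem_lowerBounds_dualValues hTA hc
  obtain ⟨t, ht, htc⟩ := exists_mem_dualValues_le hΔ hTA hc.1 hE
  exact ⟨le_antisymm (h ht) htc ▸ ht, h⟩

end DualAttained

end

end ECDiamond

theorem mainTheorem7 {A B ι : Type*}
    [NormedAddCommGroup A] [InnerProductSpace ℂ A] [CompleteSpace A]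
    [TopologicalSpace.SeparableSpace A]
    [NormedAddCommGroup B] [InnerProductSpace ℂ B] [CompleteSpace B]
    [TopologicalSpace.SeparableSpace B]
    (H : Hamiltonian ι A) (hH : H.IsGrounded) (E : ℝ) (hE : 0 < E)
    (Δ : TraceClass A →ₗ[ℂ] TraceClass B) (hΔ : IsHermitianPreserving Δ) :
    (∀ (ρ : A →L[ℂ] A) (V : HTensor B A →L[ℂ] HTensor B A),
      IsFeasible H E ρ V → ∃ t : ℝ, HasTraceAgainstChoi Δ H V t) ∧
    ecDiamondNorm Δ H E < ∞ ∧
    IsLUB (primalValues Δ H E) (ecDiamondNorm Δ H E).toReal ∧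
    (H.IsDiscrete → IsGreatest (primalValues Δ H E) (ecDiamondNorm Δ H E).toReal) ∧
    (IsTraceAnnihilating Δ →
      IsLUB (simplifiedPrimalValues Δ H E) ((1 / 2) * (ecDiamondNorm Δ H E).toReal) ∧
      (H.IsDiscrete →
        IsGreatest (simplifiedPrimalValues Δ H E) ((1 / 2) * (ecDiamondNorm Δ H E).toReal)) ∧
      IsLeast (dualValues Δ H E) ((1 / 2) * (ecDiamondNorm Δ H E).toReal)) := by
  have hc := isLUB_primalValues hΔ hH hE
  have hfin : IsLUB (finValues Δ H E) (ecDiamondNorm Δ H E).toReal := by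
    rw [toReal_ecDiamondNorm hΔ hH hE]
    exact isLUB_finValues hΔ hE.le
  have hmax : H.IsDiscrete → IsGreatest (primalValues Δ H E) (ecDiamondNorm Δ H E).toReal :=
    fun hd => ⟨mem_primalValues_of_isLUB hΔ hE.le hd hc, hc.1⟩
  exact ⟨fun ρ V h => exists_hasTraceAgainstChoi hΔ hE.le h, ecDiamondNorm_lt_top hΔ hE.le, hc,
    hmax, fun hTA => ⟨isLUB_simplifiedPrimalValues hTA hc,
      fun hd => isGreatest_simplifiedPrimalValues hTA (hmax hd),
      isLeast_dualValues hΔ hTA hfin hE⟩⟩
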